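/- All graphs are finite and simple. A graph is matchable if it has a perfect matching (the graph without vertices is matchable). For a matchable graph $G$: * a global forcing set of $G$ is a set $S\subseteq E(G)$ such that $S\cap M_1\neq S\cap M_2$ for all distinct perfect matchings $M_1,M_2$ of $G$, and $gf(G)$ is the smallest size of a global forcing set of $G$; * for a perfect matching $M$ of $G$, $af(G,M)$ is the smallest size of a set $S\subseteq E(G)\setminus M$ such that $M$ is the only perfect matching of $G-S$, and $Af(G)$ is the maximum of $af(G,M)$ over all perfect matchings $M$ of $G$. A subgraph $H$ of a matchable graph $G$ is conformal if $G-V(H)$ is matchable. $G$ is strongly uniform if $gf(H)=Af(H)$ for each conformal matchable subgraph $H$ of $G$. A bisubdivision of a graph $J$ is a graph obtained from $J$ by replacing each edge in some set of edges with a path of odd length (with the same end-vertices), these paths being internally disjoint. $J$ is a conformal minor of $G$ if some conformal subgraph of $G$ is isomorphic to a bisubdivision of $J$. An edge of $G$ is allowed if it lies in some perfect matching of $G$, and the elementary components of $G$ are the connected components of the subgraph of $G$ formed by all allowed edges. Let $\mathcal A=\{A_1,A_2,A_3,A_4\}$, where $A_1$ consists of three internally disjoint paths of length $3$ with the same two end-vertices;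 $A_2$ is the cycle $v_1v_2\cdots v_8v_1$ with the two chords $v_1v_4$ and $v_1v_6$; $A_3$ is the cycle $v_1v_2\cdots v_{10}v_1$ with the two chords $v_1v_4$ and $v_6v_9$; and $A_4=K_{3,3}$. A chord of an even cycle $C$ is an edge that is not in $C$ but has both end-vertices on $C$. Fix a proper black-white colouring of the vertices. Two disjoint chords of $C$ are parallel if they can be written $x_1x_2$ and $y_1y_2$, with $x_1$ and $y_1$ of the same colour, such that their end-vertices occur along $C$ in the cyclic order $x_1,x_2,y_1,y_2$. They are strongly crossed if they can be written $x_1x_2$ and $y_1y_2$, with $x_1$ and $y_1$ of the same colour, such that their end-vertices occur along $C$ in the cyclic order $x_1,y_1,x_2,y_2$ and $x_1y_2,x_2y_1\in E(C)$. Let $\mathcal B_0$ be the set of even cycles (of length at least $4$), $\mathcal B_1$ the set of bipartite graphs consisting of a Hamilton cycle and exactly one chord, $\mathcal B_2$ the set of bipartite graphs consisting of a Hamilton cycle and exactly two chords, which are strongly crossed, and $\mathcal B_3$ the set of bipartite graphs consisting of a Hamilton cycle with pairwise parallel chords. Let $G$ be a matchable bipartite graph. Then the following three statements are equivalent: (i)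 $G$ is strongly uniform; (ii) no graph in $\mathcal A$ is a conformal minor of $G$; (iii) each elementary component of $G$ is $K_2$ or belongs to $\mathcal B_0\cup\mathcal B_1\cup\mathcal B_2\cup\mathcal B_3$. -/

import Mathlib

namespace StronglyUniform

open SimpleGraph

universe u v

/-- `𝓜(G)`: the set of all perfect matchings of `G`, each one given by its set of edges. -/
def perfectMatchings {V : Type u} (G : SimpleGraph V) : Set (Set (Sym2 V)) :=
  {M | ∃ P : G.Subgraph, P.IsPerfectMatching ∧ P.edgeSet = M}

/-- `G` is matchable: it has a perfect matching. The graph without vertices is matchable. -/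
def Matchable {V : Type u} (G : SimpleGraph V) : Prop :=
  (perfectMatchings G).Nonempty

/-! ### Anti-forcing and global forcing numbers -/

/-- `S ⊆ E(G) \ M` is an anti-forcing set of `M`: `M` is the only perfect matching of `G - S`. -/
def IsAntiForcingSet {V : Type u} (G : SimpleGraph V) (M S : Set (Sym2 V)) : Prop :=
  S ⊆ G.edgeSet \ M ∧ perfectMatchings (G.deleteEdges S) = {M}

/-- `af(G, M)`: the smallest size of an anti-forcing set of `M`. (For a perfect matching `M` of a
finite graph the set below is nonempty: `E(G) \ M` is an anti-forcing set.) -/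
noncomputable def af {V : Type u} (G : SimpleGraph V) (M : Set (Sym2 V)) : ℕ :=
  sInf {n | ∃ S : Set (Sym2 V), IsAntiForcingSet G M S ∧ S.ncard = n}

/-- `Af(G)`: the largest anti-forcing number of a perfect matching of `G`. (The set below is finite
for a finite graph, and nonempty for a matchable one.) -/
noncomputable def Af {V : Type u} (G : SimpleGraph V) : ℕ :=
  sSup {n | ∃ M ∈ perfectMatchings G, af G M = n}

/-- `S ⊆ E(G)` is a global forcing set of `G`: it distinguishes the perfect matchings of `G`. -/
def IsGlobalForcingSet {V : Type u} (G : SimpleGraph V) (S : Set (Sym2 V)) : Prop :=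
  S ⊆ G.edgeSet ∧
    ∀ M₁ ∈ perfectMatchings G, ∀ M₂ ∈ perfectMatchings G, M₁ ≠ M₂ → S ∩ M₁ ≠ S ∩ M₂

/-- `gf(G)`: the smallest size of a global forcing set of `G`. (`E(G)` is a global forcing set.) -/
noncomputable def gf {V : Type u} (G : SimpleGraph V) : ℕ :=
  sInf {n | ∃ S : Set (Sym2 V), IsGlobalForcingSet G S ∧ S.ncard = n}

/-! ### Conformal subgraphs and conformal minors -/

/-- A (not necessarily induced or spanning) subgraph `H` of `G` is conformal: `G - V(H)` is
matchable. -/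
def IsConformal {V : Type u} {G : SimpleGraph V} (H : G.Subgraph) : Prop :=
  Matchable (G.induce H.vertsᶜ)

/-- Every conformal matchable subgraph `H` of `G` satisfies `gf(H) = Af(H)`. -/
def IsStronglyUniform {V : Type u} (G : SimpleGraph V) : Prop :=
  ∀ H : G.Subgraph, IsConformal H → Matchable H.coe → gf H.coe = Af H.coe

/-- `H` is (up to isomorphism) a bisubdivision of `J`: it arises from `J` by replacing edges by
internally disjoint paths of odd length (length one leaves the edge as it is). The map `f` places
the vertices of `J`, and `P` gives the replacement paths, one for each edge, read in both
directions. -/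
def IsBisubdivision {U : Type u} {W : Type v} (J : SimpleGraph U) (H : SimpleGraph W) : Prop :=
  ∃ (f : U ↪ W) (P : ∀ ⦃a b : U⦄, J.Adj a b → H.Walk (f a) (f b)),
    -- both directions of an edge give the same path
    (∀ ⦃a b : U⦄ (h : J.Adj a b), P h.symm = (P h).reverse) ∧
    -- the replacement paths are paths of odd length
    (∀ ⦃a b : U⦄ (h : J.Adj a b), (P h).IsPath ∧ Odd (P h).length) ∧
    -- no vertex of `J` is an inner vertex of a replacement path
    (∀ ⦃a b : U⦄ (h : J.Adj a b) (c : U), f c ∈ (P h).support → c = a ∨ c = b) ∧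
    -- the replacement paths of distinct edges share no inner vertex
    (∀ ⦃a b : U⦄ (h : J.Adj a b) ⦃c d : U⦄ (k : J.Adj c d), s(a, b) ≠ s(c, d) →
      ∀ w : W, w ∈ (P h).support → w ∈ (P k).support → w ∈ Set.range f) ∧
    -- `H` has no other vertices
    (∀ w : W, w ∈ Set.range f ∨ ∃ (a b : U) (h : J.Adj a b), w ∈ (P h).support) ∧
    -- `H` has no other edges
    (∀ e ∈ H.edgeSet, ∃ (a b : U) (h : J.Adj a b), e ∈ (P h).edges)

/-- `J` is a conformal minor of `G`: some bisubdivision of `J` is a conformal subgraph of `G`. -/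
def IsConformalMinor {U : Type u} {V : Type v} (J : SimpleGraph U) (G : SimpleGraph V) : Prop :=
  ∃ H : G.Subgraph, IsConformal H ∧ IsBisubdivision J H.coe

/-! ### The four graphs in `𝓐` -/

/-- Three internally disjoint paths of length three between the vertices `0` and `1`. -/
def A₁ : SimpleGraph (Fin 8) :=
  SimpleGraph.fromEdgeSet
    {s(0, 2), s(2, 3), s(3, 1), s(0, 4), s(4, 5), s(5, 1), s(0, 6), s(6, 7), s(7, 1)}

/-- A cycle of length eight with two chords that share the end-vertex `0`; the distance along the
cycle from `0` to the other end-vertices of the chords is three. -/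
def A₂ : SimpleGraph (Fin 8) :=
  SimpleGraph.cycleGraph 8 ⊔ SimpleGraph.edge 0 3 ⊔ SimpleGraph.edge 0 5

/-- A cycle of length ten with two chords that are disjoint, and neither crossed nor parallel. -/
def A₃ : SimpleGraph (Fin 10) :=
  SimpleGraph.cycleGraph 10 ⊔ SimpleGraph.edge 0 3 ⊔ SimpleGraph.edge 5 8

/-- The complete bipartite graph `K₃,₃`. -/
def A₄ : SimpleGraph (Fin 3 ⊕ Fin 3) :=
  completeBipartiteGraph (Fin 3) (Fin 3)

/-! ### Elementary components -/

/-- The spanning subgraph of `G` formed by the allowed edges, that is, the edges that belong to a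
perfect matching of `G`. -/
def allowedGraph {V : Type u} (G : SimpleGraph V) : SimpleGraph V :=
  SimpleGraph.fromEdgeSet {e | ∃ M ∈ perfectMatchings G, e ∈ M}

/-- The elementary components of a matchable graph `G` are the components of the subgraph formed by
its allowed edges. (Every vertex of a matchable graph lies on an allowed edge.) -/
abbrev ElementaryComponent {V : Type u} (G : SimpleGraph V) : Type u :=
  (allowedGraph G).ConnectedComponent

/-- `G` is a complete graph with two vertices. -/
def IsK₂ {V : Type u} (G : SimpleGraph V) : Prop :=
  Nonempty (G ≃g completeGraph (Fin 2))

/-! ### Chords of a cycle and the classes `𝓑₀`, `𝓑₁`, `𝓑₂`, `𝓑₃` -/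

/-- The chords of a cycle `C`: the edges of `G` that are not in `C` but have both ends on `C`. -/
def chords {V : Type u} {G : SimpleGraph V} {r : V} (C : G.Walk r r) : Set (Sym2 V) :=
  {e | e ∈ G.edgeSet ∧ e ∉ C.edges ∧ ∀ x ∈ e, x ∈ C.support}

/-- The vertices `a`, `b`, `c`, `d` occur in this order along the cycle `C`, where we may start
anywhere on `C` and go round in either direction. (On a cycle, they are then distinct, since
`C.support.tail` lists every vertex of `C` once.) -/
def OrderedAlong {V : Type u} {G : SimpleGraph V} {r : V} (C : G.Walk r r) (a b c d : V) : Prop :=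
  ∃ l : List V, (l ~r C.support.tail ∨ l ~r C.support.tail.reverse) ∧
    List.Sublist [a, b, c, d] l

/-- The chords `e` and `f` of `C` are (disjoint and) parallel: `e = x₁x₂` and `f = y₁y₂`, where `x₁`
and `y₁` have the same colour and the order along `C` is `x₁, x₂, y₁, y₂`. -/
def AreParallel {V : Type u} {G : SimpleGraph V} (col : G.Coloring Bool) {r : V} (C : G.Walk r r)
    (e f : Sym2 V) : Prop :=
  ∃ x₁ x₂ y₁ y₂ : V, e = s(x₁, x₂) ∧ f = s(y₁, y₂) ∧ col x₁ = col y₁ ∧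
    OrderedAlong C x₁ x₂ y₁ y₂

/-- The chords `e` and `f` of `C` are (disjoint and) strongly crossed: `e = x₁x₂` and `f = y₁y₂`,
where `x₁` and `y₁` have the same colour, the order along `C` is `x₁, y₁, x₂, y₂`, and `x₁y₂` and
`x₂y₁` are edges of `C`. -/
def AreStronglyCrossed {V : Type u} {G : SimpleGraph V} (col : G.Coloring Bool) {r : V}
    (C : G.Walk r r) (e f : Sym2 V) : Prop :=
  ∃ x₁ x₂ y₁ y₂ : V, e = s(x₁, x₂) ∧ f = s(y₁, y₂) ∧ col x₁ = col y₁ ∧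
    OrderedAlong C x₁ y₁ x₂ y₂ ∧ s(x₁, y₂) ∈ C.edges ∧ s(x₂, y₁) ∈ C.edges

/-- `𝓑₀`: the even cycles. -/
def InB₀ {V : Type u} (G : SimpleGraph V) : Prop :=
  ∃ k : ℕ, 2 ≤ k ∧ Nonempty (G ≃g SimpleGraph.cycleGraph (2 * k))

open Classical in
/-- `𝓑₁`: bipartite graphs consisting of a Hamilton cycle and exactly one chord. -/
def InB₁ {V : Type u} (G : SimpleGraph V) : Prop :=
  G.IsBipartite ∧ ∃ (r : V) (C : G.Walk r r), C.IsHamiltonianCycle ∧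
    ∃ e : Sym2 V, chords C = {e}

open Classical in
/-- `𝓑₂`: graphs consisting of an (even) Hamilton cycle and exactly two strongly crossed chords.
(Such graphs are bipartite, since strongly crossed chords join vertices of different colours.) -/
def InB₂ {V : Type u} (G : SimpleGraph V) : Prop :=
  ∃ (col : G.Coloring Bool) (r : V) (C : G.Walk r r), C.IsHamiltonianCycle ∧
    ∃ e f : Sym2 V, e ≠ f ∧ chords C = {e, f} ∧ AreStronglyCrossed col C e f

open Classical in
/-- `𝓑₃`: bipartite graphs consisting of a Hamilton cycle with pairwise parallel chords. (With fewer
than two chords these are members of `𝓑₀` and `𝓑₁`.) -/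
def InB₃ {V : Type u} (G : SimpleGraph V) : Prop :=
  ∃ (col : G.Coloring Bool) (r : V) (C : G.Walk r r), C.IsHamiltonianCycle ∧
    (chords C).Pairwise (AreParallel col C)

end StronglyUniform

/-!
The numbers `gf` and `Af` depend only on the family of perfect matchings of a graph, so they are
studied for families of sets: `Uniform F d` says that both numbers of `F` are equal to `d`.

A strongly uniform graph has no conformal minor in `𝓐`. An odd path that replaces an edge contains
every second one of its edges in each perfect matching, so a bisubdivision `H` of `J` has the same
perfect matchings as `J`, and each edge of `H` has the same incidence with them as an edge of `J` or
the complement of such an incidence. Hence `gf H ≥ gf J` and `Af H ≤ Af J`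
(`IsStronglyUniform.not_isConformalMinor`), and each graph in `𝓐` satisfies `Af < gf`, by listing
its few perfect matchings.

Suppose that no graph in `𝓐` is a conformal minor, and let `K` be an elementary component with more
than one edge. It contains a conformal cycle: a cycle whose complement is matchable. A longest one
covers `K`, since an allowed edge leaving it would start an ear, and the ear gives either a longer
conformal cycle or a bisubdivision of `A₁` (`IsConformalCycle.range_eq_supp`). All edges of `K` not
in this Hamilton cycle are chords. Two chords with a common end give `A₂`, two uncrossed chords are
parallel or give `A₃`, and two crossing chords are strongly crossed or give `A₁`
(`parallelPos_or_stronglyCrossedPos`). A third chord besides two strongly crossed ones forces a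
`K₃,₃` on six vertices (`isConformalMinor_A₄_of_third`). So the component is in one of the classes.

Conversely, let a component consist of a Hamilton cycle `c` with chords. Record for each edge of the
cycle whether it is in the matching `M`, or the opposite, alternately. This code of `M` is constant
along `c` except at the ends of chords in `M`, where it goes up or down by one according to the
colour of the end (`mem_perfectMatchings_iff`). For parallel chords, choose for each chord the arc
from one colour to the other. These arcs are pairwise disjoint or pairwise cover the cycle, and
exchanging the colours replaces them by their complements, so they can be taken disjoint. Then the
matchings are: all sets `T` of chords, with code `0` off the arcs of `T`, and one more matching with
code `1` everywhere (`exists_isBumpFamily`). For a family of this form, counting shows that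
`gf` is the number of chords plus one, and the matching that contains all chords has an equal
anti-forcing number, because the symmetric differences with its neighbours are witnessed by
different edges (`IsBumpFamily.uniform_face`). Two strongly crossed chords give at most four
matchings, which form a square of two-bit codes (`Uniform.of_square`).

In both cases not only the family itself but each of its nonempty faces is uniform; a face consists
of the members that contain one given set and avoid another. The perfect matchings of a graph, and
of its faces, are products over the elementary components, and uniformity passes to products
(`Uniform.prod`). Finally, the perfect matchings of a conformal subgraph, together with a fixed
perfect matching of the remaining vertices, form a face of the perfect matchings of the whole graph
(`isStronglyUniform_of_facesUniform`).
-/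

namespace StronglyUniform

open SimpleGraph

/-! ### Global forcing and anti-forcing in families of sets -/

section Families

variable {E : Type*}

/-- `S` distinguishes the members of the family `F`. For the family of perfect matchings of a graph
these are the global forcing sets. -/
def Separates (F : Set (Set E)) (S : Set E) : Prop :=
  ∀ M₁ ∈ F, ∀ M₂ ∈ F, S ∩ M₁ = S ∩ M₂ → M₁ = M₂

/-- `S` avoids `M` and meets every other member of `F`. For the family of perfect matchings of a
graph these are the anti-forcing sets of `M`. -/
def Blocks (F : Set (Set E)) (M S : Set E) : Prop :=
  Disjoint S M ∧ ∀ M' ∈ F, M' ≠ M → (S ∩ M').Nonempty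

/-- The global forcing number and the maximum anti-forcing number of the family `F` are both equal
to `d`. -/
structure Uniform (F : Set (Set E)) (d : ℕ) : Prop where
  exists_sep : ∃ S, Separates F S ∧ S.ncard ≤ d
  le_sep : ∀ S, Separates F S → d ≤ S.ncard
  exists_block : ∀ M ∈ F, ∃ S, Blocks F M S ∧ S.ncard ≤ d
  le_block : ∃ M ∈ F, ∀ S, Blocks F M S → d ≤ S.ncard

lemma ncard_iUnion_le [Finite E] {ι : Type*} [Fintype ι] (S : ι → Set E) :
    (⋃ i, S i).ncard ≤ ∑ i, (S i).ncard := by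
  classical
  have : ∀ t : Finset ι, (⋃ i ∈ t, S i).ncard ≤ ∑ i ∈ t, (S i).ncard := by
    intro t
    induction t using Finset.induction_on with
    | empty => simp
    | insert a s ha ih =>
      rw [Finset.sum_insert ha, Finset.set_biUnion_insert]
      exact (Set.ncard_union_le _ _).trans (by omega)
  simpa using this Finset.univ

lemma sum_ncard_le [Finite E] {ι : Type*} [Fintype ι] (D : ι → Set E)
    (hD : Pairwise (Function.onFun Disjoint D)) (S : Set E) :
    ∑ i, (S ∩ D i).ncard ≤ S.ncard := by
  classical
  have : ∀ t : Finset ι, ∑ i ∈ t, (S ∩ D i).ncard = (⋃ i ∈ t, S ∩ D i).ncard := by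
    intro t
    induction t using Finset.induction_on with
    | empty => simp
    | insert a s ha ih =>
      rw [Finset.sum_insert ha, Finset.set_biUnion_insert, Set.ncard_union_eq, ih]
      rw [Set.disjoint_iUnion₂_right]
      intro i hi
      have hne : a ≠ i := fun h => ha (h ▸ hi)
      exact (hD hne).mono Set.inter_subset_right Set.inter_subset_right
  rw [this]
  exact Set.ncard_le_ncard (by simp)

/-- A set that meets each of `k` pairwise disjoint sets has at least `k` elements. -/
lemma card_le_of_meets [Finite E] {ι : Type*} [Fintype ι] (D : ι → Set E)
    (hD : Pairwise (Function.onFun Disjoint D)) (S : Set E) (h : ∀ i, (S ∩ D i).Nonempty) :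
    Fintype.card ι ≤ S.ncard := by
  refine le_trans ?_ (sum_ncard_le D hD S)
  rw [Fintype.card_eq_sum_ones]
  exact Finset.sum_le_sum fun i _ => (Set.ncard_pos).2 (h i)

lemma glue_inter {ι : Type*} {C : ι → Set E} (hC : Pairwise (Function.onFun Disjoint C))
    (m : ι → Set E) (i : ι) : (⋃ j, m j ∩ C j) ∩ C i = m i ∩ C i := by
  ext x
  simp only [Set.mem_inter_iff, Set.mem_iUnion]
  constructor
  · rintro ⟨⟨j, h1, h2⟩, h3⟩
    by_cases hij : j = i
    · subst hij; exact ⟨h1, h2⟩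
    · exact (Set.disjoint_left.1 (hC hij) h2 h3).elim
  · rintro ⟨h1, h2⟩
    exact ⟨⟨i, h1, h2⟩, h2⟩

/-- Both numbers are additive for products of families. -/
lemma Uniform.prod [Finite E] {ι : Type*} [Fintype ι] {F : Set (Set E)}
    (C : ι → Set E) (hC : Pairwise (Function.onFun Disjoint C)) (hcov : ∀ M ∈ F, M ⊆ ⋃ i, C i)
    (hglue : ∀ m : ι → Set E, (∀ i, m i ∈ F) → (⋃ i, m i ∩ C i) ∈ F) (d : ι → ℕ)
    (h : ∀ i, Uniform ((· ∩ C i) '' F) (d i)) : Uniform F (∑ i, d i) := by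
  classical
  have hdec : ∀ M ∈ F, M = ⋃ i, M ∩ C i := fun M hM => by
    rw [← Set.inter_iUnion, Set.inter_eq_left.2 (hcov M hM)]
  have hext : ∀ M ∈ F, ∀ N ∈ F, (∀ i, M ∩ C i = N ∩ C i) → M = N := fun M hM N hN hh => by
    rw [hdec M hM, hdec N hN]; simp_rw [hh]
  have hupd : ∀ m : ι → Set E, (∀ i, m i ∈ F) → ∀ i, ∀ N ∈ F,
      (⋃ j, Function.update m i N j ∩ C j) ∈ F := fun m hm i N hN => by
    apply hglue
    intro j
    by_cases hj : j = i
    · subst hj; simpa using hN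
    · simpa [hj] using hm j
  refine ⟨?_, ?_, ?_, ?_⟩
  · choose S hS hSd using fun i => (h i).exists_sep
    refine ⟨⋃ i, S i, ?_, (ncard_iUnion_le _).trans (Finset.sum_le_sum fun i _ => hSd i)⟩
    intro M hM N hN hMN
    refine hext M hM N hN fun i => hS i _ ⟨M, hM, rfl⟩ _ ⟨N, hN, rfl⟩ ?_
    ext x
    have := Set.ext_iff.1 hMN x
    simp only [Set.mem_inter_iff, Set.mem_iUnion] at this ⊢
    constructor
    · rintro ⟨h1, h2, h3⟩; exact ⟨h1, (this.1 ⟨⟨i, h1⟩, h2⟩).2, h3⟩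
    · rintro ⟨h1, h2, h3⟩; exact ⟨h1, (this.2 ⟨⟨i, h1⟩, h2⟩).2, h3⟩
  · intro S hS
    refine le_trans (Finset.sum_le_sum fun i _ => (h i).le_sep (S ∩ C i) ?_) (sum_ncard_le C hC S)
    rintro _ ⟨M, hM, rfl⟩ _ ⟨N, hN, rfl⟩ hMN
    have hN' := hupd (fun _ => M) (fun _ => hM) i N hN
    have : M = ⋃ j, Function.update (fun _ => M) i N j ∩ C j := by
      refine hS M hM _ hN' ?_
      ext x
      have hx := Set.ext_iff.1 hMN x
      simp only [Set.mem_inter_iff, Set.mem_iUnion] at hx ⊢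
      constructor
      · rintro ⟨h1, h2⟩
        obtain ⟨j, hj⟩ := Set.mem_iUnion.1 (hcov M hM h2)
        refine ⟨h1, j, ?_, hj⟩
        by_cases hji : j = i
        · subst hji
          simpa using (hx.1 ⟨⟨h1, hj⟩, h2, hj⟩).2.1
        · simpa [hji] using h2
      · rintro ⟨h1, j, h2, hj⟩
        refine ⟨h1, ?_⟩
        by_cases hji : j = i
        · subst hji
          rw [Function.update_self] at h2
          exact (hx.2 ⟨⟨h1, hj⟩, h2, hj⟩).2.1
        · simpa [hji] using h2
    have h2 := congrArg (· ∩ C i) this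
    simp only [glue_inter hC, Function.update_self] at h2
    exact h2
  · intro M hM
    choose S hS hSd using fun i => (h i).exists_block (M ∩ C i) ⟨M, hM, rfl⟩
    refine ⟨⋃ i, S i ∩ C i, ⟨?_, ?_⟩, (ncard_iUnion_le _).trans (Finset.sum_le_sum fun i _ =>
      (Set.ncard_le_ncard Set.inter_subset_left).trans (hSd i))⟩
    · rw [Set.disjoint_left]
      intro x hx hxM
      obtain ⟨i, h1, h2⟩ := Set.mem_iUnion.1 hx
      exact Set.disjoint_left.1 (hS i).1 h1 ⟨hxM, h2⟩
    · intro N hN hNM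
      obtain ⟨i, hi⟩ : ∃ i, N ∩ C i ≠ M ∩ C i := by
        by_contra! hcon
        exact hNM (hext N hN M hM hcon)
      obtain ⟨x, h1, h2, h3⟩ := (hS i).2 _ ⟨N, hN, rfl⟩ hi
      exact ⟨x, Set.mem_iUnion.2 ⟨i, h1, h3⟩, h2⟩
  · have hch : ∀ i, ∃ M ∈ F, ∀ S, Blocks ((· ∩ C i) '' F) (M ∩ C i) S → d i ≤ S.ncard := by
      intro i
      obtain ⟨_, ⟨M, hM, rfl⟩, h2⟩ := (h i).le_block
      exact ⟨M, hM, h2⟩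
    choose m hm hmd using hch
    refine ⟨_, hglue m hm, fun S hS =>
      le_trans (Finset.sum_le_sum fun i _ => hmd i (S ∩ C i) ⟨?_, ?_⟩) (sum_ncard_le C hC S)⟩
    · rw [Set.disjoint_left]
      rintro x ⟨h1, h2⟩ ⟨h3, -⟩
      exact Set.disjoint_left.1 hS.1 h1 (Set.mem_iUnion.2 ⟨i, h3, h2⟩)
    · rintro _ ⟨N, hN, rfl⟩ hne
      have hN' := hupd m hm i N hN
      obtain ⟨x, h1, h2⟩ := hS.2 _ hN' (by
        intro heq
        have h2 := congrArg (· ∩ C i) heq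
        simp only [glue_inter hC, Function.update_self] at h2
        exact hne h2)
      obtain ⟨j, h3, h4⟩ := Set.mem_iUnion.1 h2
      by_cases hji : j = i
      · subst hji
        rw [Function.update_self] at h3
        exact ⟨x, ⟨h1, h4⟩, h3, h4⟩
      · refine (Set.disjoint_left.1 hS.1 h1 (Set.mem_iUnion.2 ⟨j, ?_, h4⟩)).elim
        simpa [hji] using h3

/-- Adding a fixed set `N` of new elements to all members, and renaming the others, changes neither
number. -/
lemma Uniform.of_map {E' : Type*} [Finite E] [Finite E'] {F : Set (Set E)} {F' : Set (Set E')} {d : ℕ}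
    (φ : E' → E) (hφ : Function.Injective φ) (N : Set E) (hN : Disjoint N (Set.range φ))
    (h1 : ∀ M' ∈ F', φ '' M' ∪ N ∈ F) (h2 : ∀ M ∈ F, ∃ M' ∈ F', φ '' M' ∪ N = M)
    (h : Uniform F d) : Uniform F' d := by
  have hpre : ∀ M' : Set E', φ ⁻¹' (φ '' M' ∪ N) = M' := fun M' => by
    rw [Set.preimage_union, Set.preimage_image_eq _ hφ]
    rw [Set.preimage_eq_empty hN, Set.union_empty]
  have hinj : ∀ M' N' : Set E', φ '' M' ∪ N = φ '' N' ∪ N → M' = N' := fun M' N' hh => by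
    rw [← hpre M', hh, hpre]
  have hcard : ∀ S : Set E, (φ ⁻¹' S).ncard ≤ S.ncard := fun S => by
    rw [← Set.ncard_image_of_injective _ hφ]
    exact Set.ncard_le_ncard (Set.image_preimage_subset _ _)
  refine ⟨?_, ?_, ?_, ?_⟩
  · obtain ⟨S, hS, hd⟩ := h.exists_sep
    refine ⟨φ ⁻¹' S, fun M₁ hM₁ M₂ hM₂ he => hinj _ _ (hS _ (h1 _ hM₁) _ (h1 _ hM₂) ?_),
      (hcard S).trans hd⟩
    ext x
    constructor
    · rintro ⟨hxS, ⟨y, hy, rfl⟩ | hx⟩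
      · exact ⟨hxS, Or.inl ⟨y, ((Set.ext_iff.1 he y).1 ⟨hxS, hy⟩).2, rfl⟩⟩
      · exact ⟨hxS, Or.inr hx⟩
    · rintro ⟨hxS, ⟨y, hy, rfl⟩ | hx⟩
      · exact ⟨hxS, Or.inl ⟨y, ((Set.ext_iff.1 he y).2 ⟨hxS, hy⟩).2, rfl⟩⟩
      · exact ⟨hxS, Or.inr hx⟩
  · intro S hS
    rw [← Set.ncard_image_of_injective _ hφ]
    refine h.le_sep _ fun M₁ hM₁ M₂ hM₂ he => ?_
    obtain ⟨M₁, hM₁', rfl⟩ := h2 _ hM₁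
    obtain ⟨M₂, hM₂', rfl⟩ := h2 _ hM₂
    rw [hS M₁ hM₁' M₂ hM₂']
    ext x
    have := Set.ext_iff.1 he (φ x)
    have hx : φ x ∉ N := fun hx => Set.disjoint_left.1 hN hx ⟨x, rfl⟩
    simpa [hφ.eq_iff, hx] using this
  · intro M hM
    obtain ⟨S, hS, hd⟩ := h.exists_block _ (h1 M hM)
    refine ⟨φ ⁻¹' S, ⟨?_, ?_⟩, (hcard S).trans hd⟩
    · rw [Set.disjoint_left]
      exact fun x hx hxM => Set.disjoint_left.1 hS.1 hx (Or.inl ⟨x, hxM, rfl⟩)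
    · intro M' hM' hne
      obtain ⟨x, hxS, ⟨y, hy, rfl⟩ | hx⟩ := hS.2 _ (h1 M' hM') fun he => hne (hinj _ _ he)
      · exact ⟨y, hxS, hy⟩
      · exact (Set.disjoint_left.1 hS.1 hxS (Or.inr hx)).elim
  · obtain ⟨M, hM, hS⟩ := h.le_block
    obtain ⟨M, hM', rfl⟩ := h2 _ hM
    refine ⟨M, hM', fun S hSb => ?_⟩
    rw [← Set.ncard_image_of_injective _ hφ]
    refine hS _ ⟨?_, ?_⟩
    · rw [Set.disjoint_left]
      rintro _ ⟨x, hx, rfl⟩ (⟨y, hy, hyx⟩ | hx')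
      · rw [hφ hyx] at hy
        exact Set.disjoint_left.1 hSb.1 hx hy
      · exact Set.disjoint_left.1 hN hx' ⟨x, rfl⟩
    · intro M₁ hM₁ hne
      obtain ⟨M₁, hM₁', rfl⟩ := h2 _ hM₁
      obtain ⟨x, hx, hx'⟩ := hSb.2 M₁ hM₁' fun he => hne (by rw [he])
      exact ⟨φ x, ⟨x, hx, rfl⟩, Or.inl ⟨x, hx', rfl⟩⟩

/-! ### Antichains with one or two members -/

/-- The members of `F` are pairwise incomparable. -/
def IsAntichainFamily (F : Set (Set E)) : Prop := ∀ M ∈ F, ∀ N ∈ F, M ⊆ N → M = N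

lemma IsAntichainFamily.mono {F F' : Set (Set E)} (h : IsAntichainFamily F) (hF : F' ⊆ F) :
    IsAntichainFamily F' := fun M hM N hN => h M (hF hM) N (hF hN)

lemma Uniform.singleton (M : Set E) : Uniform {M} 0 := by
  refine ⟨⟨∅, ?_, by simp⟩, fun _ _ => Nat.zero_le _, ?_, ⟨M, rfl, fun _ _ => Nat.zero_le _⟩⟩
  · rintro _ rfl _ rfl _; rfl
  · rintro _ rfl
    exact ⟨∅, ⟨by simp, by rintro _ rfl h; exact (h rfl).elim⟩, by simp⟩

lemma Uniform.pair [Finite E] {M N : Set E} (hne : M ≠ N) (h : IsAntichainFamily {M, N}) :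
    Uniform {M, N} 1 := by
  have key : ∀ A ∈ ({M, N} : Set (Set E)), ∀ B ∈ ({M, N} : Set (Set E)), A ≠ B → ∃ x ∈ B, x ∉ A := by
    intro A hA B hB hAB
    by_contra! hcon
    exact hAB (h B hB A hA hcon).symm
  have h0 : ∀ S : Set E, S ≠ ∅ → 1 ≤ S.ncard := fun S hS =>
    (Set.ncard_pos).2 (Set.nonempty_iff_ne_empty.2 hS)
  refine ⟨?_, ?_, ?_, ?_⟩
  · obtain ⟨x, hx, hx'⟩ := key M (by simp) N (by simp) hne
    refine ⟨{x}, ?_, by simp⟩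
    intro A hA B hB hAB
    have := Set.ext_iff.1 hAB x
    rcases hA with rfl | rfl <;> rcases hB with rfl | rfl <;> simp_all
  · intro S hS
    refine h0 S ?_
    rintro rfl
    exact hne (hS M (by simp) N (by simp) (by simp))
  · intro A hA
    obtain ⟨B, hB, hAB, hall⟩ : ∃ B ∈ ({M, N} : Set (Set E)), A ≠ B ∧
        ∀ D ∈ ({M, N} : Set (Set E)), D ≠ A → D = B := by
      rcases hA with rfl | rfl
      · exact ⟨N, by simp, hne, by rintro _ (rfl | rfl) h; exacts [(h rfl).elim, rfl]⟩
      · exact ⟨M, by simp, hne.symm, by rintro _ (rfl | rfl) h; exacts [rfl, (h rfl).elim]⟩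
    obtain ⟨x, hx, hx'⟩ := key A hA B hB hAB
    refine ⟨{x}, ⟨by simpa using hx', ?_⟩, by simp⟩
    intro D hD hDA
    rw [hall D hD hDA]
    exact ⟨x, rfl, hx⟩
  · refine ⟨M, by simp, fun S hS => h0 S ?_⟩
    rintro rfl
    obtain ⟨x, hx, -⟩ := hS.2 N (by simp) hne.symm
    exact hx

end Families

/-! ### Squares and bump families -/

section Families

variable {E : Type*}

lemma ncard_pair_le (x y : E) : ({x, y} : Set E).ncard ≤ 2 :=
  (Set.ncard_insert_le _ _).trans (by simp)

lemma exists_corner : ∀ a₀ b₀ a₁ b₁ a₂ b₂ : Bool, (a₀, b₀) ≠ (a₁, b₁) → (a₀, b₀) ≠ (a₂, b₂) →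
    (a₁, b₁) ≠ (a₂, b₂) →
    (a₁ = !a₀ ∧ b₁ = b₀ ∧ a₂ = a₀ ∧ b₂ = !b₀) ∨ (a₂ = !a₀ ∧ b₂ = b₀ ∧ a₁ = a₀ ∧ b₁ = !b₀) ∨
    (a₀ = !a₁ ∧ b₀ = b₁ ∧ a₂ = a₁ ∧ b₂ = !b₁) ∨ (a₂ = !a₁ ∧ b₂ = b₁ ∧ a₀ = a₁ ∧ b₀ = !b₁) ∨
    (a₀ = !a₂ ∧ b₀ = b₂ ∧ a₁ = a₂ ∧ b₁ = !b₂) ∨ (a₁ = !a₂ ∧ b₁ = b₂ ∧ a₀ = a₂ ∧ b₀ = !b₂) := by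
  decide

/-- The members of `F` are coded by the two bits `p ∈ M`, `q ∈ M`, and no element is a disjunction
of two literals in these bits. Then every nonempty subfamily is uniform: if it has at least three
members, it contains a member together with both of its neighbours in the square of codes, and no
single element lies in both neighbours but not in the member itself. -/
lemma Uniform.of_square [Finite E] {F : Set (Set E)} (hanti : IsAntichainFamily F) (p p' q q' : E)
    (hp : ∀ M ∈ F, (p' ∈ M ↔ p ∉ M)) (hq : ∀ M ∈ F, (q' ∈ M ↔ q ∉ M))
    (htype : ∀ x, ∃ g : Prop → Prop → Prop, (∀ M ∈ F, (x ∈ M ↔ g (p ∈ M) (q ∈ M))) ∧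
      ∀ a b, g (¬ a) b → g a (¬ b) → g a b)
    {F' : Set (Set E)} (hF : F' ⊆ F) (hne : F'.Nonempty) : ∃ d, Uniform F' d := by
  classical
  have hcode : ∀ M ∈ F, ∀ N ∈ F, (p ∈ M ↔ p ∈ N) → (q ∈ M ↔ q ∈ N) → M = N := by
    intro M hM N hN h1 h2
    ext x
    obtain ⟨g, hg, -⟩ := htype x
    rw [hg M hM, hg N hN, propext h1, propext h2]
  obtain ⟨M₀, h₀⟩ := hne
  by_cases hs : ∃ M₁ ∈ F', M₁ ≠ M₀
  swap
  · push Not at hs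
    have : F' = {M₀} := Set.eq_singleton_iff_unique_mem.2 ⟨h₀, hs⟩
    exact ⟨0, this ▸ Uniform.singleton M₀⟩
  obtain ⟨M₁, h₁, hne₁⟩ := hs
  by_cases hs : ∃ M₂ ∈ F', M₂ ≠ M₀ ∧ M₂ ≠ M₁
  swap
  · push Not at hs
    have : F' = {M₀, M₁} := by
      ext M
      constructor
      · intro hM
        by_cases h : M = M₀
        · exact Or.inl h
        · exact Or.inr (hs M hM h)
      · rintro (rfl | rfl) <;> assumption
    refine ⟨1, this ▸ Uniform.pair hne₁.symm ?_⟩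
    exact this ▸ hanti.mono hF
  obtain ⟨M₂, h₂, hne₂, hne₃⟩ := hs
  obtain ⟨A, hA, B, hB, D, hD, hBp, hBq, hDp, hDq⟩ : ∃ A ∈ F', ∃ B ∈ F', ∃ D ∈ F',
      (p ∈ B ↔ ¬ p ∈ A) ∧ (q ∈ B ↔ q ∈ A) ∧ (p ∈ D ↔ p ∈ A) ∧ (q ∈ D ↔ ¬ q ∈ A) := by
    have hd : ∀ M ∈ F', ∀ N ∈ F', M ≠ N →
        (decide (p ∈ M), decide (q ∈ M)) ≠ (decide (p ∈ N), decide (q ∈ N)) := by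
      intro M hM N hN hMN h
      simp only [Prod.mk.injEq, decide_eq_decide] at h
      exact hMN (hcode M (hF hM) N (hF hN) h.1 h.2)
    have hdec : ∀ X Y : Prop, decide X = !decide Y ↔ (X ↔ ¬ Y) := by
      intro X Y; by_cases X <;> by_cases Y <;> simp [*]
    have := exists_corner _ _ _ _ _ _ (hd M₀ h₀ M₁ h₁ hne₁.symm) (hd M₀ h₀ M₂ h₂ hne₂.symm)
      (hd M₁ h₁ M₂ h₂ hne₃.symm)
    simp only [hdec, decide_eq_decide] at this
    rcases this with h | h | h | h | h | h
    · exact ⟨M₀, h₀, M₁, h₁, M₂, h₂, h⟩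
    · exact ⟨M₀, h₀, M₂, h₂, M₁, h₁, h⟩
    · exact ⟨M₁, h₁, M₀, h₀, M₂, h₂, h⟩
    · exact ⟨M₁, h₁, M₂, h₂, M₀, h₀, h⟩
    · exact ⟨M₂, h₂, M₀, h₀, M₁, h₁, h⟩
    · exact ⟨M₂, h₂, M₁, h₁, M₀, h₀, h⟩
  have hcard : ∀ S : Set E, S.ncard < 2 → S = ∅ ∨ ∃ x, S = {x} := by
    intro S hS
    interval_cases h : S.ncard
    · exact Or.inl ((Set.ncard_eq_zero).1 h)
    · exact Or.inr (Set.ncard_eq_one.1 h)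
  have hAB : A ≠ B := by rintro rfl; exact iff_not_self hBp
  have hAD : A ≠ D := by rintro rfl; exact iff_not_self hDq
  have hBD : B ≠ D := by rintro rfl; exact iff_not_self (hDp.symm.trans hBp)
  refine ⟨2, ?_, ?_, ?_, ?_⟩
  · refine ⟨{p, q}, ?_, ncard_pair_le _ _⟩
    intro M hM N hN h
    have h1 := Set.ext_iff.1 h p
    have h2 := Set.ext_iff.1 h q
    simp only [Set.mem_inter_iff, Set.mem_insert_iff, Set.mem_singleton_iff, true_or, or_true,
      true_and] at h1 h2
    exact hcode M (hF hM) N (hF hN) h1 h2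
  · intro S hS
    by_contra! hlt
    rcases hcard S hlt with rfl | ⟨x, rfl⟩
    · exact hAB (hS A hA B hB (by simp))
    · have : ∀ M ∈ F', ∀ N ∈ F', (x ∈ M ↔ x ∈ N) → M = N := by
        intro M hM N hN h
        refine hS M hM N hN ?_
        ext y
        simp only [Set.mem_inter_iff, Set.mem_singleton_iff]
        constructor
        · rintro ⟨rfl, hy⟩; exact ⟨rfl, h.1 hy⟩
        · rintro ⟨rfl, hy⟩; exact ⟨rfl, h.2 hy⟩
      have e1 := mt (this A hA B hB) hAB
      have e2 := mt (this A hA D hD) hAD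
      have e3 := mt (this B hB D hD) hBD
      have hno : ∀ a b c : Prop, ¬ (a ↔ b) → ¬ (a ↔ c) → ¬ (b ↔ c) → False := by
        clear * -; intro a b c; tauto
      exact hno _ _ _ e1 e2 e3
  · intro M hM
    refine ⟨{if p ∈ M then p' else p, if q ∈ M then q' else q}, ⟨?_, ?_⟩, ncard_pair_le _ _⟩
    · rw [Set.disjoint_left]
      rintro x (rfl | rfl)
      · split_ifs with h
        · rw [hp M (hF hM)]; exact not_not.2 h
        · exact h
      · split_ifs with h
        · rw [hq M (hF hM)]; exact not_not.2 h
        · exact h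
    · intro N hN hNM
      by_cases h : p ∈ M ↔ p ∈ N
      · refine ⟨_, Or.inr rfl, ?_⟩
        have h' : ¬ (q ∈ M ↔ q ∈ N) := fun h' => hNM (hcode M (hF hM) N (hF hN) h h').symm
        split_ifs with h1
        · rw [hq N (hF hN)]
          exact fun hh => h' ⟨fun _ => hh, fun _ => h1⟩
        · by_contra hh
          exact h' ⟨fun h => (h1 h).elim, fun h => (hh h).elim⟩
      · refine ⟨_, Or.inl rfl, ?_⟩
        split_ifs with h1
        · rw [hp N (hF hN)]
          exact fun hh => h ⟨fun _ => hh, fun _ => h1⟩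
        · by_contra hh
          exact h ⟨fun h => (h1 h).elim, fun h => (hh h).elim⟩
  · refine ⟨A, hA, fun S hS => ?_⟩
    by_contra! hlt
    rcases hcard S hlt with rfl | ⟨x, rfl⟩
    · obtain ⟨x, hx, -⟩ := hS.2 B hB hAB.symm
      exact hx
    · have hxA : x ∉ A := by simpa using hS.1
      have hxB : x ∈ B := by simpa using hS.2 B hB hAB.symm
      have hxD : x ∈ D := by simpa using hS.2 D hD hAD.symm
      obtain ⟨g, hg, hg'⟩ := htype x
      rw [hg _ (hF hA)] at hxA
      rw [hg _ (hF hB), propext hBp, propext hBq] at hxB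
      rw [hg _ (hF hD), propext hDp, propext hDq] at hxD
      exact hxA (hg' _ _ hxB hxD)

/-- The members of `F` that contain `X` and avoid `Y`. -/
def face (F : Set (Set E)) (X Y : Set E) : Set (Set E) := {M ∈ F | X ⊆ M ∧ Disjoint Y M}

/-- The members of `F` are coded by `q ∈ M` and the set of all `i` with `ch i ∈ M`; the codes are
all codes with `q ∉ M`, and a single code with `q ∈ M`, for which no `ch i` is in `M`. Every element
depends only on `q`, on a single `ch i`, or on the disjunction `q ∨ ch i`, whose negation is
`a i`. -/
structure IsBumpFamily {I : Type*} (F : Set (Set E)) (q : E) (ch a : I → E) : Prop where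
  anti : IsAntichainFamily F
  ch_notMem : ∀ M ∈ F, q ∈ M → ∀ i, ch i ∉ M
  mem_a : ∀ M ∈ F, ∀ i, (a i ∈ M ↔ q ∉ M ∧ ch i ∉ M)
  cases : ∀ x, (∀ M ∈ F, x ∉ M) ∨ (∀ M ∈ F, (x ∈ M ↔ q ∈ M)) ∨ (∀ M ∈ F, (x ∈ M ↔ q ∉ M)) ∨
    ∃ i, (∀ M ∈ F, (x ∈ M ↔ ch i ∈ M)) ∨ (∀ M ∈ F, (x ∈ M ↔ a i ∈ M)) ∨
      (∀ M ∈ F, (x ∈ M ↔ a i ∉ M))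
  exists_code : ∀ T : Set I, ∃ M ∈ F, q ∉ M ∧ ∀ i, (ch i ∈ M ↔ i ∈ T)
  exists_q : ∃ M ∈ F, q ∈ M

namespace IsBumpFamily

variable {I : Type*} {F : Set (Set E)} {q : E} {ch a : I → E}

lemma ext (h : IsBumpFamily F q ch a) {M N : Set E} (hM : M ∈ F) (hN : N ∈ F)
    (hq : q ∈ M ↔ q ∈ N) (hch : ∀ i, (ch i ∈ M ↔ ch i ∈ N)) : M = N := by
  ext x
  rcases h.cases x with h1 | h1 | h1 | ⟨i, h1 | h1 | h1⟩
  · simp [h1 M hM, h1 N hN]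
  · rw [h1 M hM, h1 N hN, hq]
  · rw [h1 M hM, h1 N hN, hq]
  · rw [h1 M hM, h1 N hN, hch]
  · rw [h1 M hM, h1 N hN, h.mem_a M hM, h.mem_a N hN, hq, hch]
  · rw [h1 M hM, h1 N hN, h.mem_a M hM, h.mem_a N hN, hq, hch]

/-- The indices whose code bit is not constant on the members of the family `F'` without `q`. -/
def free (F' : Set (Set E)) (q : E) (ch : I → E) : Set I :=
  {i | (∃ M ∈ F', ch i ∈ M) ∧ ∃ M ∈ F', q ∉ M ∧ ch i ∉ M}

/-- The free code bits of a face can be chosen arbitrarily. -/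
lemma exists_free (h : IsBumpFamily F q ch a) {X Y : Set E} {M₀ : Set E} (h₀ : M₀ ∈ face F X Y)
    (hq : q ∉ M₀) (T : Set I) (hT : ∀ i ∉ free (face F X Y) q ch, (i ∈ T ↔ ch i ∈ M₀)) :
    ∃ M ∈ face F X Y, q ∉ M ∧ ∀ i, (ch i ∈ M ↔ i ∈ T) := by
  obtain ⟨M, hM, hqM, hch⟩ := h.exists_code T
  -- an element that depends on a free bit is neither in `X` nor in `Y`
  have key : ∀ x, (x ∈ M ↔ x ∈ M₀) ∨ (x ∉ X ∧ x ∉ Y) := by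
    intro x
    have hfree : ∀ i, (∀ N ∈ F, q ∉ N → (x ∈ N ↔ ch i ∈ N)) ∨ (∀ N ∈ F, q ∉ N → (x ∈ N ↔ ch i ∉ N)) →
        (x ∈ M ↔ x ∈ M₀) ∨ (x ∉ X ∧ x ∉ Y) := by
      intro i hi
      by_cases hif : i ∈ free (face F X Y) q ch
      · right
        obtain ⟨⟨N₁, hN₁, hc₁⟩, ⟨N₂, hN₂, hq₂, hc₂⟩⟩ := hif
        have hq₁ : q ∉ N₁ := fun hq' => h.ch_notMem N₁ hN₁.1 hq' i hc₁
        have e1 : ∀ N ∈ face F X Y, x ∈ X → x ∈ N := fun N hN hx => hN.2.1 hx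
        have e2 : ∀ N ∈ face F X Y, x ∈ Y → x ∉ N := fun N hN hx =>
          Set.disjoint_left.1 hN.2.2 hx
        have e3 := e1 _ hN₁
        have e4 := e1 _ hN₂
        have e5 := e2 _ hN₁
        have e6 := e2 _ hN₂
        rcases hi with hi | hi
        · rw [hi _ hN₁.1 hq₁] at e3 e5
          rw [hi _ hN₂.1 hq₂] at e4 e6
          tauto
        · rw [hi _ hN₁.1 hq₁] at e3 e5
          rw [hi _ hN₂.1 hq₂] at e4 e6
          tauto
      · left
        have := hT i hif
        rcases hi with hi | hi
        · rw [hi M hM hqM, hi M₀ h₀.1 hq, hch, this]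
        · rw [hi M hM hqM, hi M₀ h₀.1 hq, hch, this]
    rcases h.cases x with h1 | h1 | h1 | ⟨i, h1 | h1 | h1⟩
    · left; simp [h1 M hM, h1 M₀ h₀.1]
    · left; rw [h1 M hM, h1 M₀ h₀.1]; tauto
    · left; rw [h1 M hM, h1 M₀ h₀.1]; tauto
    · exact hfree i (Or.inl fun N hN _ => h1 N hN)
    · exact hfree i (Or.inr fun N hN hqN => by rw [h1 N hN, h.mem_a N hN]; tauto)
    · exact hfree i (Or.inl fun N hN hqN => by rw [h1 N hN, h.mem_a N hN]; tauto)
  refine ⟨M, ⟨hM, fun x hx => ?_, Set.disjoint_left.2 fun x hx hxM => ?_⟩, hqM, hch⟩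
  · rcases key x with h1 | h1
    · exact h1.2 (h₀.2.1 hx)
    · exact (h1.1 hx).elim
  · rcases key x with h1 | h1
    · exact Set.disjoint_left.1 h₀.2.2 hx (h1.1 hxM)
    · exact h1.2 hx

/-- Every nonempty face of a bump family is uniform. -/
lemma uniform_face [Finite E] [Finite I] (h : IsBumpFamily F q ch a) (X Y : Set E)
    (hne : (face F X Y).Nonempty) : ∃ d, Uniform (face F X Y) d := by
  classical
  have := Fintype.ofFinite I
  set F' := face F X Y with hF'
  have hsub : F' ⊆ F := fun M hM => hM.1
  set U := free F' q ch with hU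
  by_cases hq0 : ∀ M ∈ F', q ∈ M
  · obtain ⟨M₀, h₀⟩ := hne
    have : F' = {M₀} := Set.eq_singleton_iff_unique_mem.2 ⟨h₀, fun M hM =>
      h.ext hM.1 h₀.1 (by simp [hq0 M hM, hq0 M₀ h₀]) fun i => by
        simp [h.ch_notMem M hM.1 (hq0 M hM), h.ch_notMem M₀ h₀.1 (hq0 M₀ h₀)]⟩
    exact ⟨0, this ▸ Uniform.singleton M₀⟩
  push Not at hq0
  obtain ⟨M₀, h₀, hq₀⟩ := hq0
  -- outside `U` the code bits are constant on the members without `q`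
  have hconst : ∀ i ∉ U, ∀ M ∈ F', q ∉ M → (ch i ∈ M ↔ ch i ∈ M₀) := by
    intro i hi M hM hqM
    by_contra hcon
    refine hi ⟨?_, ?_⟩
    · by_cases hc : ch i ∈ M
      · exact ⟨M, hM, hc⟩
      · exact ⟨M₀, h₀, by tauto⟩
    · by_cases hc : ch i ∈ M
      · exact ⟨M₀, h₀, hq₀, by tauto⟩
      · exact ⟨M, hM, hqM, hc⟩
  have hcube : ∀ T : Set U, ∃ M ∈ F', q ∉ M ∧ (∀ i : U, (ch i ∈ M ↔ i ∈ T)) ∧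
      ∀ i ∉ U, (ch i ∈ M ↔ ch i ∈ M₀) := by
    intro T
    obtain ⟨M, hM, hqM, hch⟩ := h.exists_free h₀ hq₀
      {i | if hi : i ∈ U then (⟨i, hi⟩ : U) ∈ T else ch i ∈ M₀} (fun i hi => by
        have hi' : i ∉ U := hi
        simp [hi'])
    exact ⟨M, hM, hqM, fun i => by simp [hch], fun i hi => by simp [hch, hi]⟩
  choose mk mkF mkq mkch mkch' using hcube
  have mk_inj : Function.Injective mk := by
    intro T T' hTT
    ext i
    rw [← mkch, ← mkch, hTT]
  have hextU : ∀ M ∈ F', ∀ N ∈ F', q ∉ M → q ∉ N → (∀ i : U, (ch i ∈ M ↔ ch i ∈ N)) → M = N := by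
    intro M hM N hN hqM hqN hc
    refine h.ext hM.1 hN.1 (by tauto) fun i => ?_
    by_cases hi : i ∈ U
    · exact hc ⟨i, hi⟩
    · rw [hconst i hi M hM hqM, hconst i hi N hN hqN]
  -- for `M` without `q`, flipping the code bits of `M` one by one
  have hblock : ∀ M ∈ F', q ∉ M → ∀ N ∈ F', q ∉ N → N ≠ M →
      ∃ i : U, (if ch i ∈ M then a i else ch i) ∈ N := by
    intro M hM hqM N hN hqN hne
    by_contra! hcon
    refine hne (hextU N hN M hM hqN hqM fun i => ?_)
    have := hcon i
    split_ifs at this with hc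
    · rw [h.mem_a N hN.1] at this; tauto
    · tauto
  have hdis : ∀ M ∈ F', q ∉ M → ∀ i : U, (if ch i ∈ M then a i else ch i) ∉ M := by
    intro M hM hqM i
    split_ifs with hc
    · rw [h.mem_a M hM.1]; tauto
    · exact hc
  have hcardle : ∀ M : Set E, (Set.range fun i : U => if ch i ∈ M then a i else ch i).ncard ≤
      Fintype.card U := by
    intro M
    rw [← Set.image_univ, ← Nat.card_eq_fintype_card, ← Set.ncard_univ]
    exact Set.ncard_image_le
  have hcardch : (Set.range fun i : U => ch i).ncard ≤ Fintype.card U := by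
    rw [← Set.image_univ, ← Nat.card_eq_fintype_card, ← Set.ncard_univ]
    exact Set.ncard_image_le
  have hpow : ∀ S : Set E, Nat.card (Set S) = 2 ^ S.ncard := by
    intro S
    have := Fintype.ofFinite S
    rw [Nat.card_eq_fintype_card, Fintype.card_set, ← Nat.card_eq_fintype_card,
      Nat.card_coe_set_eq]
  -- the element that separates `mk univ` from the member with the bit `i` flipped
  have hflip : ∀ (i : U) x, x ∈ mk (Set.univ \ {i}) → x ∉ mk Set.univ →
      ∀ M ∈ F, (x ∈ M ↔ a i ∈ M) := by
    intro i x hx hx'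
    have hm1 := mkF (Set.univ \ {i})
    have hm2 := mkF Set.univ
    have hq1 := mkq (Set.univ \ {i})
    have hq2 := mkq Set.univ
    have hc : ∀ j, j ≠ i.1 → (ch j ∈ mk (Set.univ \ {i}) ↔ ch j ∈ mk Set.univ) := by
      intro j hj
      by_cases hjU : j ∈ U
      · have h1 := mkch (Set.univ \ {i}) ⟨j, hjU⟩
        have h2 := mkch Set.univ ⟨j, hjU⟩
        have h3 : (⟨j, hjU⟩ : U) ≠ i := fun hh => hj (congrArg Subtype.val hh)
        simp only [Set.mem_sdiff, Set.mem_univ, Set.mem_singleton_iff, h3] at h1 h2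
        tauto
      · rw [mkch' _ j hjU, mkch' _ j hjU]
    have hci1 : ch i ∉ mk (Set.univ \ {i}) := by rw [mkch]; simp
    have hci2 : ch i ∈ mk Set.univ := by rw [mkch]; simp
    rcases h.cases x with h1 | h1 | h1 | ⟨j, hj⟩
    · exact (h1 _ hm1.1 hx).elim
    · rw [h1 _ hm1.1] at hx; exact (hq1 hx).elim
    · rw [h1 _ hm2.1] at hx'; exact (hx' hq2).elim
    · have hji : j = i.1 := by
        by_contra hji
        have hcj := hc j hji
        rcases hj with h1 | h1 | h1
        · rw [h1 _ hm1.1] at hx; rw [h1 _ hm2.1] at hx'; tauto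
        · rw [h1 _ hm1.1, h.mem_a _ hm1.1] at hx; rw [h1 _ hm2.1, h.mem_a _ hm2.1] at hx'; tauto
        · rw [h1 _ hm1.1, h.mem_a _ hm1.1] at hx; rw [h1 _ hm2.1, h.mem_a _ hm2.1] at hx'; tauto
      subst hji
      rcases hj with h1 | h1 | h1
      · rw [h1 _ hm1.1] at hx; exact (hci1 hx).elim
      · exact h1
      · rw [h1 _ hm1.1, h.mem_a _ hm1.1] at hx; tauto
  have hflipne : ∀ i : U, mk (Set.univ \ {i}) ≠ mk Set.univ := by
    intro i hh
    have := Set.ext_iff.1 (mk_inj hh) i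
    simp at this
  have haone : ∀ i j : U, (∀ M ∈ F, (a i ∈ M ↔ a j ∈ M)) → i = j := by
    intro i j hij
    by_contra hne
    have h1 := hij _ (mkF {i}).1
    rw [h.mem_a _ (mkF {i}).1, h.mem_a _ (mkF {i}).1, mkch, mkch] at h1
    have hq1 := mkq {i}
    simp only [Set.mem_singleton_iff] at h1
    have hne' : j ≠ i := fun hh => hne hh.symm
    tauto
  by_cases hq1 : ∀ M ∈ F', q ∉ M
  · refine ⟨Fintype.card U, ⟨Set.range fun i : U => ch i, ?_, hcardch⟩, ?_, ?_, ?_⟩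
    · intro M hM N hN hMN
      refine hextU M hM N hN (hq1 M hM) (hq1 N hN) fun i => ?_
      simpa using Set.ext_iff.1 hMN (ch i)
    · intro S hS
      have hinj : Function.Injective (fun T : Set U => {x : S | x.1 ∈ mk T}) := by
        intro T T' hTT
        refine mk_inj (hS _ (mkF T) _ (mkF T') ?_)
        ext x
        constructor
        · rintro ⟨hx, hxT⟩
          exact ⟨hx, (Set.ext_iff.1 hTT ⟨x, hx⟩).1 hxT⟩
        · rintro ⟨hx, hxT⟩
          exact ⟨hx, (Set.ext_iff.1 hTT ⟨x, hx⟩).2 hxT⟩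
      have hle := Nat.card_le_card_of_injective _ hinj
      rw [hpow, Nat.card_eq_fintype_card, Fintype.card_set] at hle
      exact (Nat.pow_le_pow_iff_right (by norm_num)).1 hle
    · intro M hM
      refine ⟨_, ⟨?_, ?_⟩, hcardle M⟩
      · rw [Set.disjoint_left]
        rintro _ ⟨i, rfl⟩
        exact hdis M hM (hq1 M hM) i
      · intro N hN hNM
        obtain ⟨i, hi⟩ := hblock M hM (hq1 M hM) N hN (hq1 N hN) hNM
        exact ⟨_, ⟨i, rfl⟩, hi⟩
    · refine ⟨mk Set.univ, mkF _, fun S hS => ?_⟩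
      refine card_le_of_meets (fun i : U => mk (Set.univ \ {i}) \ mk Set.univ) ?_ S ?_
      · intro i j hij
        rw [Function.onFun, Set.disjoint_left]
        rintro x ⟨hx1, hx2⟩ ⟨hx3, -⟩
        exact hij (haone i j fun M hM => by
          rw [← hflip i x hx1 hx2 M hM, hflip j x hx3 hx2 M hM])
      · intro i
        obtain ⟨x, hx, hx'⟩ := hS.2 _ (mkF (Set.univ \ {i})) (hflipne i)
        exact ⟨x, hx, hx', fun h' => Set.disjoint_left.1 hS.1 hx h'⟩
  · push Not at hq1
    obtain ⟨Q, hQ, hqQ⟩ := hq1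
    have hQu : ∀ M ∈ F', q ∈ M → M = Q := fun M hM hqM => h.ext hM.1 hQ.1 (by tauto) fun i => by
      simp [h.ch_notMem M hM.1 hqM, h.ch_notMem Q hQ.1 hqQ]
    have hins : ∀ S : Set E, S.ncard ≤ Fintype.card U →
        (insert q S).ncard ≤ Fintype.card U + 1 := fun S hS =>
      (Set.ncard_insert_le _ _).trans (by omega)
    refine ⟨Fintype.card U + 1, ⟨insert q (Set.range fun i : U => ch i), ?_, hins _ hcardch⟩,
      ?_, ?_, ?_⟩
    · intro M hM N hN hMN
      have hqq : q ∈ M ↔ q ∈ N := by simpa using Set.ext_iff.1 hMN q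
      by_cases hqM : q ∈ M
      · rw [hQu M hM hqM, hQu N hN (hqq.1 hqM)]
      · refine hextU M hM N hN hqM (by tauto) fun i => ?_
        simpa using Set.ext_iff.1 hMN (ch i)
    · intro S hS
      have hinj : Function.Injective
          (fun T : Option (Set U) => {x : S | x.1 ∈ (T.elim Q mk : Set E)}) := by
        have hF : ∀ T : Option (Set U), (T.elim Q mk : Set E) ∈ F' := by
          rintro (_ | T)
          · exact hQ
          · exact mkF T
        intro T T' hTT
        have heq : (T.elim Q mk : Set E) = T'.elim Q mk := by
          refine hS _ (hF T) _ (hF T') ?_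
          ext x
          constructor
          · rintro ⟨hx, hxT⟩
            exact ⟨hx, (Set.ext_iff.1 hTT ⟨x, hx⟩).1 hxT⟩
          · rintro ⟨hx, hxT⟩
            exact ⟨hx, (Set.ext_iff.1 hTT ⟨x, hx⟩).2 hxT⟩
        rcases T with _ | T <;> rcases T' with _ | T'
        · rfl
        · simp only [Option.elim] at heq
          exact (mkq T' (heq ▸ hqQ)).elim
        · simp only [Option.elim] at heq
          exact (mkq T (heq ▸ hqQ)).elim
        · simp only [Option.elim] at heq
          rw [mk_inj heq]
      have hle := Nat.card_le_card_of_injective _ hinj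
      rw [hpow, Nat.card_eq_fintype_card, Fintype.card_option, Fintype.card_set] at hle
      exact (Nat.pow_lt_pow_iff_right (by norm_num)).1 (Nat.lt_of_succ_le hle)
    · intro M hM
      by_cases hqM : q ∈ M
      · obtain rfl := hQu M hM hqM
        by_cases hUe : Nonempty U
        · obtain ⟨i⟩ := hUe
          have hpos : 0 < Fintype.card U := Fintype.card_pos_iff.2 ⟨i⟩
          refine ⟨{ch i, a i}, ⟨?_, ?_⟩, (ncard_pair_le _ _).trans (by omega)⟩
          · rw [Set.disjoint_left]
            rintro x (rfl | rfl)
            · exact h.ch_notMem _ hM.1 hqM i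
            · rw [h.mem_a _ hM.1]; tauto
          · intro N hN hNM
            have hqN : q ∉ N := fun hh => hNM (hQu N hN hh)
            by_cases hc : ch i ∈ N
            · exact ⟨_, Or.inl rfl, hc⟩
            · exact ⟨_, Or.inr rfl, by rw [h.mem_a _ hN.1]; tauto⟩
        · -- only `M₀` remains, and it is not contained in `M`
          obtain ⟨x, hx, hx'⟩ : ∃ x ∈ M₀, x ∉ M := by
            by_contra! hcon
            have := h.anti _ h₀.1 _ hM.1 hcon
            exact hq₀ (this ▸ hqM)
          refine ⟨{x}, ⟨by simpa using hx', ?_⟩, by simp⟩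
          intro N hN hNM
          have hqN : q ∉ N := fun hh => hNM (hQu N hN hh)
          rw [hextU N hN M₀ h₀ hqN hq₀ fun i => (hUe ⟨i⟩).elim]
          exact ⟨x, rfl, hx⟩
      · refine ⟨_, ⟨?_, ?_⟩, hins _ (hcardle M)⟩
        · rw [Set.disjoint_left]
          rintro x (rfl | ⟨i, rfl⟩)
          · exact hqM
          · exact hdis M hM hqM i
        · intro N hN hNM
          by_cases hqN : q ∈ N
          · exact ⟨q, Or.inl rfl, hqN⟩
          · obtain ⟨i, hi⟩ := hblock M hM hqM N hN hqN hNM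
            exact ⟨_, Or.inr ⟨i, rfl⟩, hi⟩
    · refine ⟨mk Set.univ, mkF _, fun S hS => ?_⟩
      rw [← Fintype.card_option]
      refine card_le_of_meets (fun i : Option U =>
        (i.elim Q fun i => mk (Set.univ \ {i})) \ mk Set.univ) ?_ S ?_
      · have hQi : ∀ (i : U) x, x ∈ mk (Set.univ \ {i}) → x ∉ mk Set.univ → x ∉ Q := by
          intro i x hx hx'
          rw [hflip i x hx hx' Q hQ.1, h.mem_a _ hQ.1]; tauto
        intro i j hij
        rw [Function.onFun, Set.disjoint_left]
        rcases i with _ | i <;> rcases j with _ | j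
        · exact (hij rfl).elim
        · rintro x ⟨hx1, hx2⟩ ⟨hx3, -⟩
          exact hQi j x hx3 hx2 hx1
        · rintro x ⟨hx1, hx2⟩ ⟨hx3, -⟩
          exact hQi i x hx1 hx2 hx3
        · rintro x ⟨hx1, hx2⟩ ⟨hx3, -⟩
          refine hij (congrArg some (haone i j fun M hM => by
            rw [← hflip i x hx1 hx2 M hM, hflip j x hx3 hx2 M hM]))
      · rintro (_ | i)
        · obtain ⟨x, hx, hx'⟩ := hS.2 Q hQ fun hh => mkq Set.univ (hh ▸ hqQ)
          exact ⟨x, hx, hx', fun h' => Set.disjoint_left.1 hS.1 hx h'⟩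
        · obtain ⟨x, hx, hx'⟩ := hS.2 _ (mkF (Set.univ \ {i})) (hflipne i)
          exact ⟨x, hx, hx', fun h' => Set.disjoint_left.1 hS.1 hx h'⟩

end IsBumpFamily

end Families

/-! ### Perfect matchings as sets of edges -/

section PerfectMatchings

variable {V : Type*} {G : SimpleGraph V}

lemma mem_perfectMatchings {M : Set (Sym2 V)} :
    M ∈ perfectMatchings G ↔ M ⊆ G.edgeSet ∧ ∀ v, ∃! w, s(v, w) ∈ M := by
  constructor
  · rintro ⟨P, hP, rfl⟩
    exact ⟨P.edgeSet_subset, fun v => by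
      simpa using Subgraph.isPerfectMatching_iff.1 hP v⟩
  · rintro ⟨h1, h2⟩
    refine ⟨⟨Set.univ, fun v w => s(v, w) ∈ M, fun h => h1 h, fun _ => trivial,
      ⟨fun v w h => by rwa [Sym2.eq_swap]⟩⟩, Subgraph.isPerfectMatching_iff.2 h2, ?_⟩
    ext e
    induction e with
    | h v w => simp

lemma perfectMatchings_antichain : IsAntichainFamily (perfectMatchings G) := by
  intro M hM N hN hMN
  rw [mem_perfectMatchings] at hM hN
  refine Set.Subset.antisymm hMN fun e he => ?_
  induction e with
  | h v w =>
    obtain ⟨x, hx, -⟩ := hM.2 v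
    rwa [(hN.2 v).unique he (hMN hx)]

lemma perfectMatchings_deleteEdges (S : Set (Sym2 V)) :
    perfectMatchings (G.deleteEdges S) = {M ∈ perfectMatchings G | Disjoint S M} := by
  ext M
  simp only [mem_perfectMatchings, edgeSet_deleteEdges, Set.mem_ofPred_eq, Set.subset_sdiff,
    disjoint_comm (a := S)]
  tauto

lemma isAntiForcingSet_iff {M S : Set (Sym2 V)} (hM : M ∈ perfectMatchings G) :
    IsAntiForcingSet G M S ↔ S ⊆ G.edgeSet ∧ Blocks (perfectMatchings G) M S := by
  rw [IsAntiForcingSet, perfectMatchings_deleteEdges, Blocks, Set.subset_sdiff,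
    Set.eq_singleton_iff_unique_mem]
  constructor
  · rintro ⟨⟨h1, h2⟩, -, h3⟩
    refine ⟨h1, h2, fun N hN hNM => ?_⟩
    by_contra hcon
    exact hNM (h3 N ⟨hN, Set.disjoint_iff_inter_eq_empty.2 (Set.not_nonempty_iff_eq_empty.1 hcon)⟩)
  · rintro ⟨h1, h2, h3⟩
    refine ⟨⟨h1, h2⟩, ⟨hM, h2⟩, fun N hN => ?_⟩
    by_contra hcon
    obtain ⟨x, hx, hx'⟩ := h3 N hN.1 hcon
    exact Set.disjoint_left.1 hN.2 hx hx'

lemma separates_inter_edgeSet {S : Set (Sym2 V)} (hS : Separates (perfectMatchings G) S) :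
    Separates (perfectMatchings G) (S ∩ G.edgeSet) := by
  intro M hM N hN h
  have hM' := (mem_perfectMatchings.1 hM).1
  have hN' := (mem_perfectMatchings.1 hN).1
  rw [Set.inter_assoc, Set.inter_assoc, Set.inter_eq_right.2 hM', Set.inter_eq_right.2 hN'] at h
  exact hS M hM N hN h

lemma blocks_inter_edgeSet {M S : Set (Sym2 V)} (hS : Blocks (perfectMatchings G) M S) :
    Blocks (perfectMatchings G) M (S ∩ G.edgeSet) := by
  refine ⟨hS.1.mono_left Set.inter_subset_left, fun N hN hNM => ?_⟩
  obtain ⟨x, hx, hx'⟩ := hS.2 N hN hNM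
  exact ⟨x, ⟨hx, (mem_perfectMatchings.1 hN).1 hx'⟩, hx'⟩

lemma isGlobalForcingSet_iff {S : Set (Sym2 V)} :
    IsGlobalForcingSet G S ↔ S ⊆ G.edgeSet ∧ Separates (perfectMatchings G) S := by
  rw [IsGlobalForcingSet, Separates]
  refine and_congr_right fun _ => ⟨fun h M hM N hN => ?_, fun h M hM N hN => ?_⟩
  · exact not_imp_not.1 (h M hM N hN)
  · exact mt (h M hM N hN)

lemma gf_le [Finite V] {S : Set (Sym2 V)} (hS : Separates (perfectMatchings G) S) :
    gf G ≤ S.ncard := by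
  refine le_trans ?_ (Set.ncard_le_ncard (Set.inter_subset_left (t := G.edgeSet)))
  exact Nat.sInf_le ⟨S ∩ G.edgeSet, isGlobalForcingSet_iff.2 ⟨Set.inter_subset_right,
    separates_inter_edgeSet hS⟩, rfl⟩

lemma separates_univ (F : Set (Set (Sym2 V))) : Separates F Set.univ := by
  intro M _ N _ h
  simpa using h

lemma le_gf {d : ℕ} (h : ∀ S, Separates (perfectMatchings G) S → d ≤ S.ncard) : d ≤ gf G := by
  unfold gf
  apply le_csInf
  · refine ⟨_, G.edgeSet, isGlobalForcingSet_iff.2 ⟨subset_rfl, ?_⟩, rfl⟩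
    simpa using separates_inter_edgeSet (separates_univ (perfectMatchings G))
  · rintro _ ⟨S, hS, rfl⟩
    exact h S (isGlobalForcingSet_iff.1 hS).2

lemma blocks_compl {M : Set (Sym2 V)} (hM : M ∈ perfectMatchings G) :
    Blocks (perfectMatchings G) M Mᶜ := by
  refine ⟨disjoint_compl_left, fun N hN hNM => ?_⟩
  by_contra hcon
  refine hNM (perfectMatchings_antichain N hN M hM fun x hx => ?_)
  by_contra hxM
  exact hcon ⟨x, hxM, hx⟩

lemma af_le [Finite V] {M S : Set (Sym2 V)} (hM : M ∈ perfectMatchings G)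
    (hS : Blocks (perfectMatchings G) M S) : af G M ≤ S.ncard := by
  refine le_trans ?_ (Set.ncard_le_ncard (Set.inter_subset_left (t := G.edgeSet)))
  exact Nat.sInf_le ⟨S ∩ G.edgeSet, (isAntiForcingSet_iff hM).2 ⟨Set.inter_subset_right,
    blocks_inter_edgeSet hS⟩, rfl⟩

lemma le_af {d : ℕ} {M : Set (Sym2 V)} (hM : M ∈ perfectMatchings G)
    (h : ∀ S, Blocks (perfectMatchings G) M S → d ≤ S.ncard) : d ≤ af G M := by
  unfold af
  apply le_csInf
  · exact ⟨_, Mᶜ ∩ G.edgeSet, (isAntiForcingSet_iff hM).2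
      ⟨Set.inter_subset_right, blocks_inter_edgeSet (blocks_compl hM)⟩, rfl⟩
  · rintro _ ⟨S, hS, rfl⟩
    exact h S ((isAntiForcingSet_iff hM).1 hS).2

lemma Af_le [Finite V] {d : ℕ} (h : ∀ M ∈ perfectMatchings G,
    ∃ S, Blocks (perfectMatchings G) M S ∧ S.ncard ≤ d) : Af G ≤ d := by
  refine csSup_le' ?_
  rintro _ ⟨M, hM, rfl⟩
  obtain ⟨S, hS, hd⟩ := h M hM
  exact (af_le hM hS).trans hd

lemma le_Af [Finite V] {d : ℕ} {M : Set (Sym2 V)} (hM : M ∈ perfectMatchings G)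
    (h : ∀ S, Blocks (perfectMatchings G) M S → d ≤ S.ncard) : d ≤ Af G := by
  refine (le_af hM h).trans (le_csSup ⟨Nat.card (Sym2 V), ?_⟩ ⟨M, hM, rfl⟩)
  rintro _ ⟨N, hN, rfl⟩
  exact (af_le hN (blocks_compl hN)).trans (Set.ncard_le_card _)

lemma gf_eq_Af [Finite V] {d : ℕ} (h : Uniform (perfectMatchings G) d) : gf G = Af G := by
  obtain ⟨S, hS, hSd⟩ := h.exists_sep
  obtain ⟨M, hM, hMd⟩ := h.le_block
  have h1 := (gf_le hS).trans hSd
  have h2 := le_gf h.le_sep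
  have h3 := Af_le h.exists_block
  have h4 := le_Af hM hMd
  omega

end PerfectMatchings

/-! ### Perfect matchings of a bisubdivision -/

lemma mem_edges_iff_getVert {V : Type*} {G : SimpleGraph V} {u v : V} (p : G.Walk u v)
    {e : Sym2 V} :
    e ∈ p.edges ↔ ∃ i < p.length, e = s(p.getVert i, p.getVert (i + 1)) := by
  induction p with
  | nil => simp
  | cons h p ih =>
    rw [Walk.edges_cons, List.mem_cons, ih]
    constructor
    · rintro (rfl | ⟨i, hi, rfl⟩)
      · exact ⟨0, by simp, by simp⟩
      · exact ⟨i + 1, by simpa using hi, by simp⟩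
    · rintro ⟨i, hi, rfl⟩
      rcases i with _ | i
      · left; simp
      · right; exact ⟨i, by simpa using hi, by simp⟩

/-- The data of a bisubdivision `H` of `J`, with the path that replaces an edge given by its
sequence of vertices `p h 0, …, p h (L h)`. -/
structure BisubdivisionPaths {U W : Type*} (J : SimpleGraph U) (H : SimpleGraph W) where
  /-- the position of the vertices of `J` -/
  f : U → W
  /-- the vertices of the replacement paths -/
  p : ∀ {a b : U}, J.Adj a b → ℕ → W
  /-- the lengths of the replacement paths -/
  L : ∀ {a b : U}, J.Adj a b → ℕ
  f_inj : Function.Injective f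
  p_zero : ∀ {a b : U} (h : J.Adj a b), p h 0 = f a
  p_symm : ∀ {a b : U} (h : J.Adj a b) (i : ℕ), p h.symm i = p h (L h - i)
  L_symm : ∀ {a b : U} (h : J.Adj a b), L h.symm = L h
  L_odd : ∀ {a b : U} (h : J.Adj a b), Odd (L h)
  p_inj : ∀ {a b : U} (h : J.Adj a b) {i j : ℕ}, i ≤ L h → j ≤ L h → p h i = p h j → i = j
  p_adj : ∀ {a b : U} (h : J.Adj a b) {i : ℕ}, i < L h → H.Adj (p h i) (p h (i + 1))
  branch : ∀ {a b : U} (h : J.Adj a b) {i : ℕ} {c : U}, i ≤ L h → p h i = f c → c = a ∨ c = b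
  disj : ∀ {a b : U} (h : J.Adj a b) {c d : U} (k : J.Adj c d), s(a, b) ≠ s(c, d) →
    ∀ {i j : ℕ}, i ≤ L h → j ≤ L k → p h i = p k j → p h i ∈ Set.range f
  vert : ∀ w, w ∈ Set.range f ∨ ∃ (a b : U) (h : J.Adj a b), ∃ i ≤ L h, w = p h i
  edge : ∀ {w w' : W}, H.Adj w w' → ∃ (a b : U) (h : J.Adj a b), ∃ i < L h,
    s(w, w') = s(p h i, p h (i + 1))

namespace BisubdivisionPaths

variable {U W : Type*} {J : SimpleGraph U} {H : SimpleGraph W}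

lemma exists_of_isBisubdivision (h : IsBisubdivision J H) : Nonempty (BisubdivisionPaths J H) := by
  obtain ⟨f, P, hsymm, hpath, hbr, hdisj, hv, he⟩ := h
  have hr : ∀ ⦃a b : U⦄ (h : J.Adj a b) {w}, w ∈ (P h).support →
      ∃ i ≤ (P h).length, w = (P h).getVert i := by
    intro a b h w hw
    obtain ⟨i, hi, hi'⟩ := Walk.mem_support_iff_exists_getVert.1 hw
    exact ⟨i, hi', hi.symm⟩
  refine ⟨⟨f, fun h => (P h).getVert, fun h => (P h).length, f.injective, fun h => by simp,
    fun h i => ?_, fun h => ?_, fun h => (hpath h).2, fun h i j hi hj hij =>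
      (hpath h).1.getVert_injOn hi hj hij, fun h i hi => (P h).adj_getVert_succ hi,
    fun h i c hi hc => ?_, fun h c d k hne i j hi hj hij => ?_, fun w => ?_, fun {w w'} hw => ?_⟩⟩
  · rw [hsymm, Walk.getVert_reverse]
  · rw [hsymm, Walk.length_reverse]
  · exact hbr h c (hc ▸ (P h).getVert_mem_support i)
  · exact hdisj h k hne _ ((P h).getVert_mem_support i) (hij ▸ (P k).getVert_mem_support j)
  · rcases hv w with h | ⟨a, b, h, hw⟩
    · exact Or.inl h
    · exact Or.inr ⟨a, b, h, hr h hw⟩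
  · obtain ⟨a, b, h, hh⟩ := he s(w, w') hw
    exact ⟨a, b, h, (mem_edges_iff_getVert _).1 hh⟩

variable (D : BisubdivisionPaths J H)
include D

lemma p_L {a b : U} (h : J.Adj a b) : D.p h (D.L h) = D.f b := by
  have := D.p_symm h.symm (D.L h)
  rwa [D.L_symm h, Nat.sub_self, D.p_zero] at this

lemma L_pos {a b : U} (h : J.Adj a b) : 0 < D.L h := (D.L_odd h).pos

lemma inner_notMem {a b : U} (h : J.Adj a b) {i : ℕ} (h0 : 0 < i) (hi : i < D.L h) :
    D.p h i ∉ Set.range D.f := by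
  rintro ⟨c, hc⟩
  rcases D.branch h hi.le hc.symm with rfl | rfl
  · rw [← D.p_zero h] at hc
    have := D.p_inj h (Nat.zero_le _) hi.le hc
    omega
  · rw [← D.p_L h] at hc
    have := D.p_inj h le_rfl hi.le hc
    omega

lemma adj_inner {a b : U} (h : J.Adj a b) {i : ℕ} (h0 : 0 < i) (hi : i < D.L h) {w : W}
    (hw : H.Adj (D.p h i) w) : w = D.p h (i - 1) ∨ w = D.p h (i + 1) := by
  have hnot := D.inner_notMem h h0 hi
  -- an edge at `p h i` lies on the path of `h`
  have key : ∀ j < D.L h, s(D.p h i, w) = s(D.p h j, D.p h (j + 1)) →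
      w = D.p h (i - 1) ∨ w = D.p h (i + 1) := by
    intro j hj he
    rcases Sym2.eq_iff.1 he with ⟨h1, h2⟩ | ⟨h1, h2⟩
    · have := D.p_inj h hi.le hj.le h1
      subst this
      exact Or.inr h2
    · have := D.p_inj h hi.le hj h1
      subst this
      exact Or.inl h2
  obtain ⟨c, d, k, j, hj, he⟩ := D.edge hw
  have hcd : s(a, b) = s(c, d) := by
    by_contra hne
    rcases Sym2.eq_iff.1 he with ⟨h1, -⟩ | ⟨h1, -⟩
    · exact hnot (D.disj h k hne hi.le hj.le h1)
    · exact hnot (D.disj h k hne hi.le hj h1)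
  rcases Sym2.eq_iff.1 hcd with ⟨rfl, rfl⟩ | ⟨rfl, rfl⟩
  · exact key j hj he
  · have hL : D.L k = D.L h := D.L_symm h
    have e1 : D.p k j = D.p h (D.L h - j) := D.p_symm h j
    have e2 : D.p k (j + 1) = D.p h (D.L h - (j + 1)) := D.p_symm h (j + 1)
    rw [e1, e2, Sym2.eq_swap (a := D.p h (D.L h - j))] at he
    refine key (D.L h - (j + 1)) (by omega) ?_
    rwa [show D.L h - (j + 1) + 1 = D.L h - j by omega]

lemma adj_branch {a : U} {w : W} (hw : H.Adj (D.f a) w) :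
    ∃ (b : U) (h : J.Adj a b), w = D.p h 1 := by
  have key : ∀ (b : U) (h : J.Adj a b), ∀ j < D.L h,
      s(D.f a, w) = s(D.p h j, D.p h (j + 1)) → w = D.p h 1 := by
    intro b h j hj he
    rw [← D.p_zero h] at he
    rcases Sym2.eq_iff.1 he with ⟨h1, h2⟩ | ⟨h1, h2⟩
    · have := D.p_inj h (Nat.zero_le _) hj.le h1
      subst this
      exact h2
    · have := D.p_inj h (Nat.zero_le _) hj h1
      omega
  obtain ⟨c, d, k, j, hj, he⟩ := D.edge hw
  have hacd : a = c ∨ a = d := by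
    rcases Sym2.eq_iff.1 he with ⟨h1, -⟩ | ⟨h1, -⟩
    · exact D.branch k hj.le h1.symm
    · exact D.branch k hj h1.symm
  rcases hacd with rfl | rfl
  · exact ⟨d, k, key d k j hj he⟩
  · refine ⟨c, k.symm, key c k.symm (D.L k - (j + 1)) (by rw [D.L_symm k]; omega) ?_⟩
    rw [he, D.p_symm k, D.p_symm k, Sym2.eq_swap, show D.L k - (D.L k - (j + 1)) = j + 1 by omega,
      show D.L k - (D.L k - (j + 1) + 1) = j by omega]

lemma p_one_inj {a b b' : U} (h : J.Adj a b) (k : J.Adj a b') (he : D.p h 1 = D.p k 1) :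
    b = b' := by
  by_contra hne
  have hs : s(a, b) ≠ s(a, b') := by
    intro hs
    rcases Sym2.eq_iff.1 hs with ⟨-, h1⟩ | ⟨rfl, h1⟩
    · exact hne h1
    · exact h.ne h1.symm
  have hL := D.L_pos h
  have hL' := D.L_pos k
  obtain ⟨c, hc⟩ := D.disj h k hs hL hL' he
  have hca : c ≠ a := by
    rintro rfl
    rw [← D.p_zero h] at hc
    have := D.p_inj h (Nat.zero_le _) hL hc
    omega
  have h1 := (D.branch h hL hc.symm).resolve_left hca
  have h2 := (D.branch k hL' (he ▸ hc.symm)).resolve_left hca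
  exact hne (h1 ▸ h2)

/-- The first edge of the replacement path of `ab`. -/
def first {a b : U} (h : J.Adj a b) : Sym2 W := s(D.p h 0, D.p h 1)

section Projection

variable {N : Set (Sym2 W)} (hN : N ∈ perfectMatchings H)
include hN

lemma mem_succ {a b : U} (h : J.Adj a b) {i : ℕ} (hi : i + 1 < D.L h) :
    s(D.p h (i + 1), D.p h (i + 2)) ∈ N ↔ s(D.p h i, D.p h (i + 1)) ∉ N := by
  obtain ⟨hsub, huniq⟩ := mem_perfectMatchings.1 hN
  obtain ⟨w, hw, hw'⟩ := huniq (D.p h (i + 1))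
  have hadj : H.Adj (D.p h (i + 1)) w := hsub hw
  constructor
  · intro h1 h2
    rw [Sym2.eq_swap] at h2
    have := (huniq (D.p h (i + 1))).unique h1 h2
    have := D.p_inj h (by omega) (by omega) this
    omega
  · intro h2
    rcases D.adj_inner h (Nat.succ_pos i) hi hadj with rfl | rfl
    · rw [Sym2.eq_swap] at hw
      exact (h2 hw).elim
    · exact hw

lemma mem_iff_first {a b : U} (h : J.Adj a b) {i : ℕ} (hi : i < D.L h) :
    s(D.p h i, D.p h (i + 1)) ∈ N ↔ (D.first h ∈ N ↔ Even i) := by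
  induction i with
  | zero => simp [first]
  | succ i ih =>
    rw [D.mem_succ hN h hi, ih (by omega), Nat.even_add_one]
    tauto

lemma first_symm_mem {a b : U} (h : J.Adj a b) : D.first h.symm ∈ N ↔ D.first h ∈ N := by
  have hL := D.L_pos h
  have h1 : D.first h.symm = s(D.p h (D.L h - 1), D.p h (D.L h - 1 + 1)) := by
    rw [first, D.p_symm h, D.p_symm h, Sym2.eq_swap, Nat.sub_zero, Nat.sub_add_cancel hL]
  have h2 : Even (D.L h - 1) := by
    have := D.L_odd h
    rw [Nat.even_sub' (by omega)]
    simpa using this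
  rw [h1, D.mem_iff_first hN h (by omega)]
  simp [h2]

end Projection

/-- The perfect matching of `J` that corresponds to a perfect matching `N` of `H`. -/
def proj (N : Set (Sym2 W)) : Set (Sym2 U) :=
  {e | ∃ (a b : U) (h : J.Adj a b), e = s(a, b) ∧ D.first h ∈ N}

/-- The perfect matching of `H` that corresponds to a perfect matching `M` of `J`. -/
def lift (M : Set (Sym2 U)) : Set (Sym2 W) :=
  {e | ∃ (a b : U) (h : J.Adj a b), ∃ i < D.L h, e = s(D.p h i, D.p h (i + 1)) ∧
    (s(a, b) ∈ M ↔ Even i)}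

lemma mem_proj {N : Set (Sym2 W)} (hN : N ∈ perfectMatchings H) {a b : U} (h : J.Adj a b) :
    s(a, b) ∈ D.proj N ↔ D.first h ∈ N := by
  constructor
  · rintro ⟨c, d, k, he, hk⟩
    rcases Sym2.eq_iff.1 he with ⟨rfl, rfl⟩ | ⟨rfl, rfl⟩
    · exact hk
    · exact (D.first_symm_mem hN h).1 hk
  · intro hh
    exact ⟨a, b, h, rfl, hh⟩

lemma proj_subset (N : Set (Sym2 W)) : D.proj N ⊆ J.edgeSet := by
  rintro _ ⟨a, b, h, rfl, -⟩
  exact h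

lemma proj_mem {N : Set (Sym2 W)} (hN : N ∈ perfectMatchings H) :
    D.proj N ∈ perfectMatchings J := by
  refine mem_perfectMatchings.2 ⟨D.proj_subset N, fun a => ?_⟩
  obtain ⟨hsub, huniq⟩ := mem_perfectMatchings.1 hN
  obtain ⟨w, hw, -⟩ := huniq (D.f a)
  obtain ⟨b, h, rfl⟩ := D.adj_branch (hsub hw)
  refine ⟨b, (D.mem_proj hN h).2 (by rwa [first, D.p_zero]), fun b' hb' => ?_⟩
  have h' : J.Adj a b' := D.proj_subset N hb'
  have hf := (D.mem_proj hN h').1 hb'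
  rw [first, D.p_zero] at hf
  exact D.p_one_inj h' h ((huniq (D.f a)).unique hf hw)

lemma edge_unique {a b c d : U} (h : J.Adj a b) (k : J.Adj c d) {i j : ℕ} (hi : i < D.L h)
    (hj : j < D.L k) (he : s(D.p h i, D.p h (i + 1)) = s(D.p k j, D.p k (j + 1))) :
    s(a, b) = s(c, d) ∧ (Even i ↔ Even j) := by
  -- a replacement path both ends of one of whose edges are branch vertices has length one
  have hone : ∀ {a b : U} (h : J.Adj a b) {i : ℕ}, i < D.L h → D.p h i ∈ Set.range D.f →
      D.p h (i + 1) ∈ Set.range D.f → s(D.p h i, D.p h (i + 1)) = s(D.f a, D.f b) := by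
    intro a b h i hi h1 h2
    have h3 : i = 0 := by
      by_contra h0
      exact D.inner_notMem h (by omega) hi h1
    have h4 : i + 1 = D.L h := by
      by_contra h0
      exact D.inner_notMem h (by omega) (by omega) h2
    rw [h4, D.p_L, h3, D.p_zero]
  have hs : s(a, b) = s(c, d) := by
    by_contra hne
    have h12 : D.p h i ∈ Set.range D.f ∧ D.p h (i + 1) ∈ Set.range D.f := by
      rcases Sym2.eq_iff.1 he with ⟨h1, h2⟩ | ⟨h1, h2⟩
      · exact ⟨D.disj h k hne hi.le hj.le h1, D.disj h k hne hi hj h2⟩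
      · exact ⟨D.disj h k hne hi.le hj h1, D.disj h k hne hi hj.le h2⟩
    have h34 : D.p k j ∈ Set.range D.f ∧ D.p k (j + 1) ∈ Set.range D.f := by
      rcases Sym2.eq_iff.1 he with ⟨h1, h2⟩ | ⟨h1, h2⟩
      · exact ⟨h1 ▸ h12.1, h2 ▸ h12.2⟩
      · exact ⟨h2 ▸ h12.2, h1 ▸ h12.1⟩
    rw [hone h hi h12.1 h12.2, hone k hj h34.1 h34.2] at he
    refine hne ?_
    rcases Sym2.eq_iff.1 he with ⟨h1, h2⟩ | ⟨h1, h2⟩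
    · rw [D.f_inj h1, D.f_inj h2]
    · rw [D.f_inj h1, D.f_inj h2, Sym2.eq_swap]
  refine ⟨hs, ?_⟩
  rcases Sym2.eq_iff.1 hs with ⟨rfl, rfl⟩ | ⟨rfl, rfl⟩
  · rcases Sym2.eq_iff.1 he with ⟨h1, h2⟩ | ⟨h1, h2⟩
    · rw [D.p_inj h hi.le hj.le h1]
    · have e1 := D.p_inj h hi.le hj h1
      have e2 := D.p_inj h hi hj.le h2
      omega
  · have hL : D.L k = D.L h := D.L_symm h
    have e1 : D.p k j = D.p h (D.L h - j) := D.p_symm h j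
    have e2 : D.p k (j + 1) = D.p h (D.L h - (j + 1)) := D.p_symm h (j + 1)
    rw [e1, e2] at he
    rcases Sym2.eq_iff.1 he with ⟨h1, h2⟩ | ⟨h1, h2⟩
    · have e1 := D.p_inj h hi.le (by omega) h1
      have e2 := D.p_inj h hi (by omega) h2
      omega
    · have e3 := D.p_inj h hi.le (by omega) h1
      obtain ⟨m, hm⟩ := D.L_odd h
      rw [Nat.even_iff, Nat.even_iff]
      omega

lemma mem_lift {M : Set (Sym2 U)} {a b : U} (h : J.Adj a b) {i : ℕ} (hi : i < D.L h) :
    s(D.p h i, D.p h (i + 1)) ∈ D.lift M ↔ (s(a, b) ∈ M ↔ Even i) := by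
  constructor
  · rintro ⟨c, d, k, j, hj, he, hM⟩
    obtain ⟨h1, h2⟩ := D.edge_unique h k hi hj he
    rw [h1, h2, hM]
  · intro hM
    exact ⟨a, b, h, i, hi, rfl, hM⟩

lemma lift_subset (M : Set (Sym2 U)) : D.lift M ⊆ H.edgeSet := by
  rintro _ ⟨a, b, h, i, hi, rfl, -⟩
  exact D.p_adj h hi

lemma lift_mem {M : Set (Sym2 U)} (hM : M ∈ perfectMatchings J) :
    D.lift M ∈ perfectMatchings H := by
  obtain ⟨hsub, huniq⟩ := mem_perfectMatchings.1 hM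
  have hbranch : ∀ a, ∃! w, s(D.f a, w) ∈ D.lift M := by
    intro a
    obtain ⟨b, hb, hb'⟩ := huniq a
    have h : J.Adj a b := hsub hb
    have hf : ∀ {c} (k : J.Adj a c), s(D.f a, D.p k 1) ∈ D.lift M ↔ s(a, c) ∈ M := by
      intro c k
      have := D.mem_lift (M := M) k (D.L_pos k)
      rw [D.p_zero] at this
      simpa using this
    refine ⟨D.p h 1, (hf h).2 hb, fun w hw => ?_⟩
    obtain ⟨c, k, rfl⟩ := D.adj_branch (D.lift_subset M hw)
    obtain rfl := hb' c ((hf k).1 hw)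
    rfl
  refine mem_perfectMatchings.2 ⟨D.lift_subset M, fun w => ?_⟩
  rcases D.vert w with ⟨a, rfl⟩ | ⟨a, b, h, i, hi, rfl⟩
  · exact hbranch a
  · rcases Nat.eq_zero_or_pos i with rfl | h0
    · rw [D.p_zero]; exact hbranch a
    rcases hi.eq_or_lt with rfl | hi
    · rw [D.p_L]; exact hbranch b
    obtain ⟨j, rfl⟩ := Nat.exists_eq_succ_of_ne_zero h0.ne'
    have e1 := D.mem_lift (M := M) h hi
    have e2 := D.mem_lift (M := M) h (show j < D.L h by omega)
    rw [Sym2.eq_swap] at e2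
    rw [Nat.succ_eq_add_one] at *
    rw [Nat.even_add_one] at e1
    have hne : D.p h j ≠ D.p h (j + 1 + 1) := fun hh => by
      have := D.p_inj h (by omega) (by omega) hh
      omega
    have hall : ∀ w, s(D.p h (j + 1), w) ∈ D.lift M → w = D.p h j ∨ w = D.p h (j + 1 + 1) :=
      fun w hw => D.adj_inner h h0 hi (D.lift_subset M hw)
    by_cases hc : s(a, b) ∈ M ↔ Even j
    · refine ⟨_, e2.2 hc, fun w hw => (hall w hw).resolve_right ?_⟩
      rintro rfl
      have := e1.1 hw
      tauto
    · refine ⟨_, e1.2 (by tauto), fun w hw => (hall w hw).resolve_left ?_⟩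
      rintro rfl
      exact hc (e2.1 hw)

lemma proj_lift {M : Set (Sym2 U)} (hM : M ∈ perfectMatchings J) : D.proj (D.lift M) = M := by
  ext e
  induction e with
  | h a b =>
    by_cases h : J.Adj a b
    · rw [D.mem_proj (D.lift_mem hM) h, first]
      simpa using D.mem_lift (M := M) h (D.L_pos h)
    · exact ⟨fun hh => (h (D.proj_subset _ hh)).elim,
        fun hh => (h ((mem_perfectMatchings.1 hM).1 hh)).elim⟩

/-- The membership of an edge of `H` in a perfect matching is controlled by an edge of `J`. -/
lemma exists_control (x : Sym2 W) : ∃ e : Sym2 U, ∀ N₁ ∈ perfectMatchings H,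
    ∀ N₂ ∈ perfectMatchings H, (e ∈ D.proj N₁ ↔ e ∈ D.proj N₂) → (x ∈ N₁ → x ∈ N₂) := by
  by_cases hx : x ∈ H.edgeSet
  · induction x with
    | h w w' =>
      obtain ⟨a, b, h, i, hi, he⟩ := D.edge hx
      refine ⟨s(a, b), fun N₁ h₁ N₂ h₂ => ?_⟩
      rw [he, D.mem_proj h₁ h, D.mem_proj h₂ h, D.mem_iff_first h₁ h hi, D.mem_iff_first h₂ h hi]
      tauto
  · -- an arbitrary edge of `J`; a vertex of `W` provides a vertex of `J`
    have : ∃ a : U, True := by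
      induction x with
      | h w w' =>
        rcases D.vert w with ⟨a, -⟩ | ⟨a, -⟩ <;> exact ⟨a, trivial⟩
    obtain ⟨a, -⟩ := this
    exact ⟨s(a, a), fun N₁ h₁ N₂ h₂ _ hx' => (hx ((mem_perfectMatchings.1 h₁).1 hx')).elim⟩

lemma exists_mem_iff_mem_proj (e : Sym2 U) : ∃ x : Sym2 W, ∀ N ∈ perfectMatchings H,
    (x ∈ N ↔ e ∈ D.proj N) := by
  induction e with
  | h a b =>
    by_cases h : J.Adj a b
    · exact ⟨D.first h, fun N hN => (D.mem_proj hN h).symm⟩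
    · refine ⟨s(D.f a, D.f a), fun N hN => ⟨fun hx => ?_, fun hx => (h (D.proj_subset N hx)).elim⟩⟩
      exact (H.irrefl ((mem_perfectMatchings.1 hN).1 hx)).elim

lemma le_ncard_of_separates [Finite U] [Finite W] {d : ℕ}
    (hd : ∀ S, Separates (perfectMatchings J) S → d ≤ S.ncard) (S : Set (Sym2 W))
    (hS : Separates (perfectMatchings H) S) : d ≤ S.ncard := by
  choose τ hτ using D.exists_control
  refine (hd (τ '' S) fun M₁ h₁ M₂ h₂ he => ?_).trans Set.ncard_image_le
  have h1 := D.lift_mem h₁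
  have h2 := D.lift_mem h₂
  rw [← D.proj_lift h₁, ← D.proj_lift h₂]
  congr 1
  refine hS _ h1 _ h2 ?_
  have hee : ∀ x ∈ S, (τ x ∈ D.proj (D.lift M₁) ↔ τ x ∈ D.proj (D.lift M₂)) := by
    intro x hx
    rw [D.proj_lift h₁, D.proj_lift h₂]
    have := Set.ext_iff.1 he (τ x)
    simpa [Set.mem_image_of_mem τ hx] using this
  ext x
  constructor
  · rintro ⟨hx, hx'⟩
    exact ⟨hx, hτ x _ h1 _ h2 (hee x hx) hx'⟩
  · rintro ⟨hx, hx'⟩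
    exact ⟨hx, hτ x _ h2 _ h1 (hee x hx).symm hx'⟩

lemma exists_blocks [Finite U] {d : ℕ}
    (hd : ∀ M ∈ perfectMatchings J, ∃ S, Blocks (perfectMatchings J) M S ∧ S.ncard ≤ d)
    (N : Set (Sym2 W)) (hN : N ∈ perfectMatchings H) :
    ∃ S, Blocks (perfectMatchings H) N S ∧ S.ncard ≤ d := by
  choose σ hσ using D.exists_mem_iff_mem_proj
  choose τ hτ using D.exists_control
  obtain ⟨S, hS, hSd⟩ := hd _ (D.proj_mem hN)
  refine ⟨σ '' S, ⟨?_, fun N' hN' hne => ?_⟩, (Set.ncard_image_le).trans hSd⟩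
  · rw [Set.disjoint_left]
    rintro _ ⟨e, he, rfl⟩ he'
    exact Set.disjoint_left.1 hS.1 he ((hσ e N hN).1 he')
  · obtain ⟨e, he, he'⟩ := hS.2 _ (D.proj_mem hN') fun hp => hne <| by
      ext x
      exact ⟨hτ x _ hN' _ hN (by rw [hp]), hτ x _ hN _ hN' (by rw [hp])⟩
    exact ⟨σ e, ⟨e, he, rfl⟩, (hσ e N' hN').2 he'⟩

omit D in
/-- A graph whose global forcing number exceeds its maximum anti-forcing number is not a conformal
minor of a strongly uniform graph. -/
lemma _root_.StronglyUniform.IsStronglyUniform.not_isConformalMinor {V : Type*} [Finite V] {G : SimpleGraph V}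
    (hG : IsStronglyUniform G) [Finite U] (d : ℕ) (hJ : Matchable J)
    (hsep : ∀ S, Separates (perfectMatchings J) S → d + 1 ≤ S.ncard)
    (hblock : ∀ M ∈ perfectMatchings J, ∃ S, Blocks (perfectMatchings J) M S ∧ S.ncard ≤ d) :
    ¬ IsConformalMinor J G := by
  rintro ⟨H, hH, hb⟩
  obtain ⟨D⟩ := exists_of_isBisubdivision hb
  obtain ⟨M, hM⟩ := hJ
  have h1 := hG H hH ⟨_, D.lift_mem hM⟩
  have h2 := le_gf (D.le_ncard_of_separates hsep)
  have h3 := Af_le (D.exists_blocks hblock)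
  omega

end BisubdivisionPaths

/-! ### The global forcing and anti-forcing numbers of the four excluded graphs -/

section Involutions

variable {U : Type*} {J : SimpleGraph U}

/-- The edge set of the perfect matching that matches each vertex `v` with `m v`. -/
def matchingOf (m : U → U) : Set (Sym2 U) := {e | ∃ v, e = s(v, m v)}

lemma mem_matchingOf {m : U → U} (hm : Function.Involutive m) {a b : U} :
    s(a, b) ∈ matchingOf m ↔ m a = b := by
  constructor
  · rintro ⟨v, hv⟩
    rcases Sym2.eq_iff.1 hv with ⟨rfl, rfl⟩ | ⟨rfl, rfl⟩
    · rfl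
    · exact hm _
  · rintro rfl
    exact ⟨a, rfl⟩

lemma matchingOf_mem {m : U → U} (hm : Function.Involutive m) (hadj : ∀ v, J.Adj v (m v)) :
    matchingOf m ∈ perfectMatchings J := by
  refine mem_perfectMatchings.2 ⟨?_, fun v => ⟨m v, ⟨v, rfl⟩, fun w hw => ?_⟩⟩
  · rintro _ ⟨v, rfl⟩
    exact hadj v
  · exact ((mem_matchingOf hm).1 hw).symm

lemma exists_matchingOf {M : Set (Sym2 U)} (hM : M ∈ perfectMatchings J) :
    ∃ m : U → U, Function.Involutive m ∧ (∀ v, J.Adj v (m v)) ∧ M = matchingOf m := by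
  obtain ⟨hsub, huniq⟩ := mem_perfectMatchings.1 hM
  choose m hm hm' using huniq
  refine ⟨m, fun v => ?_, fun v => hsub (hm v), ?_⟩
  · refine (hm' (m v) v ?_).symm
    have : s(v, m v) ∈ M := hm v
    rwa [Sym2.eq_swap] at this
  · ext e
    constructor
    · induction e with
      | h a b => intro he; exact ⟨a, by rw [hm' a b he]⟩
    · rintro ⟨v, rfl⟩
      exact hm v

lemma exists_cover [Finite U] [Nonempty U] {d : ℕ} (S : Set (Sym2 U)) (hS : S.ncard ≤ d) :
    ∃ t : Fin d → U × U, ∀ x ∈ S, ∃ r, x = s((t r).1, (t r).2) := by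
  classical
  obtain ⟨u⟩ := ‹Nonempty U›
  have hfin : S.Finite := Set.toFinite S
  set l := hfin.toFinset.toList with hl
  have hlen : l.length ≤ d := by
    rw [hl, Finset.length_toList, ← Set.ncard_eq_toFinset_card S hfin]
    exact hS
  refine ⟨fun r => (l.getD r s(u, u)).out, fun x hx => ?_⟩
  have hxl : x ∈ l := by simpa [hl] using hx
  obtain ⟨i, hi, rfl⟩ := List.getElem_of_mem hxl
  refine ⟨⟨i, by omega⟩, ?_⟩
  have hout : ∀ z : Sym2 U, z = s(z.out.1, z.out.2) := fun z => (Quot.out_eq z).symm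
  have := hout l[i]
  simpa only [List.getD_eq_getElem _ _ hi] using this

/-- A finite certificate for the hypotheses of `IsStronglyUniform.not_isConformalMinor`: the list
`ms` of all perfect matchings of `J`, and for each of them an anti-forcing set `t i` of size at most
`d`, while no `d` edges distinguish all perfect matchings. -/
lemma IsStronglyUniform.not_isConformalMinor_of_list {V : Type*} [Finite V] {G : SimpleGraph V}
    (hG : IsStronglyUniform G) [Finite U] [Nonempty U] {d k : ℕ} (hk : 0 < k)
    (ms : Fin k → U → U) (t : Fin k → Fin d → U × U)
    (hinv : ∀ i v, ms i (ms i v) = v) (hadj : ∀ i v, J.Adj v (ms i v))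
    (hall : ∀ m : U → U, Function.Involutive m → (∀ v, J.Adj v (m v)) → ∃ i, m = ms i)
    (hms : ∀ i j, i ≠ j → ms i ≠ ms j)
    (hsep : ∀ s : Fin d → U × U, ∃ i j, i ≠ j ∧ ∀ r, (ms i (s r).1 = (s r).2 ↔ ms j (s r).1 = (s r).2))
    (hdis : ∀ i r, ms i (t i r).1 ≠ (t i r).2)
    (hmeet : ∀ i j, j ≠ i → ∃ r, ms j (t i r).1 = (t i r).2) :
    ¬ IsConformalMinor J G := by
  have hinv' : ∀ i, Function.Involutive (ms i) := hinv
  have hinj : ∀ i j, matchingOf (ms i) = matchingOf (ms j) → ms i = ms j := by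
    intro i j hij
    ext v
    have := (mem_matchingOf (hinv' i) (a := v)).2 rfl
    rw [hij, mem_matchingOf (hinv' j)] at this
    exact this.symm
  refine hG.not_isConformalMinor d ⟨_, matchingOf_mem (hinv' ⟨0, hk⟩) (hadj _)⟩ ?_ ?_
  · intro S hS
    by_contra! hlt
    obtain ⟨s, hs⟩ := exists_cover S (Nat.lt_succ_iff.1 hlt)
    obtain ⟨i, j, hij, hagree⟩ := hsep s
    refine hms i j hij (hinj i j (hS _ (matchingOf_mem (hinv' i) (hadj i)) _
      (matchingOf_mem (hinv' j) (hadj j)) ?_))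
    ext x
    refine and_congr_right fun hx => ?_
    obtain ⟨r, rfl⟩ := hs x hx
    rw [mem_matchingOf (hinv' i), mem_matchingOf (hinv' j), hagree r]
  · intro M hM
    obtain ⟨m, hm, hm', rfl⟩ := exists_matchingOf hM
    obtain ⟨i, rfl⟩ := hall m hm hm'
    refine ⟨Set.range fun r => s((t i r).1, (t i r).2), ⟨?_, ?_⟩, ?_⟩
    · rw [Set.disjoint_left]
      rintro _ ⟨r, rfl⟩ hx
      exact hdis i r ((mem_matchingOf (hinv' i)).1 hx)
    · intro N hN hne
      obtain ⟨m', hm1, hm2, rfl⟩ := exists_matchingOf hN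
      obtain ⟨j, rfl⟩ := hall m' hm1 hm2
      obtain ⟨r, hr⟩ := hmeet i j fun hji => hne (by rw [hji])
      exact ⟨_, ⟨r, rfl⟩, (mem_matchingOf (hinv' j)).2 hr⟩
    · rw [← Set.image_univ]
      refine (Set.ncard_image_le).trans ?_
      rw [Set.ncard_univ, Nat.card_eq_fintype_card, Fintype.card_fin]

end Involutions

lemma A₁_adj : ∀ a b : Fin 8, A₁.Adj a b ↔
    b ∈ (![[2, 4, 6], [3, 5, 7], [0, 3], [1, 2], [0, 5], [1, 4], [0, 7], [1, 6]] a : List (Fin 8)) := by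
  intro a b
  simp only [A₁, fromEdgeSet_adj, Set.mem_insert_iff, Set.mem_singleton_iff]
  revert a b
  decide

lemma A₂_adj : ∀ a b : Fin 8, A₂.Adj a b ↔
    b ∈ (![[1, 7, 3, 5], [0, 2], [1, 3], [2, 4, 0], [3, 5], [4, 6, 0], [5, 7], [6, 0]] a :
      List (Fin 8)) := by
  intro a b
  simp only [A₂, sup_adj, edge_adj, cycleGraph_adj]
  revert a b
  decide

lemma A₃_adj : ∀ a b : Fin 10, A₃.Adj a b ↔
    b ∈ (![[1, 9, 3], [0, 2], [1, 3], [2, 4, 0], [3, 5], [4, 6, 8], [5, 7], [6, 8], [7, 9, 5],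
      [8, 0]] a : List (Fin 10)) := by
  intro a b
  simp only [A₃, sup_adj, edge_adj, cycleGraph_adj]
  revert a b
  decide

/-- The perfect matchings of `A₁`. -/
def matchingsA₁ : Fin 3 → Fin 8 → Fin 8 :=
  ![![2, 3, 0, 1, 5, 4, 7, 6], ![4, 5, 3, 2, 0, 1, 7, 6], ![6, 7, 3, 2, 5, 4, 0, 1]]

/-- The perfect matchings of `A₂`. -/
def matchingsA₂ : Fin 4 → Fin 8 → Fin 8 :=
  ![![1, 0, 3, 2, 5, 4, 7, 6], ![3, 2, 1, 0, 5, 4, 7, 6], ![5, 2, 1, 4, 3, 0, 7, 6],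
    ![7, 2, 1, 4, 3, 6, 5, 0]]

/-- The perfect matchings of `A₃`. -/
def matchingsA₃ : Fin 4 → Fin 10 → Fin 10 :=
  ![![9, 2, 1, 4, 3, 6, 5, 8, 7, 0], ![9, 2, 1, 4, 3, 8, 7, 6, 5, 0],
    ![3, 2, 1, 0, 5, 4, 7, 6, 9, 8], ![1, 0, 3, 2, 5, 4, 7, 6, 9, 8]]

lemma eq_matchingsA₁ (m : Fin 8 → Fin 8) (hm : Function.Involutive m) (h : ∀ v, A₁.Adj v (m v)) :
    ∃ i, m = matchingsA₁ i := by
  simp only [A₁_adj] at h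
  have h0 := h 0
  have h1 := h 1
  have h2 := h 2
  have h3 := h 3
  have h4 := h 4
  have h5 := h 5
  have h6 := h 6
  have h7 := h 7
  have k0 := hm 0
  have k1 := hm 1
  have k2 := hm 2
  have k3 := hm 3
  have k4 := hm 4
  have k5 := hm 5
  have k6 := hm 6
  have k7 := hm 7
  simp at h0 h1 h2 h3 h4 h5 h6 h7
  simp only [Fin.exists_fin_succ, funext_iff, Fin.forall_fin_succ, matchingsA₁]
  simp [Fin.succ_one_eq_two, Fin.reduceSucc]
  clear h hm
  grind (splits := 30)

lemma eq_matchingsA₂ (m : Fin 8 → Fin 8) (hm : Function.Involutive m) (h : ∀ v, A₂.Adj v (m v)) :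
    ∃ i, m = matchingsA₂ i := by
  simp only [A₂_adj] at h
  have h0 := h 0
  have h1 := h 1
  have h2 := h 2
  have h3 := h 3
  have h4 := h 4
  have h5 := h 5
  have h6 := h 6
  have h7 := h 7
  have k0 := hm 0
  have k1 := hm 1
  have k2 := hm 2
  have k3 := hm 3
  have k4 := hm 4
  have k5 := hm 5
  have k6 := hm 6
  have k7 := hm 7
  simp at h0 h1 h2 h3 h4 h5 h6 h7
  simp only [Fin.exists_fin_succ, funext_iff, Fin.forall_fin_succ, matchingsA₂]
  simp [Fin.succ_one_eq_two, Fin.reduceSucc]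
  clear h hm
  grind (splits := 30)

lemma eq_matchingsA₃ (m : Fin 10 → Fin 10) (hm : Function.Involutive m)
    (h : ∀ v, A₃.Adj v (m v)) : ∃ i, m = matchingsA₃ i := by
  simp only [A₃_adj] at h
  have h0 := h 0
  have h1 := h 1
  have h2 := h 2
  have h3 := h 3
  have h4 := h 4
  have h5 := h 5
  have h6 := h 6
  have h7 := h 7
  have h8 := h 8
  have h9 := h 9
  have k0 := hm 0
  have k1 := hm 1
  have k2 := hm 2
  have k3 := hm 3
  have k4 := hm 4
  have k5 := hm 5
  have k6 := hm 6
  have k7 := hm 7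
  have k8 := hm 8
  have k9 := hm 9
  simp at h0 h1 h2 h3 h4 h5 h6 h7 h8 h9
  simp only [Fin.exists_fin_succ, funext_iff, Fin.forall_fin_succ, matchingsA₃]
  simp [Fin.succ_one_eq_two, Fin.reduceSucc]
  clear h hm
  grind (splits := 30)

/-- The matchings of `K₃,₃`, one for each permutation. -/
def matchingsA₄ : Fin 6 → Fin 3 ⊕ Fin 3 → Fin 3 ⊕ Fin 3 := fun i => Sum.elim
  (fun j => Sum.inr ((![![0, 1, 2], ![0, 2, 1], ![1, 0, 2], ![1, 2, 0], ![2, 0, 1], ![2, 1, 0]] :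
    Fin 6 → Fin 3 → Fin 3) i j))
  (fun j => Sum.inl ((![![0, 1, 2], ![0, 2, 1], ![1, 0, 2], ![2, 0, 1], ![1, 2, 0], ![2, 1, 0]] :
    Fin 6 → Fin 3 → Fin 3) i j))

lemma eq_matchingsA₄ (m : Fin 3 ⊕ Fin 3 → Fin 3 ⊕ Fin 3) (hm : Function.Involutive m)
    (h : ∀ v, A₄.Adj v (m v)) : ∃ i, m = matchingsA₄ i := by
  have hσ : ∀ j, ∃ i, m (Sum.inl j) = Sum.inr i := by
    intro j
    have := h (Sum.inl j)
    rcases hj : m (Sum.inl j) with i | i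
    · rw [hj] at this; simp [A₄] at this
    · exact ⟨i, rfl⟩
  choose σ hσ using hσ
  have hinj : Function.Injective σ := by
    intro i j hij
    have : m (Sum.inl i) = m (Sum.inl j) := by rw [hσ, hσ, hij]
    exact Sum.inl_injective (hm.injective this)
  have hdec : ∀ τ : Fin 3 → Fin 3, Function.Injective τ → ∃ i : Fin 6,
      (∀ j, matchingsA₄ i (Sum.inl j) = Sum.inr (τ j)) ∧
      ∀ j, ∃ l, τ l = j ∧ matchingsA₄ i (Sum.inr j) = Sum.inl l := by decide
  obtain ⟨i, hi, hi'⟩ := hdec σ hinj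
  refine ⟨i, funext ?_⟩
  rintro (j | j)
  · rw [hσ, hi]
  · obtain ⟨l, hl, hl'⟩ := hi' j
    rw [hl', ← hl, ← hσ, hm]

/-- Which of the four perfect matchings of `A₂` (or `A₃`) contain an edge: all possible patterns. -/
def patternsA₂ : Fin 9 → Fin 4 → Bool :=
  ![
    ![false, false, false, false],
    ![false, false, false, true],
    ![false, false, true, false],
    ![false, false, true, true],
    ![false, true, false, false],
    ![false, true, true, true],
    ![true, false, false, false],
    ![true, true, false, false],
    ![true, true, true, false]]

lemma patternsA₂_agree : ∀ k l, ∃ i j, i ≠ j ∧ patternsA₂ k i = patternsA₂ k j ∧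
    patternsA₂ l i = patternsA₂ l j := by decide

lemma matchingsA₂_pattern : ∀ a b, ∃ k, ∀ i, decide (matchingsA₂ i a = b) = patternsA₂ k i := by
  decide

lemma matchingsA₃_pattern : ∀ a b, ∃ k, ∀ i, decide (matchingsA₃ i a = b) = patternsA₂ k i := by
  decide

/-- Which of the six perfect matchings of `K₃,₃` contain an edge: all possible patterns. -/
def patternsA₄ : Fin 10 → Fin 6 → Bool :=
  ![
    ![false, false, false, false, false, false],
    ![false, false, false, false, true, true],
    ![false, false, false, true, false, true],
    ![false, false, true, false, true, false],
    ![false, false, true, true, false, false],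
    ![false, true, false, false, true, false],
    ![false, true, false, true, false, false],
    ![true, false, false, false, false, true],
    ![true, false, true, false, false, false],
    ![true, true, false, false, false, false]]

lemma patternsA₄_agree : ∀ k l n, ∃ i j, i ≠ j ∧ patternsA₄ k i = patternsA₄ k j ∧
    patternsA₄ l i = patternsA₄ l j ∧ patternsA₄ n i = patternsA₄ n j := by decide

lemma matchingsA₄_pattern : ∀ a b, ∃ k, ∀ i, decide (matchingsA₄ i a = b) = patternsA₄ k i := by
  decide

section

variable {V : Type*} [Finite V] {G : SimpleGraph V} (hG : IsStronglyUniform G)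
include hG

lemma IsStronglyUniform.not_isConformalMinor_A₁ : ¬ IsConformalMinor A₁ G := by
  have hsep : ∀ a b : Fin 8, ∃ i j, i ≠ j ∧ (matchingsA₁ i a = b ↔ matchingsA₁ j a = b) := by decide
  refine hG.not_isConformalMinor_of_list (d := 1) (by norm_num) matchingsA₁
    ![![(2, 3)], ![(4, 5)], ![(6, 7)]] (by decide) ?_ eq_matchingsA₁ (by decide) ?_ (by decide)
    (by decide)
  · simp only [A₁_adj]; decide
  · intro s
    obtain ⟨i, j, hij, h⟩ := hsep (s 0).1 (s 0).2
    exact ⟨i, j, hij, fun r => by rw [Subsingleton.elim r 0]; exact h⟩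

lemma IsStronglyUniform.not_isConformalMinor_A₂ : ¬ IsConformalMinor A₂ G := by
  refine hG.not_isConformalMinor_of_list (d := 2) (by norm_num) matchingsA₂
    ![![(1, 2), (1, 2)], ![(0, 1), (3, 4)], ![(4, 5), (5, 6)], ![(6, 7), (6, 7)]] (by decide) ?_
    eq_matchingsA₂ (by decide) ?_ (by decide) (by decide)
  · simp only [A₂_adj]; decide
  · intro s
    obtain ⟨k, hk⟩ := matchingsA₂_pattern (s 0).1 (s 0).2
    obtain ⟨l, hl⟩ := matchingsA₂_pattern (s 1).1 (s 1).2
    obtain ⟨i, j, hij, h1, h2⟩ := patternsA₂_agree k l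
    rw [← hk, ← hk, decide_eq_decide] at h1
    rw [← hl, ← hl, decide_eq_decide] at h2
    exact ⟨i, j, hij, Fin.forall_fin_two.2 ⟨h1, h2⟩⟩

lemma IsStronglyUniform.not_isConformalMinor_A₃ : ¬ IsConformalMinor A₃ G := by
  refine hG.not_isConformalMinor_of_list (d := 2) (by norm_num) matchingsA₃
    ![![(6, 7), (6, 7)], ![(7, 8), (4, 5)], ![(3, 4), (2, 3)], ![(1, 2), (1, 2)]] (by decide) ?_
    eq_matchingsA₃ (by decide) ?_ (by decide) (by decide)
  · simp only [A₃_adj]; decide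
  · intro s
    obtain ⟨k, hk⟩ := matchingsA₃_pattern (s 0).1 (s 0).2
    obtain ⟨l, hl⟩ := matchingsA₃_pattern (s 1).1 (s 1).2
    obtain ⟨i, j, hij, h1, h2⟩ := patternsA₂_agree k l
    rw [← hk, ← hk, decide_eq_decide] at h1
    rw [← hl, ← hl, decide_eq_decide] at h2
    exact ⟨i, j, hij, Fin.forall_fin_two.2 ⟨h1, h2⟩⟩

lemma IsStronglyUniform.not_isConformalMinor_A₄ : ¬ IsConformalMinor A₄ G := by
  -- number the columns so that `M` is the diagonal, and delete the entries below the diagonal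
  refine hG.not_isConformalMinor_of_list (d := 3) (by norm_num) matchingsA₄
    (fun i => ![(Sum.inl 1, matchingsA₄ i (Sum.inl 0)), (Sum.inl 2, matchingsA₄ i (Sum.inl 0)),
      (Sum.inl 2, matchingsA₄ i (Sum.inl 1))]) (by decide) ?_
    eq_matchingsA₄ (by decide) ?_ (by decide) (by decide)
  · intro i v
    rcases v with v | v <;> simp [A₄, matchingsA₄]
  · intro s
    obtain ⟨k, hk⟩ := matchingsA₄_pattern (s 0).1 (s 0).2
    obtain ⟨l, hl⟩ := matchingsA₄_pattern (s 1).1 (s 1).2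
    obtain ⟨n, hn⟩ := matchingsA₄_pattern (s 2).1 (s 2).2
    obtain ⟨i, j, hij, h1, h2, h3⟩ := patternsA₄_agree k l n
    rw [← hk, ← hk, decide_eq_decide] at h1
    rw [← hl, ← hl, decide_eq_decide] at h2
    rw [← hn, ← hn, decide_eq_decide] at h3
    refine ⟨i, j, hij, fun r => ?_⟩
    fin_cases r
    · exact h1
    · exact h2
    · exact h3

end

/-! ### Constructing conformal minors -/

/-- The walk through `p 0, …, p n`. -/
def walkOfNat {W : Type*} {H : SimpleGraph W} (p : ℕ → W) :
    ∀ n : ℕ, (∀ i < n, H.Adj (p i) (p (i + 1))) → H.Walk (p 0) (p n)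
  | 0, _ => Walk.nil
  | n + 1, h => (walkOfNat p n fun i hi => h i (by omega)).concat (h n (by omega))

section WalkOfNat

variable {W : Type*} {H : SimpleGraph W} (p : ℕ → W) (n : ℕ) (h : ∀ i < n, H.Adj (p i) (p (i + 1)))

@[simp] lemma length_walkOfNat : (walkOfNat p n h).length = n := by
  induction n with
  | zero => rfl
  | succ n ih => rw [walkOfNat, Walk.length_concat, ih]

lemma support_walkOfNat : (walkOfNat p n h).support = (List.range (n + 1)).map p := by
  induction n with
  | zero => rfl
  | succ n ih =>
    rw [walkOfNat, Walk.support_concat, ih, List.range_succ (n := n + 1)]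
    simp

lemma getVert_walkOfNat {i : ℕ} (hi : i ≤ n) : (walkOfNat p n h).getVert i = p i := by
  rw [Walk.getVert_eq_support_getElem _ (by simpa using hi)]
  simp [support_walkOfNat]

end WalkOfNat

/-- To find `J` as a conformal minor of `G`, it suffices to give a path `p a b` of odd length
`L a b` for each edge `ab` of `J`, read in one direction only. -/
lemma isConformalMinor_of_paths {U V : Type*} {J : SimpleGraph U} {G : SimpleGraph V} (φ : U → ℕ)
    (hφ : Function.Injective φ) (f : U → V) (hf : Function.Injective f) (p : U → U → ℕ → V)
    (L : U → U → ℕ)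
    (h0 : ∀ a b, J.Adj a b → φ a < φ b → p a b 0 = f a)
    (hL : ∀ a b, J.Adj a b → φ a < φ b → p a b (L a b) = f b)
    (hodd : ∀ a b, J.Adj a b → φ a < φ b → Odd (L a b))
    (hadj : ∀ a b, J.Adj a b → φ a < φ b → ∀ i < L a b, G.Adj (p a b i) (p a b (i + 1)))
    (hinj : ∀ a b, J.Adj a b → φ a < φ b → ∀ i j, 0 < i → i < L a b → 0 < j → j < L a b →
      p a b i = p a b j → i = j)
    (hinner : ∀ a b, J.Adj a b → φ a < φ b → ∀ i, 0 < i → i < L a b → p a b i ∉ Set.range f)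
    (hdisj : ∀ a b, J.Adj a b → φ a < φ b → ∀ c d, J.Adj c d → φ c < φ d → (a, b) ≠ (c, d) →
      ∀ i j, 0 < i → i < L a b → 0 < j → j < L c d → p a b i ≠ p c d j)
    (hmatch : Matchable (G.induce {v | v ∈ Set.range f ∨ ∃ a b, J.Adj a b ∧ φ a < φ b ∧
      ∃ i, 0 < i ∧ i < L a b ∧ v = p a b i}ᶜ)) :
    IsConformalMinor J G := by
  set A := {v | v ∈ Set.range f ∨ ∃ a b, J.Adj a b ∧ φ a < φ b ∧
      ∃ i, 0 < i ∧ i < L a b ∧ v = p a b i} with hA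
  have hpA : ∀ a b, J.Adj a b → φ a < φ b → ∀ i ≤ L a b, p a b i ∈ A := by
    intro a b hab hlt i hi
    rcases Nat.eq_zero_or_pos i with rfl | hpos
    · exact Or.inl ⟨a, (h0 a b hab hlt).symm⟩
    rcases hi.eq_or_lt with rfl | hi'
    · exact Or.inl ⟨b, (hL a b hab hlt).symm⟩
    · exact Or.inr ⟨a, b, hab, hlt, i, hpos, hi', rfl⟩
  have hend : ∀ a b, J.Adj a b → φ a < φ b → ∀ i ≤ L a b, p a b i ∈ Set.range f →
      i = 0 ∨ i = L a b := by
    intro a b hab hlt i hi hr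
    by_contra! hcon
    exact hinner a b hab hlt i (by omega) (by omega) hr
  have hinj' : ∀ a b, J.Adj a b → φ a < φ b → ∀ i j, i ≤ L a b → j ≤ L a b →
      p a b i = p a b j → i = j := by
    intro a b hab hlt i j hi hj hij
    have e0 := h0 a b hab hlt
    have eL := hL a b hab hlt
    by_cases hr : p a b i ∈ Set.range f
    · rcases hend a b hab hlt i hi hr with rfl | rfl <;>
      rcases hend a b hab hlt j hj (hij ▸ hr) with rfl | rfl
      · rfl
      · rw [e0, eL] at hij
        exact (hab.ne (hf hij)).elim
      · rw [e0, eL] at hij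
        exact (hab.ne (hf hij.symm)).elim
      · rfl
    · have hi0 : 0 < i := by
        by_contra hh
        obtain rfl : i = 0 := by omega
        exact hr ⟨a, e0.symm⟩
      have hiL : i < L a b := by
        by_contra hh
        obtain rfl : i = L a b := by omega
        exact hr ⟨b, eL.symm⟩
      rw [hij] at hr
      have hj0 : 0 < j := by
        by_contra hh
        obtain rfl : j = 0 := by omega
        exact hr ⟨a, e0.symm⟩
      have hjL : j < L a b := by
        by_contra hh
        obtain rfl : j = L a b := by omega
        exact hr ⟨b, eL.symm⟩
      exact hinj a b hab hlt i j hi0 hiL hj0 hjL hij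
  let H : G.Subgraph :=
    { verts := A
      Adj := fun v w => ∃ a b, J.Adj a b ∧ φ a < φ b ∧ ∃ i < L a b, s(v, w) = s(p a b i, p a b (i + 1))
      adj_sub := by
        rintro v w ⟨a, b, hab, hlt, i, hi, he⟩
        have := hadj a b hab hlt i hi
        rcases Sym2.eq_iff.1 he with ⟨rfl, rfl⟩ | ⟨rfl, rfl⟩
        · exact this
        · exact this.symm
      edge_vert := by
        rintro v w ⟨a, b, hab, hlt, i, hi, he⟩
        rcases Sym2.eq_iff.1 he with ⟨rfl, rfl⟩ | ⟨rfl, rfl⟩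
        · exact hpA a b hab hlt _ hi.le
        · exact hpA a b hab hlt _ hi
      symm := by
        refine ⟨?_⟩
        rintro v w ⟨a, b, hab, hlt, i, hi, he⟩
        exact ⟨a, b, hab, hlt, i, hi, by rw [Sym2.eq_swap, he]⟩ }
  have hHv : H.verts = A := rfl
  let f' : U ↪ H.verts := ⟨fun a => ⟨f a, Or.inl ⟨a, rfl⟩⟩, fun a b hab =>
    hf (congrArg Subtype.val hab)⟩
  have hW : ∀ a b, J.Adj a b → φ a < φ b → ∃ w : H.coe.Walk (f' a) (f' b), w.length = L a b ∧
      ∀ i ≤ L a b, (w.getVert i).1 = p a b i := by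
    intro a b hab hlt
    let q : ℕ → H.verts := fun i => ⟨p a b (min i (L a b)),
      hpA a b hab hlt _ (min_le_right _ _)⟩
    have hq : ∀ i < L a b, H.coe.Adj (q i) (q (i + 1)) := by
      intro i hi
      refine ⟨a, b, hab, hlt, i, hi, ?_⟩
      simp only [q, min_eq_left hi.le, min_eq_left (Nat.succ_le_of_lt hi)]
    have e0 : q 0 = f' a := Subtype.ext (by
      change p a b (min 0 _) = f a
      rw [Nat.zero_min, h0 a b hab hlt])
    have eL : q (L a b) = f' b := Subtype.ext (by
      change p a b (min _ _) = f b
      rw [min_self, hL a b hab hlt])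
    refine ⟨(walkOfNat q (L a b) hq).copy e0 eL, by simp, fun i hi => ?_⟩
    rw [Walk.getVert_copy, getVert_walkOfNat _ _ _ hi]
    simp [q, min_eq_left hi]
  choose w hwl hwv using hW
  have hlt' : ∀ {a b}, J.Adj a b → ¬ φ a < φ b → φ b < φ a := fun hab hn =>
    lt_of_le_of_ne (not_lt.1 hn) fun he => hab.ne (hφ he).symm
  let P : ∀ ⦃a b : U⦄, J.Adj a b → H.coe.Walk (f' a) (f' b) := fun a b hab =>
    if hlt : φ a < φ b then w a b hab hlt else (w b a hab.symm (hlt' hab hlt)).reverse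
  have hP1 : ∀ a b (hab : J.Adj a b) (hlt : φ a < φ b), P hab = w a b hab hlt :=
    fun a b hab hlt => by simp only [P, hlt, dif_pos]
  have hP2 : ∀ a b (hab : J.Adj a b) (hlt : φ b < φ a), P hab = (w b a hab.symm hlt).reverse :=
    fun a b hab hlt => by simp only [P, hlt.not_gt, dif_neg, not_false_iff]
  have hsupp : ∀ a b (hab : J.Adj a b) (hlt : φ a < φ b) x,
      x ∈ (w a b hab hlt).support ↔ ∃ i ≤ L a b, x.1 = p a b i := by
    intro a b hab hlt x
    rw [Walk.mem_support_iff_exists_getVert]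
    constructor
    · rintro ⟨i, rfl, hi⟩
      rw [hwl] at hi
      exact ⟨i, hi, hwv a b hab hlt i hi⟩
    · rintro ⟨i, hi, hx⟩
      exact ⟨i, Subtype.ext (by rw [hx, hwv a b hab hlt i hi]), by rwa [hwl]⟩
  have hpath : ∀ a b (hab : J.Adj a b) (hlt : φ a < φ b), (w a b hab hlt).IsPath := by
    intro a b hab hlt
    rw [← Walk.IsPath.getVert_injOn_iff]
    intro i hi j hj hij
    simp only [hwl] at hi hj
    refine hinj' a b hab hlt i j hi hj ?_
    rw [← hwv a b hab hlt i hi, ← hwv a b hab hlt j hj, hij]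
  -- each of the two directions of an edge is represented by the chosen one
  have hor : ∀ a b (hab : J.Adj a b), ∃ c d, ∃ hcd : J.Adj c d, ∃ hlt : φ c < φ d,
      s(a, b) = s(c, d) ∧ (P hab).length = L c d ∧ (P hab).IsPath ∧
      ∀ x, x ∈ (P hab).support ↔ ∃ i ≤ L c d, x.1 = p c d i := by
    intro a b hab
    by_cases hlt : φ a < φ b
    · refine ⟨a, b, hab, hlt, rfl, ?_, ?_, ?_⟩ <;> rw [hP1 a b hab hlt]
      · exact hwl a b hab hlt
      · exact hpath a b hab hlt
      · exact hsupp a b hab hlt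
    · have hlt := hlt' hab hlt
      refine ⟨b, a, hab.symm, hlt, Sym2.eq_swap, ?_, ?_, ?_⟩ <;> rw [hP2 a b hab hlt]
      · rw [Walk.length_reverse]; exact hwl b a hab.symm hlt
      · exact (hpath b a hab.symm hlt).reverse
      · intro x
        rw [Walk.support_reverse, List.mem_reverse]; exact hsupp b a hab.symm hlt x
  refine ⟨H, hmatch, f', P, ?_, ?_, ?_, ?_, ?_, ?_⟩
  · intro a b hab
    by_cases hlt : φ a < φ b
    · rw [hP1 a b hab hlt, hP2 b a hab.symm hlt]
    · have hlt := hlt' hab hlt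
      rw [hP2 a b hab hlt, hP1 b a hab.symm hlt, Walk.reverse_reverse]
  · intro a b hab
    obtain ⟨c, d, hcd, hlt, -, h1, h2, -⟩ := hor a b hab
    exact ⟨h2, h1 ▸ hodd c d hcd hlt⟩
  · intro a b hab x hx
    obtain ⟨c, d, hcd, hlt, h1, -, -, h2⟩ := hor a b hab
    obtain ⟨i, hi, hxi⟩ := (h2 _).1 hx
    have hxi : f x = p c d i := hxi
    have : x = c ∨ x = d := by
      rcases hend c d hcd hlt i hi ⟨x, hxi⟩ with rfl | rfl
      · left; rw [h0 c d hcd hlt] at hxi; exact hf hxi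
      · right; rw [hL c d hcd hlt] at hxi; exact hf hxi
    rcases Sym2.eq_iff.1 h1 with ⟨rfl, rfl⟩ | ⟨rfl, rfl⟩
    · exact this
    · exact this.symm
  · intro a b hab c d hcd hne x hx hx'
    obtain ⟨a', b', hab', hlt, e1, -, -, h1⟩ := hor a b hab
    obtain ⟨c', d', hcd', hlt', e2, -, -, h2⟩ := hor c d hcd
    obtain ⟨i, hi, hxi⟩ := (h1 _).1 hx
    obtain ⟨j, hj, hxj⟩ := (h2 _).1 hx'
    have hr : x.1 ∈ Set.range f := by
      by_contra hr
      have hi0 : 0 < i := by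
        by_contra hh
        obtain rfl : i = 0 := by omega
        exact hr ⟨a', by rw [hxi, h0 a' b' hab' hlt]⟩
      have hiL : i < L a' b' := by
        by_contra hh
        obtain rfl : i = L a' b' := by omega
        exact hr ⟨b', by rw [hxi, hL a' b' hab' hlt]⟩
      have hj0 : 0 < j := by
        by_contra hh
        obtain rfl : j = 0 := by omega
        exact hr ⟨c', by rw [hxj, h0 c' d' hcd' hlt']⟩
      have hjL : j < L c' d' := by
        by_contra hh
        obtain rfl : j = L c' d' := by omega
        exact hr ⟨d', by rw [hxj, hL c' d' hcd' hlt']⟩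
      refine hdisj a' b' hab' hlt c' d' hcd' hlt' ?_ i j hi0 hiL hj0 hjL (hxi ▸ hxj)
      intro he
      rw [Prod.mk.injEq] at he
      exact hne (by rw [e1, e2, he.1, he.2])
    obtain ⟨u, hu⟩ := hr
    exact ⟨u, Subtype.ext hu⟩
  · rintro ⟨x, ⟨u, hu⟩ | ⟨a, b, hab, hlt, i, hi0, hi, hx⟩⟩
    · exact Or.inl ⟨u, Subtype.ext hu⟩
    · refine Or.inr ⟨a, b, hab, ?_⟩
      rw [hP1 a b hab hlt, hsupp a b hab hlt]
      exact ⟨i, hi.le, hx⟩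
  · intro e
    induction e with
    | h x y =>
      rintro ⟨a, b, hab, hlt, i, hi, he⟩
      refine ⟨a, b, hab, ?_⟩
      rw [hP1 a b hab hlt, mem_edges_iff_getVert]
      refine ⟨i, by rwa [hwl], ?_⟩
      have e1 := hwv a b hab hlt i hi.le
      have e2 := hwv a b hab hlt (i + 1) hi
      rcases Sym2.eq_iff.1 he with ⟨h1, h2⟩ | ⟨h1, h2⟩
      · have hx : x = _ := Subtype.ext (h1.trans e1.symm)
        have hy : y = _ := Subtype.ext (h2.trans e2.symm)
        rw [hx, hy]
      · have hx : x = _ := Subtype.ext (h1.trans e2.symm)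
        have hy : y = _ := Subtype.ext (h2.trans e1.symm)
        rw [hx, hy, Sym2.eq_swap]

/-! ### Conformal cycles -/

section MatchableOn

variable {V : Type*} {G : SimpleGraph V}

/-- The subgraph of `G` induced by `A` has a perfect matching, given as an involution `m`. -/
def MatchableOn (G : SimpleGraph V) (A : Set V) : Prop :=
  ∃ m : V → V, ∀ v ∈ A, m v ∈ A ∧ m (m v) = v ∧ G.Adj v (m v)

lemma matchable_induce_iff {A : Set V} : Matchable (G.induce A) ↔ MatchableOn G A := by
  classical
  constructor
  · rintro ⟨M, hM⟩
    obtain ⟨m, h1, h2, -⟩ := exists_matchingOf hM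
    refine ⟨fun v => if hv : v ∈ A then m ⟨v, hv⟩ else v, fun v hv => ?_⟩
    have h3 := h1 ⟨v, hv⟩
    have h4 := h2 ⟨v, hv⟩
    simp only [hv, dif_pos, Subtype.coe_prop, Subtype.coe_eta, h3]
    exact ⟨trivial, trivial, h4⟩
  · rintro ⟨m, hm⟩
    refine ⟨_, matchingOf_mem (m := fun v : A => ⟨m v.1, (hm v.1 v.2).1⟩) ?_ ?_⟩
    · exact fun v => Subtype.ext (hm v.1 v.2).2.1
    · exact fun v => (hm v.1 v.2).2.2

lemma MatchableOn.union {A B : Set V} (hA : MatchableOn G A) (hB : MatchableOn G B)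
    (hAB : Disjoint A B) : MatchableOn G (A ∪ B) := by
  classical
  obtain ⟨m, hm⟩ := hA
  obtain ⟨m', hm'⟩ := hB
  refine ⟨fun v => if v ∈ A then m v else m' v, fun v hv => ?_⟩
  by_cases hvA : v ∈ A
  · obtain ⟨h1, h2, h3⟩ := hm v hvA
    simp only [hvA, h1, h2, h3, if_true, and_true]
    exact Or.inl h1
  · obtain ⟨h1, h2, h3⟩ := hm' v (hv.resolve_left hvA)
    have h4 : m' v ∉ A := fun h => Set.disjoint_left.1 hAB h h1
    simp only [hvA, h4, h2, h3, if_false, and_true]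
    exact Or.inr h1

lemma matchableOn_empty : MatchableOn G ∅ := ⟨id, by simp⟩

lemma matchableOn_pair {x y : V} (h : G.Adj x y) : MatchableOn G {x, y} := by
  classical
  refine ⟨fun v => if v = x then y else x, ?_⟩
  rintro v (rfl | rfl)
  · simp [h, h.ne.symm]
  · simp [h.symm, h.ne.symm]

/-- A path with an even number of vertices is matchable. -/
lemma matchableOn_path (p : ℕ → V) (a k : ℕ)
    (hinj : ∀ i j, a ≤ i → i < a + 2 * k → a ≤ j → j < a + 2 * k → p i = p j → i = j)
    (hadj : ∀ i, a ≤ i → i + 1 < a + 2 * k → G.Adj (p i) (p (i + 1))) :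
    MatchableOn G {v | ∃ i, a ≤ i ∧ i < a + 2 * k ∧ v = p i} := by
  induction k with
  | zero =>
    convert matchableOn_empty (G := G)
    ext v
    simp only [Set.mem_ofPred_eq, Set.mem_empty_iff_false, iff_false]
    rintro ⟨i, h1, h2, -⟩
    omega
  | succ k ih =>
    have h1 := ih (fun i j h1 h2 h3 h4 => hinj i j h1 (by omega) h3 (by omega))
      (fun i h1 h2 => hadj i h1 (by omega))
    have h2 := matchableOn_pair (hadj (a + 2 * k) (by omega) (by omega))
    convert h1.union h2 ?_ using 1
    · ext v
      simp only [Set.mem_ofPred_eq, Set.mem_union, Set.mem_insert_iff, Set.mem_singleton_iff]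
      constructor
      · rintro ⟨i, h3, h4, rfl⟩
        by_cases h5 : i < a + 2 * k
        · exact Or.inl ⟨i, h3, h5, rfl⟩
        · have : i = a + 2 * k ∨ i = a + 2 * k + 1 := by omega
          rcases this with rfl | rfl <;> simp
      · rintro (⟨i, h3, h4, rfl⟩ | rfl | rfl)
        · exact ⟨i, h3, by omega, rfl⟩
        · exact ⟨_, by omega, by omega, rfl⟩
        · exact ⟨_, by omega, by omega, rfl⟩
    · rw [Set.disjoint_left]
      rintro v ⟨i, h3, h4, rfl⟩ (h5 | h5)
      · have := hinj _ _ h3 (by omega) (by omega) (by omega) h5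
        omega
      · have := hinj _ _ h3 (by omega) (by omega) (by omega) h5
        omega

lemma MatchableOn.congr {A B : Set V} (hA : MatchableOn G A) (h : A = B) : MatchableOn G B := h ▸ hA

end MatchableOn

/-- The map `c` runs once around an even cycle of `G` whose complement is matchable. -/
structure IsConformalCycle {V : Type*} (G : SimpleGraph V) {n : ℕ} (c : ZMod n → V) : Prop where
  four_le : 4 ≤ n
  even : Even n
  inj : Function.Injective c
  adj : ∀ i, G.Adj (c i) (c (i + 1))
  compl : MatchableOn G (Set.range c)ᶜ

namespace IsConformalCycle

variable {V : Type*} {G : SimpleGraph V} {n : ℕ} {c : ZMod n → V}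

lemma rotate (h : IsConformalCycle G c) (s : ZMod n) : IsConformalCycle G fun i => c (s + i) where
  four_le := h.four_le
  even := h.even
  inj := h.inj.comp (add_right_injective s)
  adj i := by rw [← add_assoc]; exact h.adj _
  compl := by
    have : (Set.range fun i => c (s + i)) = Set.range c :=
      (Equiv.addLeft s).surjective.range_comp c
    rw [this]; exact h.compl

lemma reflect (h : IsConformalCycle G c) : IsConformalCycle G fun i => c (-i) where
  four_le := h.four_le
  even := h.even
  inj := h.inj.comp neg_injective
  adj i := by
    have := (h.adj (-(i + 1))).symm
    rwa [show -(i + 1) + 1 = -i by ring] at this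
  compl := by
    have : (Set.range fun i => c (-i)) = Set.range c := (Equiv.neg (ZMod n)).surjective.range_comp c
    rw [this]; exact h.compl

lemma neZero (h : IsConformalCycle G c) : NeZero n := ⟨by have := h.four_le; omega⟩

lemma natCast_inj (h : IsConformalCycle G c) {i j : ℕ} (hi : i < n) (hj : j < n)
    (hij : c i = c j) : i = j := by
  have := (ZMod.natCast_eq_natCast_iff' i j n).1 (h.inj hij)
  rwa [Nat.mod_eq_of_lt hi, Nat.mod_eq_of_lt hj] at this

lemma natCast_adj (h : IsConformalCycle G c) (i : ℕ) : G.Adj (c i) (c (i + 1 : ℕ)) := by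
  rw [Nat.cast_succ]; exact h.adj _

lemma exists_nat (h : IsConformalCycle G c) (z : ZMod n) : ∃ i < n, (i : ZMod n) = z := by
  have := h.neZero
  exact ⟨z.val, ZMod.val_lt z, ZMod.natCast_rightInverse z⟩

/-- A closed walk without repeated vertices, given by the sequence of its vertices. -/
lemma of_nat {N : ℕ} (hN : 4 ≤ N) (heven : Even N) (p : ℕ → V)
    (hinj : ∀ i j, i < N → j < N → p i = p j → i = j)
    (hadj : ∀ i, i + 1 < N → G.Adj (p i) (p (i + 1))) (hclose : G.Adj (p (N - 1)) (p 0))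
    (hcompl : MatchableOn G {v | ∃ i < N, v = p i}ᶜ) :
    IsConformalCycle G fun z : ZMod N => p z.val where
  four_le := hN
  even := heven
  inj := by
    have : NeZero N := ⟨by omega⟩
    intro x y hxy
    exact ZMod.val_injective N (hinj _ _ (ZMod.val_lt x) (ZMod.val_lt y) hxy)
  adj z := by
    have : NeZero N := ⟨by omega⟩
    have : Fact (1 < N) := ⟨by omega⟩
    by_cases hz : z.val + 1 < N
    · rw [ZMod.val_add_of_lt (by rwa [ZMod.val_one]), ZMod.val_one]
      exact hadj _ hz
    · have h1 : z.val = N - 1 := by have := ZMod.val_lt z; omega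
      have h2 : (z + 1).val = 0 := by
        rw [ZMod.val_add, ZMod.val_one, h1, Nat.sub_add_cancel (by omega), Nat.mod_self]
      rw [h2, h1]; exact hclose
  compl := by
    have : NeZero N := ⟨by omega⟩
    refine hcompl.congr ?_
    congr 1
    ext v
    constructor
    · rintro ⟨i, hi, rfl⟩
      exact ⟨(i : ZMod N), by simp [ZMod.val_natCast, Nat.mod_eq_of_lt hi]⟩
    · rintro ⟨z, rfl⟩
      exact ⟨z.val, ZMod.val_lt z, rfl⟩

lemma matchable_of_range (h : IsConformalCycle G c) {A : Set V} (hA : A = Set.range c) :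
    Matchable (G.induce Aᶜ) := by
  rw [hA, matchable_induce_iff]; exact h.compl

/-- A graph `J` that consists of a Hamilton cycle and chords is a conformal minor if its Hamilton
cycle can be stretched to the conformal cycle `c` such that chords become edges of `G`. Here
`φ a` is the position of the vertex `a` on the Hamilton cycle, and `g` maps it to a position on
`c`. -/
lemma isConformalMinor (h : IsConformalCycle G c) {U : Type*} {J : SimpleGraph U} {k : ℕ}
    (hk : 3 ≤ k) (φ : U → ℕ) (hφ : Function.Injective φ) (hφk : ∀ a, φ a < k)
    (hsurj : ∀ i < k, ∃ a, φ a = i) (hJ : ∀ a b, φ b = φ a + 1 → J.Adj a b)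
    (hJ' : ∀ a b, φ a = 0 → φ b = k - 1 → J.Adj a b) (g : ℕ → ℕ) (hg0 : g 0 = 0) (hgk : g k = n)
    (hg : ∀ i < k, ∃ d, g (i + 1) = g i + 2 * d + 1)
    (hchord : ∀ a b, J.Adj a b → φ a < φ b → φ b = φ a + 1 ∨ (φ a = 0 ∧ φ b = k - 1) ∨
      G.Adj (c (g (φ a))) (c (g (φ b)))) : IsConformalMinor J G := by
  classical
  have hmono : ∀ j, j ≤ k → ∀ i < j, g i < g j := by
    intro j
    induction j with
    | zero => intro _ i hi; omega
    | succ j ih =>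
      intro hj i hi
      obtain ⟨d, hd⟩ := hg j (by omega)
      rcases Nat.lt_succ_iff_lt_or_eq.1 hi with hi' | rfl
      · have := ih (by omega) i hi'; omega
      · omega
  have hgn : ∀ i < k, g i < n := fun i hi => hgk ▸ hmono k le_rfl i hi
  -- positions strictly between two consecutive values of `g`
  have hbet : ∀ r < k, ∀ r' < k, ∀ x, g r < x → x < g (r + 1) → g r' ≤ x → x < g (r' + 1) →
      r = r' := by
    intro r hr r' hr' x h1 h2 h3 h4
    rcases lt_trichotomy r r' with hlt | rfl | hlt
    · rcases (Nat.succ_le_of_lt hlt).eq_or_lt with he | hlt'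
      · rw [Nat.succ_eq_add_one] at he; rw [he] at h2; omega
      · have := hmono r' hr'.le (r + 1) hlt'; omega
    · rfl
    · rcases (Nat.succ_le_of_lt hlt).eq_or_lt with he | hlt'
      · rw [Nat.succ_eq_add_one] at he; rw [he] at h4; omega
      · have := hmono r hr.le (r' + 1) hlt'; omega
  set f : U → V := fun a => c (g (φ a)) with hf
  set p : U → U → ℕ → V := fun a b i =>
    if φ b = φ a + 1 then c (g (φ a) + i : ℕ) else
      if φ a = 0 ∧ φ b = k - 1 then c (n - i : ℕ) else if i = 0 then f a else f b with hp
  set L : U → U → ℕ := fun a b => if φ b = φ a + 1 then g (φ a + 1) - g (φ a) else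
      if φ a = 0 ∧ φ b = k - 1 then n - g (k - 1) else 1 with hL
  have hcn : c ((n : ℕ) : ZMod n) = c ((0 : ℕ) : ZMod n) := by simp
  have hk1 : ¬ k - 1 = 0 + 1 := by omega
  have hlast := hg (k - 1) (by omega)
  rw [Nat.sub_add_cancel (by omega), hgk] at hlast
  obtain ⟨dl, hdl⟩ := hlast
  -- inner vertices of the replacement paths
  have hin : ∀ a b, φ a < φ b → ∀ i, 0 < i → i < L a b → ∃ r < k, ∃ x, g r < x ∧
      x < g (r + 1) ∧ x < n ∧ p a b i = c (x : ℕ) ∧ ((φ b = φ a + 1 ∧ r = φ a ∧ x = g r + i) ∨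
        (φ b ≠ φ a + 1 ∧ φ a = 0 ∧ φ b = k - 1 ∧ r = k - 1 ∧ x + i = n)) := by
    intro a b hlt i hi hiL
    by_cases h1 : φ b = φ a + 1
    · simp only [hL, h1, if_true] at hiL
      have h3 := hφk b
      have h4 : g (φ a + 1) ≤ n := by
        rw [← h1]; exact (hgn _ (hφk b)).le
      exact ⟨φ a, hφk a, g (φ a) + i, by omega, by omega, by omega, by simp only [hp, h1, if_true],
        Or.inl ⟨h1, rfl, rfl⟩⟩
    · by_cases h2 : φ a = 0 ∧ φ b = k - 1
      · simp only [hL, h2, hk1, if_false, if_true, and_self] at hiL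
        refine ⟨k - 1, by omega, n - i, by omega, ?_, by omega, ?_,
          Or.inr ⟨h1, h2.1, h2.2, rfl, by omega⟩⟩
        · rw [Nat.sub_add_cancel (by omega), hgk]; omega
        · simp only [hp, h2, hk1, if_false, if_true, and_self]
      · simp only [hL, h1, h2, if_false] at hiL
        omega
  refine isConformalMinor_of_paths φ hφ f ?_ p L ?_ ?_ ?_ ?_ ?_ ?_ ?_ ?_
  · intro a b hab
    have := h.natCast_inj (hgn _ (hφk a)) (hgn _ (hφk b)) hab
    apply hφ
    rcases lt_trichotomy (φ a) (φ b) with hlt | he | hlt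
    · have := hmono _ (hφk b).le _ hlt; omega
    · exact he
    · have := hmono _ (hφk a).le _ hlt; omega
  · intro a b hab hlt
    simp only [hp]
    split_ifs with h1 h2
    · simp [hf]
    · simp only [Nat.sub_zero, hcn, hf, h2.1, hg0]
    · rfl
  · intro a b hab hlt
    simp only [hp, hL]
    split_ifs with h1 h2 h3
    · simp only [hf]
      have := hmono (φ a + 1) (by have := hφk b; omega) (φ a) (Nat.lt_succ_self _)
      rw [h1, Nat.add_sub_cancel' this.le]
    · simp only [hf, h2.2]
      rw [Nat.sub_sub_self (by omega)]
    · contradiction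
    · rfl
  · intro a b hab hlt
    simp only [hL]
    split_ifs with h1 h2
    · obtain ⟨d, hd⟩ := hg (φ a) (hφk a)
      exact ⟨d, by omega⟩
    · exact ⟨dl, by omega⟩
    · exact odd_one
  · intro a b hab hlt i hi
    simp only [hp, hL] at hi ⊢
    split_ifs at hi ⊢ with h1 h2 h3 h4 h5
    · rw [← add_assoc]; exact h.natCast_adj _
    · have := h.natCast_adj (n - (i + 1))
      rw [show n - (i + 1) + 1 = n - i by omega] at this
      exact this.symm
    all_goals
      first
      | omega
      | contradiction
      | exact ((hchord a b hab hlt).resolve_left h1).resolve_left h2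
  · intro a b hab hlt i j hi hi' hj hj' hij
    obtain ⟨r, hr, x, h1, h2, h3, h4, h5⟩ := hin a b hlt i hi hi'
    obtain ⟨r', hr', x', h1', h2', h3', h4', h5'⟩ := hin a b hlt j hj hj'
    rw [h4, h4'] at hij
    have hxx := h.natCast_inj h3 h3' hij
    rcases h5 with ⟨e1, rfl, e3⟩ | ⟨e1, -, -, rfl, e3⟩ <;>
      rcases h5' with ⟨e1', rfl, e3'⟩ | ⟨e1', -, -, rfl, e3'⟩ <;> omega
  · rintro a b hab hlt i hi hi' ⟨u, hu⟩
    obtain ⟨r, hr, x, h1, h2, h3, h4, -⟩ := hin a b hlt i hi hi'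
    rw [h4] at hu
    have hxx := h.natCast_inj (hgn _ (hφk u)) h3 hu
    have h6 := hmono (φ u + 1) (hφk u) (φ u) (Nat.lt_succ_self _)
    have := hbet r hr (φ u) (hφk u) x h1 h2 hxx.le (by omega)
    subst this
    omega
  · intro a b hab hlt a' b' hab' hlt' hne i j hi hi' hj hj' hij
    obtain ⟨r, hr, x, h1, h2, h3, h4, h5⟩ := hin a b hlt i hi hi'
    obtain ⟨r', hr', x', h1', h2', h3', h4', h5'⟩ := hin a' b' hlt' j hj hj'
    rw [h4, h4'] at hij
    obtain rfl := h.natCast_inj h3 h3' hij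
    have hrr := hbet r hr r' hr' x h1 h2 h1'.le h2'
    have hb := hφk b
    have hb' := hφk b'
    refine hne ?_
    have h6 : φ a = φ a' ∧ φ b = φ b' := by
      rcases h5 with ⟨e1, e2, e3⟩ | ⟨e1, e4, e5, e2, e3⟩ <;>
        rcases h5' with ⟨e1', e2', e3'⟩ | ⟨e1', e4', e5', e2', e3'⟩ <;> omega
    rw [hφ h6.1, hφ h6.2]
  · refine h.matchable_of_range ?_
    ext v
    constructor
    · rintro (⟨u, rfl⟩ | ⟨a, b, hab, hlt, i, hi, hi', rfl⟩)
      · exact ⟨_, rfl⟩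
      · obtain ⟨r, hr, x, h1, h2, h3, h4, h5⟩ := hin a b hlt i hi hi'
        exact ⟨_, h4.symm⟩
    · rintro ⟨z, rfl⟩
      obtain ⟨x, hx, rfl⟩ := h.exists_nat z
      -- the last value of `g` that is at most `x`
      have hex : ∃ r < k, g r ≤ x ∧ x < g (r + 1) := by
        have hfind : ∃ r, x < g (r + 1) := ⟨k - 1, by
          rw [Nat.sub_add_cancel (by omega), hgk]; exact hx⟩
        refine ⟨Nat.find hfind, ?_, ?_, Nat.find_spec hfind⟩
        · have : Nat.find hfind ≤ k - 1 := Nat.find_min' hfind (by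
            rw [Nat.sub_add_cancel (by omega), hgk]; exact hx)
          omega
        · by_cases h0 : Nat.find hfind = 0
          · rw [h0, hg0]; omega
          · have := Nat.find_min hfind (m := Nat.find hfind - 1) (by omega)
            rw [Nat.sub_add_cancel (by omega)] at this
            omega
      obtain ⟨r, hr, h1, h2⟩ := hex
      obtain ⟨a, ha⟩ := hsurj r hr
      rcases h1.eq_or_lt with rfl | h1
      · exact Or.inl ⟨a, by simp only [hf, ha]⟩
      · right
        by_cases hrk : r + 1 < k
        · obtain ⟨b, hb⟩ := hsurj (r + 1) hrk
          refine ⟨a, b, hJ a b (by omega), by omega, x - g r, by omega, ?_, ?_⟩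
          · simp only [hL, ha, hb, if_true]; omega
          · simp only [hp, ha, hb, if_true]
            rw [Nat.add_sub_cancel' h1.le]
        · obtain ⟨b, hb⟩ := hsurj 0 (by omega)
          obtain rfl : r = k - 1 := by omega
          have hne : ¬ k - 1 = 0 + 1 := by omega
          refine ⟨b, a, hJ' b a hb ha, by omega, n - x, by omega, ?_, ?_⟩
          · simp only [hL, ha, hb, hne, if_true, if_false, and_self]; omega
          · simp only [hp, ha, hb, hne, if_true, if_false, and_self]
            rw [Nat.sub_sub_self hx.le]

end IsConformalCycle

/-! ### Conformal minors from chords of a conformal cycle -/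

section Minors

variable {V : Type*} {G : SimpleGraph V}

namespace IsConformalCycle

variable {n : ℕ} {c : ZMod n → V}

/-- Two chords at the same vertex of a conformal cycle. -/
lemma isConformalMinor_A₂ (h : IsConformalCycle G c) {y z : ℕ} (hy3 : 3 ≤ y) (hy : y % 2 = 1)
    (hyz : y < z) (hz : z % 2 = 1) (hzn : z + 3 ≤ n) (h1 : G.Adj (c (0 : ℕ)) (c (y : ℕ)))
    (h2 : G.Adj (c (0 : ℕ)) (c (z : ℕ))) : IsConformalMinor A₂ G := by
  have hn := h.even
  rw [Nat.even_iff] at hn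
  have hE : ∀ a b : Fin 8, b ∈ (![[1, 7, 3, 5], [0, 2], [1, 3], [2, 4, 0], [3, 5], [4, 6, 0],
      [5, 7], [6, 0]] a : List (Fin 8)) → a.val < b.val → b.val = a.val + 1 ∨
      (a.val = 0 ∧ b.val = 8 - 1) ∨ (a.val = 0 ∧ b.val = 3) ∨ (a.val = 0 ∧ b.val = 5) := by decide
  refine h.isConformalMinor (k := 8) (by norm_num) Fin.val Fin.val_injective Fin.is_lt
    (fun i hi => ⟨⟨i, hi⟩, rfl⟩) (by simp only [A₂_adj]; decide) (by simp only [A₂_adj]; decide)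
    (fun i => [0, 1, 2, y, y + 1, z, z + 1, z + 2].getD i n) (by simp) (by simp) ?_ ?_
  · intro i hi
    interval_cases i
    · exact ⟨0, by simp⟩
    · exact ⟨0, by simp⟩
    · exact ⟨(y - 3) / 2, by simp; omega⟩
    · exact ⟨0, by simp⟩
    · exact ⟨(z - y - 2) / 2, by simp; omega⟩
    · exact ⟨0, by simp⟩
    · exact ⟨0, by simp⟩
    · exact ⟨(n - z - 3) / 2, by simp; omega⟩
  · intro a b hab hlt
    rw [A₂_adj] at hab
    rcases hE a b hab hlt with h' | h' | ⟨ha, hb⟩ | ⟨ha, hb⟩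
    · exact Or.inl h'
    · exact Or.inr (Or.inl h')
    · rw [ha, hb]; exact Or.inr (Or.inr h1)
    · rw [ha, hb]; exact Or.inr (Or.inr h2)

/-- Two disjoint chords of a conformal cycle that are neither crossed nor parallel. -/
lemma isConformalMinor_A₃ (h : IsConformalCycle G c) {x y z : ℕ} (hx3 : 3 ≤ x) (hx : x % 2 = 1)
    (hxy : x < y) (hy : y % 2 = 1) (hyz : y + 3 ≤ z) (hz : z % 2 = 0) (hzn : z < n)
    (h1 : G.Adj (c (0 : ℕ)) (c (x : ℕ))) (h2 : G.Adj (c (y : ℕ)) (c (z : ℕ))) :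
    IsConformalMinor A₃ G := by
  have hn := h.even
  rw [Nat.even_iff] at hn
  have hE : ∀ a b : Fin 10, b ∈ (![[1, 9, 3], [0, 2], [1, 3], [2, 4, 0], [3, 5], [4, 6, 8], [5, 7],
      [6, 8], [7, 9, 5], [8, 0]] a : List (Fin 10)) → a.val < b.val → b.val = a.val + 1 ∨
      (a.val = 0 ∧ b.val = 10 - 1) ∨ (a.val = 0 ∧ b.val = 3) ∨ (a.val = 5 ∧ b.val = 8) := by decide
  refine h.isConformalMinor (k := 10) (by norm_num) Fin.val Fin.val_injective Fin.is_lt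
    (fun i hi => ⟨⟨i, hi⟩, rfl⟩) (by simp only [A₃_adj]; decide) (by simp only [A₃_adj]; decide)
    (fun i => [0, 1, 2, x, x + 1, y, y + 1, y + 2, z, z + 1].getD i n) (by simp) (by simp) ?_ ?_
  · intro i hi
    interval_cases i
    · exact ⟨0, by simp⟩
    · exact ⟨0, by simp⟩
    · exact ⟨(x - 3) / 2, by simp; omega⟩
    · exact ⟨0, by simp⟩
    · exact ⟨(y - x - 2) / 2, by simp; omega⟩
    · exact ⟨0, by simp⟩
    · exact ⟨0, by simp⟩
    · exact ⟨(z - y - 3) / 2, by simp; omega⟩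
    · exact ⟨0, by simp⟩
    · exact ⟨(n - z - 2) / 2, by simp; omega⟩
  · intro a b hab hlt
    rw [A₃_adj] at hab
    rcases hE a b hab hlt with h' | h' | ⟨ha, hb⟩ | ⟨ha, hb⟩
    · exact Or.inl h'
    · exact Or.inr (Or.inl h')
    · rw [ha, hb]; exact Or.inr (Or.inr h1)
    · rw [ha, hb]; exact Or.inr (Or.inr h2)

/-- A conformal hexagon with all its long chords. -/
lemma isConformalMinor_A₄ (h : IsConformalCycle G c) (hn : n = 6)
    (h1 : G.Adj (c (0 : ℕ)) (c (3 : ℕ))) (h2 : G.Adj (c (1 : ℕ)) (c (4 : ℕ)))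
    (h3 : G.Adj (c (2 : ℕ)) (c (5 : ℕ))) : IsConformalMinor A₄ G := by
  let φ : Fin 3 ⊕ Fin 3 → ℕ := Sum.elim (fun i => 2 * i.val) (fun i => 2 * i.val + 1)
  have hcross : ∀ a b, A₄.Adj a b ↔ (a.isLeft = !b.isLeft) := by
    rintro (a | a) (b | b) <;> simp [A₄]
  have hφ : ∀ a b, φ a = φ b → a = b := by decide
  have hE : ∀ a b, (a.isLeft = !b.isLeft) → φ a < φ b → φ b = φ a + 1 ∨
      (φ a = 0 ∧ φ b = 6 - 1) ∨ (φ a = 0 ∧ φ b = 3) ∨ (φ a = 1 ∧ φ b = 4) ∨ (φ a = 2 ∧ φ b = 5) := by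
    decide
  refine h.isConformalMinor (k := 6) (by norm_num) φ hφ (by decide) (by decide)
    (by simp only [hcross]; decide) (by simp only [hcross]; decide) id rfl (by simp [hn])
    (fun i _ => ⟨0, by simp⟩) ?_
  intro a b hab hlt
  rcases hE a b ((hcross a b).1 hab) hlt with h' | h' | ⟨ha, hb⟩ | ⟨ha, hb⟩ | ⟨ha, hb⟩
  · exact Or.inl h'
  · exact Or.inr (Or.inl h')
  · rw [ha, hb]; exact Or.inr (Or.inr h1)
  · rw [ha, hb]; exact Or.inr (Or.inr h2)
  · rw [ha, hb]; exact Or.inr (Or.inr h3)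

end IsConformalCycle

/-- Three internally disjoint paths of odd lengths `ℓ r ≥ 3` from `x` to `y`, whose union has a
matchable complement. -/
lemma isConformalMinor_A₁ {x y : V} (hxy : x ≠ y) (q : Fin 3 → ℕ → V) (ℓ : Fin 3 → ℕ)
    (hodd : ∀ r, Odd (ℓ r)) (h3 : ∀ r, 3 ≤ ℓ r) (hq0 : ∀ r, q r 0 = x) (hqℓ : ∀ r, q r (ℓ r) = y)
    (hadj : ∀ r, ∀ i < ℓ r, G.Adj (q r i) (q r (i + 1)))
    (hinner : ∀ r i, 0 < i → i < ℓ r → q r i ≠ x ∧ q r i ≠ y)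
    (hinj : ∀ r r' i i', 0 < i → i < ℓ r → 0 < i' → i' < ℓ r' → q r i = q r' i' → r = r' ∧ i = i')
    (hcompl : MatchableOn G {v | ∃ r, ∃ i ≤ ℓ r, v = q r i}ᶜ) : IsConformalMinor A₁ G := by
  let rr : Fin 8 → Fin 3 := ![0, 0, 0, 0, 1, 1, 2, 2]
  let ss : Fin 8 → ℕ := ![1, 1, 1, 2, 1, 2, 1, 2]
  let f : Fin 8 → V := fun a => if a = 0 then x else if a = 1 then y else q (rr a) (ss a)
  have hf0 : f 0 = x := rfl
  have hf1 : f 1 = y := rfl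
  have hf : ∀ a, a ≠ 0 → a ≠ 1 → f a = q (rr a) (ss a) := fun a h0 h1 => by simp [f, h0, h1]
  have hss : ∀ a, 0 < ss a ∧ ss a ≤ 2 := by decide
  have hss' : ∀ a, 0 < ss a ∧ ss a < ℓ (rr a) := fun a =>
    ⟨(hss a).1, lt_of_le_of_lt (hss a).2 (h3 _)⟩
  have hrs : ∀ a b : Fin 8, a ≠ 0 → a ≠ 1 → b ≠ 0 → b ≠ 1 → rr a = rr b → ss a = ss b → a = b := by
    decide
  have hfne : ∀ a, a ≠ 0 → a ≠ 1 → f a ≠ x ∧ f a ≠ y := fun a h0 h1 => by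
    rw [hf a h0 h1]; exact hinner _ _ (hss' a).1 (hss' a).2
  have hE : ∀ a b : Fin 8, b ∈ (![[2, 4, 6], [3, 5, 7], [0, 3], [1, 2], [0, 5], [1, 4], [0, 7],
      [1, 6]] a : List (Fin 8)) → a.val < b.val → b ≠ 0 ∧ b ≠ 1 ∧ ((a = 1 ∧ ss b = 2) ∨
        (a = 0 ∧ ss b = 1) ∨ (a ≠ 0 ∧ a ≠ 1 ∧ rr a = rr b ∧ ss a = 1 ∧ ss b = 2)) := by decide
  have hbr : ∀ b b' : Fin 8, b ≠ 0 → b ≠ 1 → b' ≠ 0 → b' ≠ 1 → ss b = 2 → ss b' = 2 →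
      rr b = rr b' → b = b' := by decide
  let p : Fin 8 → Fin 8 → ℕ → V := fun a b i =>
    if a = 1 then q (rr b) (ℓ (rr b) - i) else if i = 0 then f a else f b
  let L : Fin 8 → Fin 8 → ℕ := fun a b => if a = 1 then ℓ (rr b) - 2 else 1
  have hp1 : ∀ b i, p 1 b i = q (rr b) (ℓ (rr b) - i) := fun b i => by simp [p]
  have hL1 : ∀ b, L 1 b = ℓ (rr b) - 2 := fun b => by simp [L]
  have hLn : ∀ a b, a ≠ 1 → L a b = 1 := fun a b ha => by simp [L, ha]
  -- only the paths from `1` have inner vertices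
  have hin : ∀ a b i, 0 < i → i < L a b → a = 1 := by
    intro a b i hi hi'
    by_contra ha
    rw [hLn a b ha] at hi'
    omega
  refine isConformalMinor_of_paths Fin.val Fin.val_injective f ?_ p L ?_ ?_ ?_ ?_ ?_ ?_ ?_ ?_
  · intro a b hab
    by_cases ha0 : a = 0
    · subst ha0
      by_cases hb0 : b = 0
      · exact hb0.symm
      by_cases hb1 : b = 1
      · subst hb1; exact (hxy hab).elim
      · exact ((hfne b hb0 hb1).1 hab.symm).elim
    by_cases ha1 : a = 1
    · subst ha1
      by_cases hb0 : b = 0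
      · subst hb0; exact (hxy hab.symm).elim
      by_cases hb1 : b = 1
      · exact hb1.symm
      · exact ((hfne b hb0 hb1).2 hab.symm).elim
    by_cases hb0 : b = 0
    · subst hb0; exact ((hfne a ha0 ha1).1 hab).elim
    by_cases hb1 : b = 1
    · subst hb1; exact ((hfne a ha0 ha1).2 hab).elim
    rw [hf a ha0 ha1, hf b hb0 hb1] at hab
    obtain ⟨h1, h2⟩ := hinj _ _ _ _ (hss' a).1 (hss' a).2 (hss' b).1 (hss' b).2 hab
    exact hrs a b ha0 ha1 hb0 hb1 h1 h2
  · intro a b hab hlt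
    by_cases ha : a = 1
    · subst ha; rw [hp1, Nat.sub_zero, hqℓ, hf1]
    · simp [p, ha]
  · intro a b hab hlt
    rw [A₁_adj] at hab
    obtain ⟨hb0, hb1, hc⟩ := hE a b hab hlt
    by_cases ha : a = 1
    · subst ha
      rw [hp1, hL1, hf b hb0 hb1, Nat.sub_sub_self (by have := h3 (rr b); omega)]
      rcases hc with hc | hc | hc
      · rw [hc.2]
      · exact absurd hc.1 (by decide)
      · exact absurd rfl hc.2.1
    · rw [hLn a b ha]; simp [p, ha]
  · intro a b hab hlt
    by_cases ha : a = 1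
    · subst ha
      rw [hL1]
      have := h3 (rr b)
      obtain ⟨d, hd⟩ := hodd (rr b)
      exact ⟨d - 1, by omega⟩
    · rw [hLn a b ha]; exact odd_one
  · intro a b hab hlt i hi
    rw [A₁_adj] at hab
    obtain ⟨hb0, hb1, hc⟩ := hE a b hab hlt
    by_cases ha : a = 1
    · subst ha
      rw [hL1] at hi
      rw [hp1, hp1]
      have := hadj (rr b) (ℓ (rr b) - (i + 1)) (by omega)
      rw [show ℓ (rr b) - (i + 1) + 1 = ℓ (rr b) - i by omega] at this
      exact this.symm
    · rw [hLn a b ha] at hi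
      obtain rfl : i = 0 := by omega
      have e1 : p a b 0 = f a := by simp [p, ha]
      have e2 : p a b (0 + 1) = f b := by simp [p, ha]
      rw [e1, e2, hf b hb0 hb1]
      rcases hc with hc | hc | hc
      · exact (ha hc.1).elim
      · rw [hc.1, hf0, hc.2, ← hq0 (rr b)]
        exact hadj _ 0 (by have := h3 (rr b); omega)
      · rw [hf a hc.1 ha, hc.2.2.1, hc.2.2.2.1, hc.2.2.2.2]
        exact hadj _ 1 (by have := h3 (rr b); omega)
  · intro a b hab hlt i j hi hi' hj hj' hij
    obtain rfl := hin a b i hi hi'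
    rw [hL1] at hi' hj'
    rw [hp1, hp1] at hij
    have := (hinj _ _ _ _ (by omega) (by omega) (by omega) (by omega) hij).2
    omega
  · rintro a b hab hlt i hi hi' ⟨u, hu⟩
    obtain rfl := hin a b i hi hi'
    rw [hL1] at hi'
    rw [hp1] at hu
    have hne := hinner (rr b) (ℓ (rr b) - i) (by omega) (by omega)
    by_cases hu0 : u = 0
    · subst hu0; exact hne.1 hu.symm
    by_cases hu1 : u = 1
    · subst hu1; exact hne.2 hu.symm
    rw [hf u hu0 hu1] at hu
    have h1 := (hinj _ _ _ _ (hss' u).1 (hss' u).2 (by omega) (by omega) hu).2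
    have h2 := (hss u).2
    omega
  · intro a b hab hlt a' b' hab' hlt' hne i j hi hi' hj hj' hij
    obtain rfl := hin a b i hi hi'
    obtain rfl := hin a' b' j hj hj'
    rw [A₁_adj] at hab hab'
    obtain ⟨hb0, hb1, hc⟩ := hE _ b hab hlt
    obtain ⟨hb0', hb1', hc'⟩ := hE _ b' hab' hlt'
    rw [hL1] at hi' hj'
    rw [hp1, hp1] at hij
    have h1 := (hinj _ _ _ _ (by omega) (by omega) (by omega) (by omega) hij).1
    have e : ∀ b : Fin 8, ((1 : Fin 8) = 1 ∧ ss b = 2) ∨ ((1 : Fin 8) = 0 ∧ ss b = 1) ∨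
        ((1 : Fin 8) ≠ 0 ∧ (1 : Fin 8) ≠ 1 ∧ rr 1 = rr b ∧ ss 1 = 1 ∧ ss b = 2) → ss b = 2 := by
      decide
    exact hne (by rw [hbr b b' hb0 hb1 hb0' hb1' (e b hc) (e b' hc') h1])
  · rw [matchable_induce_iff]
    refine hcompl.congr ?_
    congr 1
    have hrb : ∀ r : Fin 3, ∃ b₁ b₂ : Fin 8, A₁.Adj 1 b₂ ∧ (1 : Fin 8).val < b₂.val ∧ b₁ ≠ 0 ∧
        b₁ ≠ 1 ∧ b₂ ≠ 0 ∧ b₂ ≠ 1 ∧ rr b₁ = r ∧ rr b₂ = r ∧ ss b₁ = 1 ∧ ss b₂ = 2 := by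
      simp only [A₁_adj]
      decide
    ext v
    constructor
    · rintro ⟨r, i, hi, rfl⟩
      obtain ⟨b₁, b₂, hadj₂, hlt₂, h10, h11, h20, h21, hr1, hr2, hs1, hs2⟩ := hrb r
      by_cases h0 : i = 0
      · subst h0; rw [hq0]; exact Or.inl ⟨0, rfl⟩
      by_cases hℓ : i = ℓ r
      · subst hℓ; rw [hqℓ]; exact Or.inl ⟨1, rfl⟩
      by_cases h1 : i = 1
      · subst h1; exact Or.inl ⟨b₁, by rw [hf b₁ h10 h11, hr1, hs1]⟩
      by_cases h2 : i = 2
      · subst h2; exact Or.inl ⟨b₂, by rw [hf b₂ h20 h21, hr2, hs2]⟩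
      · refine Or.inr ⟨1, b₂, hadj₂, hlt₂, ℓ r - i, by omega, ?_, ?_⟩
        · rw [hL1, hr2]; omega
        · rw [hp1, hr2, Nat.sub_sub_self hi]
    · rintro (⟨u, rfl⟩ | ⟨a, b, hab, hlt, i, hi, hi', rfl⟩)
      · by_cases hu0 : u = 0
        · subst hu0; exact ⟨0, 0, Nat.zero_le _, by rw [hq0]; rfl⟩
        by_cases hu1 : u = 1
        · subst hu1; exact ⟨0, ℓ 0, le_rfl, by rw [hqℓ]; rfl⟩
        · exact ⟨_, _, (hss' u).2.le, hf u hu0 hu1⟩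
      · obtain rfl := hin a b i hi hi'
        rw [hL1] at hi'
        exact ⟨rr b, _, Nat.sub_le _ _, hp1 b i⟩

end Minors

/-! ### Alternating walks and ears -/

section Mates

variable {V : Type*} {G : SimpleGraph V}

/-- A perfect matching of `G`, encoded by the map that sends each vertex to its partner. -/
def IsMateMap (G : SimpleGraph V) (m : V → V) : Prop :=
  Function.Involutive m ∧ ∀ v, G.Adj v (m v)

lemma allowedGraph_adj {x y : V} : (allowedGraph G).Adj x y ↔ ∃ m, IsMateMap G m ∧ m x = y := by
  classical
  rw [allowedGraph, fromEdgeSet_adj]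
  constructor
  · rintro ⟨⟨M, hM, hxy⟩, -⟩
    obtain ⟨m, h1, h2, rfl⟩ := exists_matchingOf hM
    exact ⟨m, ⟨h1, h2⟩, (mem_matchingOf h1).1 hxy⟩
  · rintro ⟨m, ⟨h1, h2⟩, rfl⟩
    exact ⟨⟨_, matchingOf_mem h1 h2, (mem_matchingOf h1).2 rfl⟩, (h2 x).ne⟩

lemma allowedGraph_le : allowedGraph G ≤ G := by
  intro x y h
  obtain ⟨m, hm, rfl⟩ := allowedGraph_adj.1 h
  exact hm.2 x

lemma exists_isMateMap_of_matchable (hG : Matchable G) : ∃ m, IsMateMap G m := by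
  obtain ⟨M, hM⟩ := hG
  obtain ⟨m, h1, h2, -⟩ := exists_matchingOf hM
  exact ⟨m, h1, h2⟩

lemma exists_isMateMap {A : Set V} (hA : MatchableOn G A) (hA' : MatchableOn G Aᶜ) :
    ∃ m, IsMateMap G m ∧ ∀ v, m v ∈ A ↔ v ∈ A := by
  classical
  obtain ⟨m₁, h₁⟩ := hA
  obtain ⟨m₂, h₂⟩ := hA'
  have h₂' : ∀ v, v ∉ A → m₂ v ∉ A := fun v hv => (h₂ v hv).1
  refine ⟨fun v => if v ∈ A then m₁ v else m₂ v, ⟨fun v => ?_, fun v => ?_⟩, fun v => ?_⟩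
  · by_cases hv : v ∈ A
    · simp only [hv, if_true, (h₁ v hv).1, (h₁ v hv).2.1]
    · simp only [hv, if_false, h₂' v hv, (h₂ v hv).2.1]
  · by_cases hv : v ∈ A
    · simpa only [hv, if_true] using (h₁ v hv).2.2
    · simpa only [hv, if_false] using (h₂ v hv).2.2
  · by_cases hv : v ∈ A
    · simp only [hv, if_true, (h₁ v hv).1]
    · simp only [hv, if_false, h₂' v hv]

lemma IsMateMap.matchableOn {m : V → V} (hm : IsMateMap G m) {A : Set V}
    (hA : ∀ v ∈ A, m v ∈ A) : MatchableOn G A :=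
  ⟨m, fun v hv => ⟨hA v hv, hm.1 v, hm.2 v⟩⟩

lemma allowedGraph_adj_of_compl {x y : V} (hxy : G.Adj x y) (h : MatchableOn G {x, y}ᶜ) :
    (allowedGraph G).Adj x y := by
  obtain ⟨m, hm, hm'⟩ := exists_isMateMap (matchableOn_pair hxy) h
  refine allowedGraph_adj.2 ⟨m, hm, ?_⟩
  have := (hm' x).2 (Or.inl rfl)
  rcases this with h1 | h1
  · exact absurd h1 (hm.2 x).ne.symm
  · exact h1

/-- An alternating walk for two perfect matchings `m` and `m'`, where `m` matches `A` into itself,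
that leaves `A` along an edge of `m'` returns to `A` for the first time after an odd number of
steps. It is a path, and its inner vertices are matched by `m`. -/
lemma exists_ear [Finite V] (col : G.Coloring Bool) {A : Set V} {m m' : V → V}
    (hm : IsMateMap G m) (hmA : ∀ v, m v ∈ A ↔ v ∈ A) (hm' : IsMateMap G m') {u : V} (hu : u ∈ A)
    (hu' : m' u ∉ A) : ∃ (k : ℕ) (p : ℕ → V), 1 ≤ k ∧ p 0 = u ∧ p (2 * k + 1) ∈ A ∧
      (∀ i, 0 < i → i < 2 * k + 1 → p i ∉ A) ∧
      (∀ i j, i ≤ 2 * k + 1 → j ≤ 2 * k + 1 → p i = p j → i = j) ∧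
      (∀ i, G.Adj (p i) (p (i + 1))) ∧
      MatchableOn G (A ∪ {v | ∃ i, 0 < i ∧ i < 2 * k + 1 ∧ v = p i})ᶜ := by
  classical
  set σ : Equiv.Perm V := hm'.1.toPerm.trans hm.1.toPerm with hσ
  have hσa : ∀ v, σ v = m (m' v) := fun v => rfl
  have hcol : ∀ {a b : V}, G.Adj a b → col b = !col a := by
    intro a b hab
    have := col.valid hab
    revert this
    cases col a <;> cases col b <;> simp
  have hσs : ∀ j, (σ ^ (j + 1)) u = m (m' ((σ ^ j) u)) := fun j => by
    rw [pow_succ', Equiv.Perm.mul_apply, hσa]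
  have hex : ∃ j, m' ((σ ^ j) u) ∈ A := by
    refine ⟨orderOf σ - 1, ?_⟩
    rw [← hmA, ← hσs, Nat.sub_add_cancel (orderOf_pos σ), pow_orderOf_eq_one]
    exact hu
  set k := Nat.find hex with hk
  have hk1 : m' ((σ ^ k) u) ∈ A := Nat.find_spec hex
  have hlt : ∀ j < k, m' ((σ ^ j) u) ∉ A := fun j hj => Nat.find_min hex hj
  have hlt' : ∀ j, 0 < j → j ≤ k → (σ ^ j) u ∉ A := by
    intro j hj hjk
    obtain ⟨i, rfl⟩ := Nat.exists_eq_succ_of_ne_zero hj.ne'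
    rw [Nat.succ_eq_add_one, hσs, hmA]
    exact hlt i hjk
  have hk0 : 1 ≤ k := by
    rcases Nat.eq_zero_or_pos k with h | h
    · rw [h] at hk1; exact absurd hk1 hu'
    · exact h
  have hσinj : ∀ i j, i < j → j ≤ k → (σ ^ i) u ≠ (σ ^ j) u := by
    intro i j hij hj he
    refine hlt' (j - i) (by omega) (by omega) ?_
    have : (σ ^ (j - i)) u = u := by
      apply (σ ^ i).injective
      rw [← Equiv.Perm.mul_apply, ← pow_add, Nat.add_sub_cancel' hij.le, he]
    rw [this]; exact hu
  have hσinj' : ∀ i j, i ≤ k → j ≤ k → (σ ^ i) u = (σ ^ j) u → i = j := by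
    intro i j hi hj he
    rcases lt_trichotomy i j with h | h | h
    · exact absurd he (hσinj i j h hj)
    · exact h
    · exact absurd he.symm (hσinj j i h hi)
  have hcolσ : ∀ j, col ((σ ^ j) u) = col u := by
    intro j
    induction j with
    | zero => rfl
    | succ j ih => rw [hσs, hcol (hm.2 _), hcol (hm'.2 _), ih, Bool.not_not]
  have hcolσ' : ∀ j, col (m' ((σ ^ j) u)) = !col u := fun j => by rw [hcol (hm'.2 _), hcolσ]
  set p : ℕ → V := fun i => if i % 2 = 0 then (σ ^ (i / 2)) u else m' ((σ ^ (i / 2)) u) with hp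
  have hp0 : ∀ j, p (2 * j) = (σ ^ j) u := fun j => by
    simp only [hp, Nat.mul_mod_right, if_true, Nat.mul_div_cancel_left j two_pos]
  have hp1 : ∀ j, p (2 * j + 1) = m' ((σ ^ j) u) := fun j => by
    have h1 : (2 * j + 1) % 2 = 1 := by omega
    have h2 : (2 * j + 1) / 2 = j := by omega
    simp only [hp, h1, h2, one_ne_zero, if_false]
  have heo : ∀ i j, p (2 * i) ≠ p (2 * j + 1) := by
    intro i j h
    have := congrArg col h
    rw [hp0, hp1, hcolσ, hcolσ'] at this
    revert this
    cases col u <;> simp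
  refine ⟨k, p, hk0, hp0 0, by rw [hp1]; exact hk1, ?_, ?_, ?_, ?_⟩
  · intro i hi hi'
    rcases Nat.even_or_odd' i with ⟨j, rfl | rfl⟩
    · rw [hp0]; exact hlt' j (by omega) (by omega)
    · rw [hp1]; exact hlt j (by omega)
  · intro i j hi hj hij
    rcases Nat.even_or_odd' i with ⟨i, rfl | rfl⟩ <;>
      rcases Nat.even_or_odd' j with ⟨j, rfl | rfl⟩
    · rw [hp0, hp0] at hij
      rw [hσinj' i j (by omega) (by omega) hij]
    · exact absurd hij (heo _ _)
    · exact absurd hij.symm (heo _ _)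
    · rw [hp1, hp1] at hij
      rw [hσinj' i j (by omega) (by omega) (hm'.1.injective hij)]
  · intro i
    rcases Nat.even_or_odd' i with ⟨j, rfl | rfl⟩
    · rw [hp0, hp1]; exact hm'.2 _
    · rw [hp1, show 2 * j + 1 + 1 = 2 * (j + 1) by ring, hp0, hσs]; exact hm.2 _
  · refine hm.matchableOn ?_
    rintro v hv (h1 | ⟨i, h1, h2, h3⟩)
    · exact hv (Or.inl ((hmA v).1 h1))
    · have h4 : v = m (p i) := by rw [← h3, hm.1]
      rcases Nat.even_or_odd' i with ⟨j, rfl | rfl⟩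
      · obtain ⟨j, rfl⟩ := Nat.exists_eq_succ_of_ne_zero (show j ≠ 0 by omega)
        rw [hp0, Nat.succ_eq_add_one, hσs, hm.1, ← hp1] at h4
        exact hv (Or.inr ⟨_, by omega, by omega, h4⟩)
      · rw [hp1, ← hσs, ← hp0] at h4
        exact hv (Or.inr ⟨_, by omega, by omega, h4⟩)

end Mates

namespace IsConformalCycle

variable {V : Type*} {G : SimpleGraph V} {n : ℕ} {c : ZMod n → V}

lemma color_natCast (h : IsConformalCycle G c) (col : G.Coloring Bool) (i : ℕ) :
    col (c i) = col (c (0 : ℕ)) ↔ i % 2 = 0 := by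
  induction i with
  | zero => simp
  | succ i ih =>
    have h1 := col.valid (h.natCast_adj i)
    have h2 : i % 2 = 0 ∨ i % 2 = 1 := by omega
    have h3 : (i + 1) % 2 = 0 ↔ ¬ i % 2 = 0 := by omega
    rw [h3, ← ih]
    revert h1
    cases col (c i) <;> cases col (c (i + 1 : ℕ)) <;> cases col (c (0 : ℕ)) <;> simp

lemma odd_of_adj (h : IsConformalCycle G c) (col : G.Coloring Bool) {i : ℕ}
    (hi : G.Adj (c (0 : ℕ)) (c i)) : i % 2 = 1 := by
  have h1 := (h.color_natCast col i).not.1 (col.valid hi).symm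
  omega

/-- The vertices of a conformal cycle, listed from `c 0` on. -/
lemma range_eq (h : IsConformalCycle G c) : Set.range c = {v | ∃ i < n, v = c (i : ℕ)} := by
  ext v
  constructor
  · rintro ⟨z, rfl⟩
    obtain ⟨i, hi, rfl⟩ := h.exists_nat z
    exact ⟨i, hi, rfl⟩
  · rintro ⟨i, -, rfl⟩
    exact ⟨_, rfl⟩

lemma matchableOn_arc (h : IsConformalCycle G c) {a b : ℕ} (hab : a ≤ b) (hb : b ≤ n)
    (hpar : a % 2 = b % 2) : MatchableOn G {v | ∃ i, a ≤ i ∧ i < b ∧ v = c (i : ℕ)} := by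
  obtain ⟨k, rfl⟩ : ∃ k, b = a + 2 * k := ⟨(b - a) / 2, by omega⟩
  exact matchableOn_path (fun i => c (i : ℕ)) a k
    (fun i j _ hi _ hj hij => h.natCast_inj (by omega) (by omega) hij) (fun i _ _ => h.natCast_adj i)

lemma matchableOn_range (h : IsConformalCycle G c) : MatchableOn G (Set.range c) := by
  have := h.even
  refine (h.matchableOn_arc (Nat.zero_le n) le_rfl (by grind)).congr ?_
  rw [h.range_eq]
  simp

lemma card_le [Finite V] (h : IsConformalCycle G c) : n ≤ Nat.card V := by
  have := h.neZero
  have h1 := Nat.card_le_card_of_injective c h.inj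
  rwa [Nat.card_zmod] at h1

/-- In a bipartite graph, every edge between two vertices of a conformal cycle is allowed. -/
lemma allowed (h : IsConformalCycle G c) (col : G.Coloring Bool) {i j : ZMod n}
    (hij : G.Adj (c i) (c j)) : (allowedGraph G).Adj (c i) (c j) := by
  have key : ∀ {c : ZMod n → V}, IsConformalCycle G c → ∀ j : ZMod n, G.Adj (c (0 : ℕ)) (c j) →
      (allowedGraph G).Adj (c (0 : ℕ)) (c j) := by
    intro c h j hj
    obtain ⟨j, hjn, rfl⟩ := h.exists_nat j
    have h1 := h.odd_of_adj col hj
    have h2 := h.even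
    refine allowedGraph_adj_of_compl hj ?_
    have hj0 : 0 < j := by omega
    refine (((h.matchableOn_arc (a := 1) (b := j) (by omega) hjn.le (by omega)).union
      (h.matchableOn_arc (a := j + 1) (b := n) (by omega) le_rfl (by grind)) ?_).union
      h.compl ?_).congr ?_
    · rw [Set.disjoint_left]
      rintro v ⟨a, ha, ha', rfl⟩ ⟨b, hb, hb', hab⟩
      have := h.natCast_inj (by omega) (by omega) hab
      omega
    · rw [Set.disjoint_left]
      rintro v (⟨a, ha, ha', rfl⟩ | ⟨a, ha, ha', rfl⟩) hv <;> exact hv ⟨_, rfl⟩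
    · ext v
      constructor
      · rintro ((⟨a, ha, ha', rfl⟩ | ⟨a, ha, ha', rfl⟩) | hv) (h3 | h3)
        · have := h.natCast_inj (by omega) (by omega) h3; omega
        · have := h.natCast_inj (by omega) (by omega) h3; omega
        · have := h.natCast_inj (by omega) (by omega) h3; omega
        · have := h.natCast_inj (by omega) (by omega) h3; omega
        · exact hv ⟨_, h3.symm⟩
        · exact hv ⟨_, h3.symm⟩
      · intro hv
        by_cases hvr : v ∈ Set.range c
        · obtain ⟨z, rfl⟩ := hvr
          obtain ⟨a, ha, rfl⟩ := h.exists_nat z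
          have h3 : a ≠ 0 := fun h3 => hv (Or.inl (by rw [h3]))
          have h4 : a ≠ j := fun h4 => hv (Or.inr (by rw [h4]; rfl))
          rcases lt_or_gt_of_ne h4 with h5 | h5
          · exact Or.inl (Or.inl ⟨a, by omega, h5, rfl⟩)
          · exact Or.inl (Or.inr ⟨a, by omega, ha, rfl⟩)
        · exact Or.inr hvr
  have := key (h.rotate i) (j - i) (by simpa using hij)
  simpa using this

end IsConformalCycle

/-! ### Longest conformal cycles -/

section Longest

variable {V : Type*} {G : SimpleGraph V} {n : ℕ} {c : ZMod n → V}

/-- A path of odd length at least three between consecutive vertices of a conformal cycle yields a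
longer conformal cycle. -/
lemma IsConformalCycle.extend (h : IsConformalCycle G c) {k : ℕ} {p : ℕ → V} (hk : 1 ≤ k)
    (hp0 : p 0 = c (0 : ℕ)) (hpk : p (2 * k + 1) = c (1 : ℕ))
    (hpA : ∀ i, 0 < i → i < 2 * k + 1 → p i ∉ Set.range c)
    (hinj : ∀ i j, i ≤ 2 * k + 1 → j ≤ 2 * k + 1 → p i = p j → i = j)
    (hadj : ∀ i < 2 * k + 1, G.Adj (p i) (p (i + 1)))
    (hcompl : MatchableOn G (Set.range c ∪ {v | ∃ i, 0 < i ∧ i < 2 * k + 1 ∧ v = p i})ᶜ) :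
    ∃ c' : ZMod (n + 2 * k) → V, IsConformalCycle G c' ∧ c' 0 = c (0 : ℕ) := by
  have h4 := h.four_le
  have heven := h.even
  let q : ℕ → V := fun i => if i < 2 * k + 1 then p i else c (i - 2 * k : ℕ)
  have hq1 : ∀ i, i < 2 * k + 1 → q i = p i := fun i hi => by simp only [q, hi, if_true]
  have hq2 : ∀ i, 2 * k < i → q i = c (i - 2 * k : ℕ) := fun i hi => by
    simp only [q, show ¬ i < 2 * k + 1 by omega, if_false]
  have hdis : ∀ i j, i < 2 * k + 1 → 0 < j → j < n → p i ≠ c (j : ℕ) := by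
    intro i j hi hj hj' hij
    rcases Nat.eq_zero_or_pos i with rfl | hi0
    · rw [hp0] at hij
      have := h.natCast_inj (by omega) hj' hij
      omega
    · exact hpA i hi0 hi ⟨_, hij.symm⟩
  refine ⟨_, IsConformalCycle.of_nat (N := n + 2 * k) (by omega) (by grind) q ?_ ?_ ?_ ?_, ?_⟩
  · intro i j hi hj hij
    by_cases hi' : i < 2 * k + 1 <;> by_cases hj' : j < 2 * k + 1
    · rw [hq1 i hi', hq1 j hj'] at hij
      exact hinj i j hi'.le hj'.le hij
    · rw [hq1 i hi', hq2 j (by omega)] at hij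
      exact absurd hij (hdis _ _ hi' (by omega) (by omega))
    · rw [hq1 j hj', hq2 i (by omega)] at hij
      exact absurd hij.symm (hdis _ _ hj' (by omega) (by omega))
    · rw [hq2 i (by omega), hq2 j (by omega)] at hij
      have := h.natCast_inj (by omega) (by omega) hij
      omega
  · intro i hi
    rcases lt_trichotomy i (2 * k) with hlt | rfl | hlt
    · rw [hq1 i (by omega), hq1 (i + 1) (by omega)]
      exact hadj i (by omega)
    · rw [hq1 _ (by omega), hq2 _ (by omega), Nat.add_sub_cancel_left, ← hpk]
      exact hadj _ (by omega)
    · rw [hq2 i hlt, hq2 (i + 1) (by omega), show i + 1 - 2 * k = i - 2 * k + 1 by omega]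
      exact h.natCast_adj _
  · rw [hq1 0 (by omega), hq2 _ (by omega), hp0]
    have := h.natCast_adj (n - 1)
    rw [Nat.sub_add_cancel (by omega), ZMod.natCast_self] at this
    rw [show n + 2 * k - 1 - 2 * k = n - 1 by omega, Nat.cast_zero]
    exact this
  · refine hcompl.congr ?_
    congr 1
    rw [h.range_eq]
    ext v
    constructor
    · rintro (⟨i, hi, rfl⟩ | ⟨i, hi, hi', rfl⟩)
      · rcases Nat.eq_zero_or_pos i with rfl | hi0
        · exact ⟨0, by omega, by rw [hq1 0 (by omega), hp0]⟩
        · exact ⟨i + 2 * k, by omega, by rw [hq2 _ (by omega), Nat.add_sub_cancel]⟩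
      · exact ⟨i, by omega, (hq1 i hi').symm⟩
    · rintro ⟨i, hi, rfl⟩
      by_cases hi' : i < 2 * k + 1
      · rw [hq1 i hi']
        rcases Nat.eq_zero_or_pos i with rfl | hi0
        · exact Or.inl ⟨0, by omega, hp0⟩
        · exact Or.inr ⟨i, hi0, hi', rfl⟩
      · rw [hq2 i (by omega)]
        exact Or.inl ⟨_, by omega, rfl⟩
  · have : NeZero (n + 2 * k) := ⟨by omega⟩
    simp only [ZMod.val_zero]
    rw [hq1 0 (by omega), hp0]

/-- A path of odd length at least three that joins two non-consecutive vertices of a conformal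
cycle forms a bisubdivision of `A₁` with it. -/
lemma IsConformalCycle.isConformalMinor_of_ear (h : IsConformalCycle G c) {j k : ℕ} {p : ℕ → V}
    (hj : 3 ≤ j) (hjodd : j % 2 = 1) (hjn : j + 3 ≤ n) (hk : 1 ≤ k)
    (hp0 : p 0 = c (0 : ℕ)) (hpk : p (2 * k + 1) = c (j : ℕ))
    (hpA : ∀ i, 0 < i → i < 2 * k + 1 → p i ∉ Set.range c)
    (hinj : ∀ i j, i ≤ 2 * k + 1 → j ≤ 2 * k + 1 → p i = p j → i = j)
    (hadj : ∀ i < 2 * k + 1, G.Adj (p i) (p (i + 1)))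
    (hcompl : MatchableOn G (Set.range c ∪ {v | ∃ i, 0 < i ∧ i < 2 * k + 1 ∧ v = p i})ᶜ) :
    IsConformalMinor A₁ G := by
  have heven := h.even
  have hne : c (0 : ℕ) ≠ c (j : ℕ) := fun he => by
    have := h.natCast_inj (by omega) (by omega) he
    omega
  refine isConformalMinor_A₁ hne ![fun i => c (i : ℕ), fun i => c (n - i : ℕ), p]
    ![j, n - j, 2 * k + 1] ?_ ?_ ?_ ?_ ?_ ?_ ?_ ?_
  · intro r
    fin_cases r
    · exact Nat.odd_iff.2 hjodd
    · show Odd (n - j)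
      grind
    · exact ⟨k, rfl⟩
  · intro r
    fin_cases r
    · exact hj
    · show 3 ≤ n - j
      omega
    · show 3 ≤ 2 * k + 1
      omega
  · intro r
    fin_cases r
    · rfl
    · show c (n - 0 : ℕ) = _
      simp
    · exact hp0
  · intro r
    fin_cases r
    · rfl
    · show c (n - (n - j) : ℕ) = _
      rw [Nat.sub_sub_self (by omega)]
    · exact hpk
  · intro r i hi
    fin_cases r
    · exact h.natCast_adj i
    · change i < n - j at hi
      show G.Adj (c (n - i : ℕ)) (c (n - (i + 1) : ℕ))
      have := h.natCast_adj (n - (i + 1))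
      rw [show n - (i + 1) + 1 = n - i by omega] at this
      exact this.symm
    · exact hadj i hi
  · intro r i hi hi'
    fin_cases r
    · change i < j at hi'
      constructor <;> intro he <;> have := h.natCast_inj (by omega) (by omega) he <;> omega
    · change i < n - j at hi'
      constructor <;> intro he <;>
        have := h.natCast_inj (i := n - i) (by omega) (by omega) he <;> omega
    · constructor <;> intro he <;> exact hpA i hi hi' ⟨_, he.symm⟩
  · intro r r' i i' hi hi' hii hii' he
    fin_cases r <;> fin_cases r'
    · change i < j at hi'
      change i' < j at hii'
      exact ⟨rfl, h.natCast_inj (by omega) (by omega) he⟩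
    · change i < j at hi'
      change i' < n - j at hii'
      have := h.natCast_inj (j := n - i') (by omega) (by omega) he
      omega
    · exact absurd ⟨_, he⟩ (hpA i' hii hii')
    · change i < n - j at hi'
      change i' < j at hii'
      have := h.natCast_inj (i := n - i) (by omega) (by omega) he
      omega
    · change i < n - j at hi'
      change i' < n - j at hii'
      have := h.natCast_inj (i := n - i) (j := n - i') (by omega) (by omega) he
      exact ⟨rfl, by omega⟩
    · exact absurd ⟨_, he⟩ (hpA i' hii hii')
    · exact absurd ⟨_, he.symm⟩ (hpA i hi hi')
    · exact absurd ⟨_, he.symm⟩ (hpA i hi hi')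
    · change i < 2 * k + 1 at hi'
      change i' < 2 * k + 1 at hii'
      exact ⟨rfl, hinj _ _ hi'.le hii'.le he⟩
  · refine hcompl.congr ?_
    congr 1
    rw [h.range_eq]
    ext v
    constructor
    · rintro (⟨i, hi, rfl⟩ | ⟨i, hi, hi', rfl⟩)
      · rcases le_total i j with hij | hij
        · exact ⟨0, i, hij, rfl⟩
        · refine ⟨1, n - i, ?_, ?_⟩
          · show n - i ≤ n - j
            omega
          · show c (i : ℕ) = c (n - (n - i) : ℕ)
            rw [Nat.sub_sub_self hi.le]
      · exact ⟨2, i, hi'.le, rfl⟩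
    · rintro ⟨r, i, hi, rfl⟩
      fin_cases r
      · change i ≤ j at hi
        exact Or.inl ⟨i, by omega, rfl⟩
      · change i ≤ n - j at hi
        rcases Nat.eq_zero_or_pos i with rfl | hi0
        · exact Or.inl ⟨0, by omega, by show c (n - 0 : ℕ) = _; simp⟩
        · exact Or.inl ⟨n - i, by omega, rfl⟩
      · change i ≤ 2 * k + 1 at hi
        show p i ∈ _
        rcases Nat.eq_zero_or_pos i with rfl | hi0
        · exact Or.inl ⟨0, by omega, hp0⟩
        · rcases hi.eq_or_lt with rfl | hi1
          · exact Or.inl ⟨j, by omega, hpk⟩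
          · exact Or.inr ⟨i, hi0, hi1, rfl⟩

/-- A longest conformal cycle covers its elementary component: an allowed edge that leaves it would
start an ear, and the ear makes the cycle longer or gives a bisubdivision of `A₁`. -/
lemma IsConformalCycle.range_eq_supp [Finite V] (col : G.Coloring Bool)
    (hA₁ : ¬ IsConformalMinor A₁ G) (K : ElementaryComponent G) (h : IsConformalCycle G c)
    (hK : c 0 ∈ K.supp)
    (hmax : ∀ N (c' : ZMod N → V), IsConformalCycle G c' → c' 0 ∈ K.supp → N ≤ n) :
    Set.range c = K.supp := by
  have hsub : ∀ z, c z ∈ K.supp := by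
    intro z
    obtain ⟨i, -, rfl⟩ := h.exists_nat z
    induction i with
    | zero => simpa using hK
    | succ i ih =>
      have := h.allowed col (h.natCast_adj i)
      exact (K.mem_supp_congr_adj this).1 ih
  refine (Set.range_subset_iff.2 hsub).antisymm fun v hv => ?_
  by_contra hvc
  obtain ⟨w⟩ := K.reachable_of_mem_supp hK hv
  obtain ⟨d, -, ⟨z, hz⟩, hd2⟩ := w.exists_boundary_dart (Set.range c) ⟨0, rfl⟩ hvc
  obtain ⟨m', hm', hmd⟩ := allowedGraph_adj.1 d.adj
  rw [← hz] at hmd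
  obtain ⟨m, hm, hmA⟩ := exists_isMateMap h.matchableOn_range h.compl
  obtain ⟨k, p, hk, hp0, hpk, hpA, hpinj, hpadj, hpc⟩ :=
    exists_ear col hm hmA hm' ⟨z, rfl⟩ (by rw [hmd]; exact hd2)
  have hr := h.rotate z
  have hrange : Set.range (fun i => c (z + i)) = Set.range c :=
    (Equiv.addLeft z).surjective.range_comp c
  obtain ⟨j', hj'⟩ := hpk
  obtain ⟨j, hj, hjz⟩ := h.exists_nat (j' - z)
  have hj1 : p (2 * k + 1) = c (z + (j : ℕ)) := by rw [hjz, ← hj', add_sub_cancel]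
  have hp0' : p 0 = c (z + (0 : ℕ)) := by rw [hp0, Nat.cast_zero, add_zero]
  rw [← hrange] at hpA hpc
  have hjodd : j % 2 = 1 := by
    have h1 : ∀ i, col (p i) = col (p 0) ↔ i % 2 = 0 := by
      intro i
      induction i with
      | zero => simp
      | succ i ih =>
        have h1 := col.valid (hpadj i)
        have h3 : (i + 1) % 2 = 0 ↔ ¬ i % 2 = 0 := by omega
        rw [h3, ← ih]
        revert h1
        cases col (p i) <;> cases col (p (i + 1)) <;> cases col (p 0) <;> simp
    have h2 := hr.color_natCast col j
    rw [← hj1, ← hp0', h1 (2 * k + 1)] at h2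
    omega
  have heven := h.even
  have h4 := h.four_le
  by_cases hj3 : 3 ≤ j ∧ j + 3 ≤ n
  · exact hA₁ (hr.isConformalMinor_of_ear hj3.1 hjodd hj3.2 hk hp0' hj1 hpA hpinj
      (fun i _ => hpadj i) hpc)
  have hcase : j = 1 ∨ j + 1 = n := by grind
  rcases hcase with rfl | hjn
  · obtain ⟨c', hc', hc0⟩ := hr.extend hk hp0' hj1 hpA hpinj (fun i _ => hpadj i) hpc
    have := hmax _ c' hc' (by rw [hc0]; exact hsub _)
    omega
  · have hrange' : Set.range (fun i => c (z + i)) = Set.range (fun i => c (z + -i)) :=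
      ((Equiv.neg (ZMod n)).surjective.range_comp fun i => c (z + i)).symm
    rw [hrange'] at hpA hpc
    have hneg : ((j : ℕ) : ZMod n) = -((1 : ℕ) : ZMod n) := by
      rw [eq_neg_iff_add_eq_zero, ← Nat.cast_add, hjn, ZMod.natCast_self]
    obtain ⟨c', hc', hc0⟩ := hr.reflect.extend hk (by simpa using hp0') (by rw [hj1, hneg]) hpA
      hpinj (fun i _ => hpadj i) hpc
    have := hmax _ c' hc' (by rw [hc0]; exact hsub _)
    omega

/-- An elementary component with more than one edge contains a conformal cycle. -/
lemma exists_isConformalCycle [Finite V] (col : G.Coloring Bool) (hG : Matchable G)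
    (K : ElementaryComponent G) (hK : ¬ IsK₂ K.toSimpleGraph) :
    ∃ (n : ℕ) (c : ZMod n → V), IsConformalCycle G c ∧ c 0 ∈ K.supp := by
  obtain ⟨m, hm⟩ := exists_isMateMap_of_matchable hG
  have key : ∃ x ∈ K.supp, ∃ m', IsMateMap G m' ∧ m' x ≠ m x := by
    by_contra! hno
    refine hK ?_
    obtain ⟨x, hx⟩ := K.nonempty_supp
    have hmx : m x ∈ K.supp :=
      (K.mem_supp_congr_adj (allowedGraph_adj.2 ⟨m, hm, rfl⟩)).1 hx
    have hne : x ≠ m x := (hm.2 x).ne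
    have hall : ∀ v ∈ K.supp, v = x ∨ v = m x := by
      intro v hv
      by_contra hvx
      obtain ⟨w⟩ := K.reachable_of_mem_supp hx hv
      obtain ⟨d, -, hd1, hd2⟩ := w.exists_boundary_dart {x, m x} (Or.inl rfl) hvx
      obtain ⟨m', hm', hmd⟩ := allowedGraph_adj.1 d.adj
      rcases hd1 with hd1 | hd1
      · exact hd2 (Or.inr (by rw [← hmd, hd1]; exact hno x hx m' hm'))
      · exact hd2 (Or.inl (by rw [← hmd, hd1, hno (m x) hmx m' hm', hm.1]))
    have hx' : x ∈ K := hx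
    have hmx' : m x ∈ K := hmx
    have htop : K.toSimpleGraph = ⊤ := by
      ext ⟨a, ha⟩ ⟨b, hb⟩
      rw [K.toSimpleGraph_adj, top_adj, Ne, Subtype.mk.injEq]
      refine ⟨fun h => h.ne, fun hab => ?_⟩
      have hadj : (allowedGraph G).Adj x (m x) := allowedGraph_adj.2 ⟨m, hm, rfl⟩
      rcases hall a ha with rfl | rfl <;> rcases hall b hb with rfl | rfl
      · exact absurd rfl hab
      · exact hadj
      · exact hadj.symm
      · exact absurd rfl hab
    have e : K ≃ Fin 2 :=
      Finite.equivFinOfCardEq (by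
        rw [Nat.card_eq_two_iff]
        refine ⟨⟨x, hx'⟩, ⟨m x, hmx'⟩, fun h => hne (congrArg Subtype.val h), ?_⟩
        ext ⟨v, hv⟩
        simp only [Set.mem_insert_iff, Set.mem_singleton_iff, Set.mem_univ, iff_true,
          Subtype.mk.injEq]
        exact hall v hv)
    exact ⟨⟨e, by intro a b; rw [htop]; simp [completeGraph]⟩⟩
  obtain ⟨x, hx, m', hm', hmm⟩ := key
  have hmA : ∀ v, m v ∈ ({x, m x} : Set V) ↔ v ∈ ({x, m x} : Set V) := by
    intro v
    simp only [Set.mem_insert_iff, Set.mem_singleton_iff]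
    constructor
    · rintro (h | h)
      · exact Or.inr (by rw [← h, hm.1])
      · exact Or.inl (hm.1.injective h)
    · rintro (rfl | rfl)
      · exact Or.inr rfl
      · exact Or.inl (hm.1 _)
  obtain ⟨k, p, hk, hp0, hpk, hpA, hpinj, hpadj, hpc⟩ := exists_ear col hm hmA hm' (Or.inl rfl)
    (show m' x ∉ ({x, m x} : Set V) by
      rintro (h | h)
      · exact (hm'.2 x).ne h.symm
      · exact hmm h)
  have hpk' : p (2 * k + 1) = m x := by
    rcases hpk with h | h
    · have := hpinj (2 * k + 1) 0 le_rfl (by omega) (h.trans hp0.symm)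
      omega
    · exact h
  refine ⟨2 * k + 2, _, IsConformalCycle.of_nat (by omega) (by grind) p
    (fun i j hi hj => hpinj i j (by omega) (by omega)) (fun i _ => hpadj i) ?_ ?_, ?_⟩
  · rw [show 2 * k + 2 - 1 = 2 * k + 1 by omega, hpk', hp0]
    exact (hm.2 x).symm
  · refine hpc.congr ?_
    congr 1
    ext v
    constructor
    · rintro ((h | h) | ⟨i, hi, hi', rfl⟩)
      · exact ⟨0, by omega, by rw [hp0, h]⟩
      · exact ⟨2 * k + 1, by omega, by rw [hpk', h]⟩
      · exact ⟨i, by omega, rfl⟩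
    · rintro ⟨i, hi, rfl⟩
      rcases Nat.eq_zero_or_pos i with rfl | hi0
      · exact Or.inl (Or.inl hp0)
      · rcases (Nat.le_of_lt_succ hi).eq_or_lt with rfl | hi1
        · exact Or.inl (Or.inr hpk')
        · exact Or.inr ⟨i, hi0, hi1, rfl⟩
  · have : NeZero (2 * k + 2) := ⟨by omega⟩
    show p (ZMod.val (0 : ZMod (2 * k + 2))) ∈ K.supp
    rw [ZMod.val_zero, hp0]
    exact hx

/-- A longest one among the conformal cycles that meet the component. -/
lemma exists_hamiltonian_isConformalCycle [Finite V] (col : G.Coloring Bool) (hG : Matchable G)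
    (hA₁ : ¬ IsConformalMinor A₁ G) (K : ElementaryComponent G) (hK : ¬ IsK₂ K.toSimpleGraph) :
    ∃ (n : ℕ) (c : ZMod n → V), IsConformalCycle G c ∧ Set.range c = K.supp := by
  classical
  obtain ⟨n₀, c₀, h₀, hK₀⟩ := exists_isConformalCycle col hG K hK
  let P : ℕ → Prop := fun n => ∃ c : ZMod n → V, IsConformalCycle G c ∧ c 0 ∈ K.supp
  obtain ⟨c, hc, hcK⟩ : P (Nat.findGreatest P (Nat.card V)) :=
    Nat.findGreatest_spec (P := P) h₀.card_le ⟨c₀, h₀, hK₀⟩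
  exact ⟨_, c, hc, hc.range_eq_supp col hA₁ K hcK fun N c' hc' hcK' =>
    Nat.le_findGreatest hc'.card_le ⟨c', hc', hcK'⟩⟩

end Longest

/-! ### Crossing and nested chords of a conformal cycle -/

section Chords

variable {V : Type*} {G : SimpleGraph V} {n : ℕ} {c : ZMod n → V}

/-- A rotation or reflection of the positions on a cycle. -/
def IsFrame (φ : ZMod n → ZMod n) : Prop :=
  ∃ s, (∀ x, φ x = s + x) ∨ ∀ x, φ x = s - x

lemma IsFrame.comp {φ ψ : ZMod n → ZMod n} (hφ : IsFrame φ) (hψ : IsFrame ψ) :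
    IsFrame fun x => φ (ψ x) := by
  obtain ⟨s, hs | hs⟩ := hφ <;> obtain ⟨t, ht | ht⟩ := hψ
  · exact ⟨s + t, Or.inl fun x => by simp only [hs, ht]; ring⟩
  · exact ⟨s + t, Or.inr fun x => by simp only [hs, ht]; ring⟩
  · exact ⟨s - t, Or.inr fun x => by simp only [hs, ht]; ring⟩
  · exact ⟨s - t, Or.inl fun x => by simp only [hs, ht]; ring⟩

lemma isFrame_rotate (s : ZMod n) : IsFrame fun x => s + x := ⟨s, Or.inl fun _ => rfl⟩

lemma isFrame_reflect : IsFrame fun x : ZMod n => -x := ⟨0, Or.inr fun _ => by rw [zero_sub]⟩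

lemma isFrame_id : IsFrame fun x : ZMod n => x := ⟨0, Or.inl fun _ => by rw [zero_add]⟩

/-- Positions `i` and `j` on the cycle `c` whose vertices are joined by a chord. -/
def IsChord (G : SimpleGraph V) (c : ZMod n → V) (i j : ZMod n) : Prop :=
  G.Adj (c i) (c j) ∧ j ≠ i + 1 ∧ i ≠ j + 1

lemma IsChord.symm {i j : ZMod n} (h : IsChord G c i j) : IsChord G c j i :=
  ⟨h.1.symm, h.2.2, h.2.1⟩

lemma IsFrame.isChord_iff {φ : ZMod n → ZMod n} (hφ : IsFrame φ) {i j : ZMod n} :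
    IsChord G (fun x => c (φ x)) i j ↔ IsChord G c (φ i) (φ j) := by
  obtain ⟨s, hs | hs⟩ := hφ
  · simp only [IsChord, hs, ne_eq, add_assoc, add_right_inj]
  · have e : ∀ a b : ZMod n, s - a = s - b + 1 ↔ b = a + 1 := by
      intro a b
      constructor <;> intro h
      · linear_combination h
      · linear_combination h
    simp only [IsChord, hs, ne_eq, e]
    tauto

lemma IsConformalCycle.comp_frame (h : IsConformalCycle G c) {φ : ZMod n → ZMod n}
    (hφ : IsFrame φ) : IsConformalCycle G fun x => c (φ x) := by
  obtain ⟨s, hs | hs⟩ := hφ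
  · simp only [hs]
    exact h.rotate s
  · simp only [hs, sub_eq_add_neg]
    exact (h.rotate s).reflect

/-- Two chords, given by their positions, that are parallel: up to rotation and reflection, they
are `{0, J}` and `{A, B}` with `0 < J < A < B` and `A` even. -/
def ParallelPos (e f : Sym2 (ZMod n)) : Prop :=
  ∃ φ : ZMod n → ZMod n, IsFrame φ ∧ ∃ J A B : ℕ, 0 < J ∧ J < A ∧ A < B ∧ B < n ∧ A % 2 = 0 ∧
    e = s(φ (0 : ℕ), φ J) ∧ f = s(φ A, φ B)

/-- Two chords, given by their positions, that are strongly crossed: up to rotation and reflection,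
they are `{0, A + 1}` and `{A, n - 1}` with `A` even. -/
def StronglyCrossedPos (e f : Sym2 (ZMod n)) : Prop :=
  ∃ φ : ZMod n → ZMod n, IsFrame φ ∧ ∃ A : ℕ, 0 < A ∧ A + 2 < n ∧ A % 2 = 0 ∧
    e = s(φ (0 : ℕ), φ (A + 1 : ℕ)) ∧ f = s(φ A, φ (n - 1 : ℕ))

lemma ParallelPos.comp_frame {φ : ZMod n → ZMod n} (hφ : IsFrame φ) {i j k l : ZMod n}
    (h : ParallelPos s(i, j) s(k, l)) : ParallelPos s(φ i, φ j) s(φ k, φ l) := by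
  obtain ⟨ψ, hψ, J, A, B, h0, h1, h2, h3, h4, h5, h6⟩ := h
  refine ⟨_, hφ.comp hψ, J, A, B, h0, h1, h2, h3, h4, ?_, ?_⟩
  · exact congrArg (Sym2.map φ) h5
  · exact congrArg (Sym2.map φ) h6

lemma StronglyCrossedPos.comp_frame {φ : ZMod n → ZMod n} (hφ : IsFrame φ) {i j k l : ZMod n}
    (h : StronglyCrossedPos s(i, j) s(k, l)) : StronglyCrossedPos s(φ i, φ j) s(φ k, φ l) := by
  obtain ⟨ψ, hψ, A, h0, h1, h2, h5, h6⟩ := h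
  refine ⟨_, hφ.comp hψ, A, h0, h1, h2, ?_, ?_⟩
  · exact congrArg (Sym2.map φ) h5
  · exact congrArg (Sym2.map φ) h6

namespace IsConformalCycle

/-- Crossing chords `{0, J}` and `{a, b}` with `a` even give a bisubdivision of `A₁` unless
`J = a + 1`: the chords and the two even arcs form a conformal cycle, and the odd arc from `a` to
`J` is an ear of it. -/
lemma isConformalMinor_of_cross (h : IsConformalCycle G c) {a J b : ℕ} (ha : 0 < a)
    (ha2 : a % 2 = 0) (haJ : a + 3 ≤ J) (hJ : J % 2 = 1) (hJb : J < b) (hb : b % 2 = 1) (hbn : b < n)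
    (h1 : G.Adj (c (0 : ℕ)) (c J)) (h2 : G.Adj (c a) (c b)) : IsConformalMinor A₁ G := by
  have heven := h.even
  have hne : c (a : ℕ) ≠ c (J : ℕ) := fun he => by
    have := h.natCast_inj (by omega) (by omega) he
    omega
  -- the positions of the vertices of the three paths
  let g : Fin 3 → ℕ → ℕ := ![fun i => a + i, fun i => if i ≤ a then a - i else J,
    fun i => if i = 0 then a else b + 1 - i]
  have hg : ∀ r i, g r i = if r = 0 then a + i else if r = 1 then (if i ≤ a then a - i else J) else
      if i = 0 then a else b + 1 - i := by
    intro r i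
    fin_cases r <;> rfl
  let ℓ : Fin 3 → ℕ := ![J - a, a + 1, b - J + 1]
  have hℓ : ∀ r, ℓ r = if r = 0 then J - a else if r = 1 then a + 1 else b - J + 1 := by
    intro r
    fin_cases r <;> rfl
  have hr3 : ∀ r : Fin 3, r = 0 ∨ r = 1 ∨ r = 2 := by decide
  have h10 : ¬ (1 : Fin 3) = 0 := by decide
  have h20 : ¬ (2 : Fin 3) = 0 := by decide
  have h21 : ¬ (2 : Fin 3) = 1 := by decide
  have hgn : ∀ r i, i ≤ ℓ r → g r i < n := by
    intro r i hi
    rw [hℓ] at hi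
    rw [hg]
    rcases hr3 r with rfl | rfl | rfl <;> simp only [h10, h20, h21, eq_self, if_true, if_false] at hi ⊢ <;>
      (try split_ifs) <;> omega
  refine isConformalMinor_A₁ hne (fun r i => c (g r i : ℕ)) ℓ ?_ ?_ ?_ ?_ ?_ ?_ ?_ ?_
  · intro r
    rw [Nat.odd_iff, hℓ]
    split_ifs <;> omega
  · intro r
    rw [hℓ]
    split_ifs <;> omega
  · intro r
    have : g r 0 = a := by rw [hg]; split_ifs <;> omega
    simp only [this]
  · intro r
    have : g r (ℓ r) = J := by
      rw [hg, hℓ]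
      rcases hr3 r with rfl | rfl | rfl <;> simp only [h10, h20, h21, eq_self, if_true, if_false]
      · omega
      · rw [if_neg (by omega)]
      · rw [if_neg (by omega)]
        omega
    simp only [this]
  · intro r i hi
    rw [hℓ] at hi
    simp only [hg]
    rcases hr3 r with rfl | rfl | rfl <;> simp only [h10, h20, h21, eq_self, if_true, if_false] at hi ⊢
    · exact h.natCast_adj _
    · rcases (Nat.le_of_lt_succ hi).eq_or_lt with rfl | hi'
      · simpa using h1
      · rw [if_pos hi'.le, if_pos (show i + 1 ≤ a from hi'), show a - i = a - (i + 1) + 1 by omega]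
        exact (h.natCast_adj _).symm
    · rcases Nat.eq_zero_or_pos i with rfl | hi0
      · simpa using h2
      · rw [if_neg (by omega), if_neg (by omega), show b + 1 - i = b + 1 - (i + 1) + 1 by omega]
        exact (h.natCast_adj _).symm
  · intro r i hi hi'
    have hn := hgn r i hi'.le
    have hne : g r i ≠ a ∧ g r i ≠ J := by
      rw [hℓ] at hi'
      rw [hg]
      rcases hr3 r with rfl | rfl | rfl <;>
        simp only [h10, h20, h21, eq_self, if_true, if_false] at hi' ⊢ <;> (try split_ifs) <;> omega
    exact ⟨fun he => hne.1 (h.natCast_inj hn (by omega) he),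
      fun he => hne.2 (h.natCast_inj hn (by omega) he)⟩
  · intro r r' i i' hi hi' hii hii' he
    have he' := h.natCast_inj (hgn r i hi'.le) (hgn r' i' hii'.le) he
    rw [hℓ] at hi' hii'
    rw [hg, hg] at he'
    rcases hr3 r with rfl | rfl | rfl <;> rcases hr3 r' with rfl | rfl | rfl <;>
      simp only [h10, h20, h21, eq_self, if_true, if_false] at hi' hii' he' <;>
      (try split_ifs at he') <;> omega
  · refine ((h.matchableOn_arc (a := b + 1) (b := n) (by omega) le_rfl (by grind)).union h.compl
      ?_).congr ?_
    · rw [Set.disjoint_left]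
      rintro v ⟨i, hi, hi', rfl⟩ hv
      exact hv ⟨_, rfl⟩
    · ext v
      constructor
      · rintro (⟨i, hi, hi', rfl⟩ | hv) ⟨r, k, hk, he⟩
        · have he' := h.natCast_inj hi' (hgn r k hk) he
          rw [hℓ] at hk
          rw [hg] at he'
          split_ifs at he' hk <;> omega
        · exact hv ⟨_, he.symm⟩
      · intro hv
        by_cases hvr : v ∈ Set.range c
        · obtain ⟨z, rfl⟩ := hvr
          obtain ⟨i, hi, rfl⟩ := h.exists_nat z
          by_cases hib : b < i
          · exact Or.inl ⟨i, hib, hi, rfl⟩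
          · exfalso
            refine hv ?_
            by_cases hia : i < a
            · exact ⟨1, a - i, by rw [hℓ]; simp only [h10, if_true, if_false]; omega, by
                simp only [hg, h10, if_true, if_false]
                rw [if_pos (by omega), Nat.sub_sub_self hia.le]⟩
            by_cases hiJ : i < J
            · exact ⟨0, i - a, by rw [hℓ, if_pos rfl]; omega, by
                simp only [hg, if_true]
                rw [Nat.add_sub_cancel' (by omega)]⟩
            · exact ⟨2, b + 1 - i, by rw [hℓ, if_neg h20, if_neg h21]; omega, by
                simp only [hg, h20, h21, if_false]
                rw [if_neg (by omega), Nat.sub_sub_self (by omega)]⟩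
        · exact Or.inr hvr

lemma natCast_ne_of_isChord {a b : ℕ} (h : IsChord G c a b) : b ≠ a + 1 ∧ a ≠ b + 1 := by
  constructor
  · rintro rfl; exact h.2.1 (by push_cast; rfl)
  · rintro rfl; exact h.2.2 (by push_cast; rfl)

lemma mod_two_ne (h : IsConformalCycle G c) (col : G.Coloring Bool) {a b : ℕ}
    (hab : G.Adj (c a) (c b)) : a % 2 ≠ b % 2 := by
  intro he
  have h1 := h.color_natCast col a
  have h2 := h.color_natCast col b
  rw [he, ← h2] at h1
  have := col.valid hab
  revert h1 this
  cases col (c a) <;> cases col (c b) <;> cases col (c (0 : ℕ)) <;> simp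

lemma isChord_zero (h : IsConformalCycle G c) (col : G.Coloring Bool) {J : ℕ} (hJn : J < n)
    (hJ : IsChord G c (0 : ℕ) J) : 3 ≤ J ∧ J % 2 = 1 ∧ J + 3 ≤ n := by
  have h1 := h.odd_of_adj col hJ.1
  have h2 := natCast_ne_of_isChord hJ
  have h3 : J + 1 ≠ n := by
    rintro rfl
    apply hJ.2.2
    have := ZMod.natCast_self (J + 1)
    push_cast at this ⊢
    exact this.symm
  have h4 := h.even
  grind

/-- The position of `i` after a rotation of the cycle by `J`. -/
lemma rotate_natCast {J i : ℕ} (hJ : J ≤ n) :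
    (i : ZMod n) = (J : ZMod n) + ((if J ≤ i then i - J else i + n - J : ℕ) : ZMod n) := by
  rw [← Nat.cast_add]
  split_ifs with h
  · rw [Nat.add_sub_cancel' h]
  · rw [Nat.add_sub_cancel' (by omega)]
    simp

variable (h : IsConformalCycle G c) (col : G.Coloring Bool) (hA₁ : ¬ IsConformalMinor A₁ G)
  (hA₂ : ¬ IsConformalMinor A₂ G) (hA₃ : ¬ IsConformalMinor A₃ G)

include h col hA₂ in
/-- Two chords with a common end form a bisubdivision of `A₂` with the cycle. -/
lemma chord_unique {i j k : ZMod n} (hj : IsChord G c i j) (hk : IsChord G c i k) : j = k := by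
  by_contra hjk
  have hr := h.rotate i
  obtain ⟨J, hJn, hJ⟩ := h.exists_nat (j - i)
  obtain ⟨K, hKn, hK⟩ := h.exists_nat (k - i)
  have hJ' : IsChord G (fun x => c (i + x)) (0 : ℕ) J :=
    (isFrame_rotate i).isChord_iff.2 (by simpa [hJ] using hj)
  have hK' : IsChord G (fun x => c (i + x)) (0 : ℕ) K :=
    (isFrame_rotate i).isChord_iff.2 (by simpa [hK] using hk)
  have h1 := hr.isChord_zero col hJn hJ'
  have h2 := hr.isChord_zero col hKn hK'
  have hne : J ≠ K := by
    rintro rfl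
    rw [hJ] at hK
    exact hjk (sub_left_injective hK)
  rcases lt_or_gt_of_ne hne with hlt | hlt
  · exact hA₂ (hr.isConformalMinor_A₂ h1.1 h1.2.1 hlt h2.2.1 h2.2.2 hJ'.1 hK'.1)
  · exact hA₂ (hr.isConformalMinor_A₂ h2.1 h2.2.1 hlt h1.2.1 h1.2.2 hK'.1 hJ'.1)

include h col hA₃ in
/-- Uncrossed chords `{0, J}` and `{a, b}` with `a` odd form a bisubdivision of `A₃` with the cycle;
otherwise they are parallel. -/
lemma even_of_isChord {J a b : ℕ} (hJ : IsChord G c (0 : ℕ) J) (hJa : J < a) (hab : a < b)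
    (hbn : b < n) (hf : IsChord G c a b) : a % 2 = 0 := by
  by_contra ha
  have h1 := h.isChord_zero col (by omega) hJ
  have h2 := natCast_ne_of_isChord hf
  have h3 := h.mod_two_ne col hf.1
  exact hA₃ (h.isConformalMinor_A₃ h1.1 h1.2.1 hJa (by omega) (by omega) (by omega) hbn hJ.1 hf.1)

include h col hA₁ in
/-- Crossing chords `{0, J}` and `{a, b}` with `a` even are strongly crossed:
`isConformalMinor_of_cross` applies on both sides of `{0, J}`. -/
lemma cross_even {J a b : ℕ} (hJ : IsChord G c (0 : ℕ) J) (ha : 0 < a) (ha2 : a % 2 = 0)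
    (haJ : a < J) (hJb : J < b) (hbn : b < n) (hf : IsChord G c a b) : J = a + 1 ∧ b + 1 = n := by
  have h1 := h.isChord_zero col (by omega) hJ
  have h3 := h.mod_two_ne col hf.1
  have heven := h.even
  constructor
  · by_contra hne
    exact hA₁ (h.isConformalMinor_of_cross ha ha2 (by omega) h1.2.1 hJb (by omega) hbn hJ.1 hf.1)
  · by_contra hne
    have hr := h.rotate J
    refine hA₁ (hr.isConformalMinor_of_cross (a := b - J) (J := n - J) (b := a + n - J) (by omega)
      (by omega) (by grind) (by grind) (by omega) (by grind) (by omega) ?_ ?_)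
    · have := rotate_natCast (n := n) (J := J) (i := 0) (by omega)
      rw [if_neg (by omega), Nat.zero_add] at this
      rw [← this]
      simpa using hJ.1.symm
    · have e1 := rotate_natCast (n := n) (J := J) (i := a) (by omega)
      have e2 := rotate_natCast (n := n) (J := J) (i := b) (by omega)
      rw [if_neg (by omega)] at e1
      rw [if_pos (by omega)] at e2
      rw [← e1, ← e2]
      exact hf.1.symm

lemma neg_natCast {i : ℕ} (hi : i ≤ n) : -(i : ZMod n) = ((n - i : ℕ) : ZMod n) := by
  rw [Nat.cast_sub hi, ZMod.natCast_self, zero_sub]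

include h col hA₁ in
/-- The reflection of `cross_even`. -/
lemma cross_odd {J a b : ℕ} (hJ : IsChord G c (0 : ℕ) J) (ha2 : a % 2 = 1)
    (haJ : a < J) (hJb : J < b) (hbn : b < n) (hf : IsChord G c a b) : a = 1 ∧ b = J + 1 := by
  have h1 := h.isChord_zero col (by omega) hJ
  have h3 := h.mod_two_ne col hf.1
  have heven := h.even
  have := h.reflect.cross_even col hA₁ (J := n - J) (a := n - b) (b := n - a)
    (isFrame_reflect.isChord_iff.2 (by
      rw [← neg_natCast (by omega), neg_neg]; simpa using hJ)) (by omega) (by grind) (by omega)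
    (by omega) (by omega) (isFrame_reflect.isChord_iff.2 (by
      rw [← neg_natCast (by omega), ← neg_natCast (by omega), neg_neg, neg_neg]; exact hf.symm))
  omega

end IsConformalCycle
end Chords

/-! ### Parallel and strongly crossed chords -/

section ChordPairs

variable {V : Type*} {G : SimpleGraph V} {n : ℕ} {c : ZMod n → V}

lemma IsChord.congr {i j k l : ZMod n} (h : IsChord G c i j) (he : s(i, j) = s(k, l)) :
    IsChord G c k l := by
  rcases Sym2.eq_iff.1 he with ⟨rfl, rfl⟩ | ⟨rfl, rfl⟩
  · exact h
  · exact h.symm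

lemma natCast_eq_rotate {J a a' : ℕ} (ha : a = J + a' ∨ a + n = J + a') :
    (a : ZMod n) = (J : ZMod n) + (a' : ZMod n) := by
  rcases ha with rfl | ha
  · push_cast; rfl
  · have := congrArg (Nat.cast (R := ZMod n)) ha
    push_cast at this
    simpa using this

lemma IsChord.rotate {J a b a' b' : ℕ} (h : IsChord G c a b) (ha : a = J + a' ∨ a + n = J + a')
    (hb : b = J + b' ∨ b + n = J + b') : IsChord G (fun x : ZMod n => c (J + x)) a' b' :=
  (isFrame_rotate _).isChord_iff.2 (by
    rw [← natCast_eq_rotate ha, ← natCast_eq_rotate hb]; exact h)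

namespace IsConformalCycle

variable (h : IsConformalCycle G c) (col : G.Coloring Bool) (hA₁ : ¬ IsConformalMinor A₁ G)
  (hA₂ : ¬ IsConformalMinor A₂ G) (hA₃ : ¬ IsConformalMinor A₃ G)

include h col hA₃ in
/-- `even_of_isChord` seen from the end `J` of the first chord. -/
lemma odd_of_isChord {J a b : ℕ} (hJ : IsChord G c (0 : ℕ) J) (ha : 0 < a) (hab : a < b) (hbJ : b < J)
    (hJn : J < n) (hf : IsChord G c a b) : a % 2 = 1 := by
  have h1 := h.isChord_zero col hJn hJ
  have h2 := (h.rotate J).even_of_isChord col hA₃ (J := n - J) (a := a + n - J) (b := b + n - J)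
    (hJ.symm.rotate (by omega) (by omega)) (by omega) (by omega) (by omega)
    (hf.rotate (by omega) (by omega))
  have := h.even
  grind

include h col hA₂ in
lemma isChord_disjoint {i j k l : ZMod n} (hij : IsChord G c i j) (hkl : IsChord G c k l)
    (hne : s(i, j) ≠ s(k, l)) : k ≠ i ∧ k ≠ j ∧ l ≠ i ∧ l ≠ j := by
  refine ⟨?_, ?_, ?_, ?_⟩
  · rintro rfl
    exact hne (by rw [h.chord_unique col hA₂ hij hkl])
  · rintro rfl
    exact hne (by rw [h.chord_unique col hA₂ hij.symm hkl, Sym2.eq_swap])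
  · rintro rfl
    exact hne (by rw [h.chord_unique col hA₂ hij hkl.symm, Sym2.eq_swap])
  · rintro rfl
    exact hne (by rw [h.chord_unique col hA₂ hij.symm hkl.symm])

include h col hA₂ in
lemma isChord_disjoint_nat {i j k l : ℕ} (hij : IsChord G c i j) (hkl : IsChord G c k l)
    (hne : s((i : ZMod n), (j : ZMod n)) ≠ s((k : ZMod n), (l : ZMod n))) :
    k ≠ i ∧ k ≠ j ∧ l ≠ i ∧ l ≠ j := by
  obtain ⟨h1, h2, h3, h4⟩ := h.isChord_disjoint col hA₂ hij hkl hne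
  exact ⟨fun e => h1 (by rw [e]), fun e => h2 (by rw [e]), fun e => h3 (by rw [e]),
    fun e => h4 (by rw [e])⟩

include h col hA₁ hA₂ hA₃ in
/-- Any two chords of a conformal cycle are parallel or strongly crossed. -/
lemma parallelPos_or_stronglyCrossedPos {i j k l : ZMod n} (hij : IsChord G c i j)
    (hkl : IsChord G c k l) (hne : s(i, j) ≠ s(k, l)) :
    ParallelPos s(i, j) s(k, l) ∨ StronglyCrossedPos s(i, j) s(k, l) := by
  have key : ∀ {c : ZMod n → V}, IsConformalCycle G c → ∀ {J a b : ℕ}, J < n → a < b → b < n →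
      IsChord G c (0 : ℕ) J → IsChord G c a b →
      s(((0 : ℕ) : ZMod n), (J : ZMod n)) ≠ s((a : ZMod n), (b : ZMod n)) →
      ParallelPos s(((0 : ℕ) : ZMod n), (J : ZMod n)) s((a : ZMod n), (b : ZMod n)) ∨
        StronglyCrossedPos s(((0 : ℕ) : ZMod n), (J : ZMod n)) s((a : ZMod n), (b : ZMod n)) := by
    intro c h J a b hJn hab hbn hJ hf hne
    obtain ⟨d1, d2, d3, d4⟩ := h.isChord_disjoint_nat col hA₂ hJ hf hne
    have hJ3 := h.isChord_zero col hJn hJ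
    have heven := h.even
    rcases lt_or_gt_of_ne d2.symm with hJa | haJ
    · exact Or.inl ⟨_, isFrame_id, J, a, b, by omega, hJa, hab, hbn,
        h.even_of_isChord col hA₃ hJ hJa hab hbn hf, rfl, rfl⟩
    rcases lt_or_gt_of_ne d4 with hbJ | hJb
    · have h1 := h.odd_of_isChord col hA₃ hJ (by omega) hab hbJ hJn hf
      refine Or.inl ⟨_, isFrame_rotate (J : ZMod n), n - J, a + n - J, b + n - J, by omega, by omega,
        by omega, by omega, by grind, ?_, ?_⟩
      · rw [← natCast_eq_rotate (a := J) (by omega), ← natCast_eq_rotate (a := 0) (by omega),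
          Sym2.eq_swap]
      · rw [← natCast_eq_rotate (a := a) (by omega), ← natCast_eq_rotate (a := b) (by omega)]
    · rcases Nat.mod_two_eq_zero_or_one a with ha | ha
      · obtain ⟨rfl, rfl⟩ := h.cross_even col hA₁ hJ (by omega) ha haJ hJb hbn hf
        exact Or.inr ⟨_, isFrame_id, a, by omega, by omega, ha, rfl, rfl⟩
      · obtain ⟨rfl, rfl⟩ := h.cross_odd col hA₁ hJ ha haJ hJb hbn hf
        refine Or.inr ⟨_, isFrame_reflect, n - (J + 1), by omega, by omega, by grind, ?_, ?_⟩
        · rw [show n - (J + 1) + 1 = n - J by omega, ← neg_natCast hJn.le, neg_neg]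
          simp
        · rw [← neg_natCast hbn.le, ← neg_natCast (by omega), neg_neg, neg_neg, Sym2.eq_swap]
  have hf := isFrame_rotate i
  obtain ⟨J, hJn, hJ⟩ := h.exists_nat (j - i)
  obtain ⟨a, han, ha⟩ := h.exists_nat (k - i)
  obtain ⟨b, hbn, hb⟩ := h.exists_nat (l - i)
  have ei : i = i + ((0 : ℕ) : ZMod n) := by simp
  have ej : j = i + (J : ZMod n) := by rw [hJ, add_sub_cancel]
  have ek : k = i + (a : ZMod n) := by rw [ha, add_sub_cancel]
  have el : l = i + (b : ZMod n) := by rw [hb, add_sub_cancel]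
  have hr := h.rotate i
  have h1 : IsChord G (fun x => c (i + x)) (0 : ℕ) J := hf.isChord_iff.2 (by rw [← ei, ← ej]; exact hij)
  have h2 : IsChord G (fun x => c (i + x)) a b := hf.isChord_iff.2 (by rw [← ek, ← el]; exact hkl)
  have h3 : s(((0 : ℕ) : ZMod n), (J : ZMod n)) ≠ s((a : ZMod n), (b : ZMod n)) := by
    intro he
    have := congrArg (Sym2.map fun x => i + x) he
    simp only [Sym2.map_mk] at this
    rw [← ei, ← ej, ← ek, ← el] at this
    exact hne this
  have hab : a ≠ b := by
    rintro rfl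
    exact h2.1.ne rfl
  have hgoal : ParallelPos s(((0 : ℕ) : ZMod n), (J : ZMod n)) s((a : ZMod n), (b : ZMod n)) ∨
        StronglyCrossedPos s(((0 : ℕ) : ZMod n), (J : ZMod n)) s((a : ZMod n), (b : ZMod n)) := by
    rcases lt_or_gt_of_ne hab with hlt | hlt
    · exact key hr hJn hlt hbn h1 h2 h3
    · rw [Sym2.eq_swap (a := (a : ZMod n))] at h3 ⊢
      exact key hr hJn hlt han h1 h2.symm h3
  rw [ei, ej, ek, el]
  simp only [← ei]
  rcases hgoal with hg | hg
  · left; simpa using hg.comp_frame hf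
  · right; simpa using hg.comp_frame hf

include h col hA₁ hA₂ hA₃ in
/-- A chord besides two strongly crossed ones forces the cycle to have length six, and the three
chords to join opposite vertices. -/
lemma isConformalMinor_A₄_of_third {i j k l x y : ZMod n} (hij : IsChord G c i j)
    (hkl : IsChord G c k l) (hx : StronglyCrossedPos s(i, j) s(k, l)) (hxy : IsChord G c x y)
    (h1 : s(i, j) ≠ s(x, y)) (h2 : s(k, l) ≠ s(x, y)) : IsConformalMinor A₄ G := by
  have key : ∀ {c : ZMod n → V}, IsConformalCycle G c → ∀ {A a b : ℕ}, 0 < A → A + 2 < n →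
      A % 2 = 0 → a < b → b < n → IsChord G c (0 : ℕ) (A + 1 : ℕ) → IsChord G c A (n - 1 : ℕ) →
      IsChord G c a b →
      s(((0 : ℕ) : ZMod n), ((A + 1 : ℕ) : ZMod n)) ≠ s((a : ZMod n), (b : ZMod n)) →
      s((A : ZMod n), ((n - 1 : ℕ) : ZMod n)) ≠ s((a : ZMod n), (b : ZMod n)) →
      IsConformalMinor A₄ G := by
    intro c h A a b hA hAn hA2 hab hbn he hf hg hne1 hne2
    obtain ⟨d1, d2, d3, d4⟩ := h.isChord_disjoint_nat col hA₂ he hg hne1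
    obtain ⟨d5, d6, d7, d8⟩ := h.isChord_disjoint_nat col hA₂ hf hg hne2
    have heven := h.even
    have hr := h.rotate A
    have hf' := hf.rotate (J := A) (a' := 0) (b' := n - 1 - A) (by omega) (by omega)
    by_cases hbA : b < A
    · have h1 := h.odd_of_isChord col hA₃ he (by omega) hab (by omega) (by omega) hg
      have h2 := hr.even_of_isChord col hA₃ hf' (a := a + n - A) (b := b + n - A) (by omega)
        (by omega) (by omega) (hg.rotate (by omega) (by omega))
      grind
    by_cases haA : a < A
    · rcases Nat.mod_two_eq_zero_or_one a with ha | ha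
      · have := h.cross_even col hA₁ he (by omega) ha (by omega) (by omega) hbn hg
        omega
      · obtain ⟨rfl, rfl⟩ := h.cross_odd col hA₁ he ha (by omega) (by omega) hbn hg
        have := hr.cross_even col hA₁ hf' (a := 2) (b := 1 + n - A) (by omega) (by omega) (by omega)
          (by omega) (by omega) (hg.symm.rotate (by omega) (by omega))
        obtain rfl : A = 2 := by omega
        obtain rfl : n = 6 := by omega
        exact h.isConformalMinor_A₄ rfl he.1 hg.1 hf.1
    · have h1 := h.even_of_isChord col hA₃ he (by omega) hab hbn hg
      have h2 := hr.odd_of_isChord col hA₃ hf' (a := a - A) (b := b - A) (by omega)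
        (by omega) (by omega) (by omega) (hg.rotate (by omega) (by omega))
      omega
  obtain ⟨φ, hφ, A, hA, hAn, hA2, e1, e2⟩ := hx
  have hc := h.comp_frame hφ
  have hsurj : ∀ z, ∃ a < n, z = φ (a : ℕ) := by
    intro z
    obtain ⟨s, hs | hs⟩ := hφ
    · obtain ⟨a, ha, hz⟩ := h.exists_nat (z - s)
      exact ⟨a, ha, by rw [hs, hz]; ring⟩
    · obtain ⟨a, ha, hz⟩ := h.exists_nat (s - z)
      exact ⟨a, ha, by rw [hs, hz]; ring⟩
  obtain ⟨a, ha, rfl⟩ := hsurj x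
  obtain ⟨b, hb, rfl⟩ := hsurj y
  have g1 := hφ.isChord_iff.2 (hij.congr e1)
  have g2 := hφ.isChord_iff.2 (hkl.congr e2)
  have g3 := hφ.isChord_iff.2 hxy
  rw [e1] at h1
  rw [e2] at h2
  have hmap : ∀ {p q r t : ZMod n}, s(φ p, φ q) ≠ s(φ r, φ t) → s(p, q) ≠ s(r, t) :=
    fun hne he => hne (congrArg (Sym2.map φ) he)
  have hab : a ≠ b := by
    rintro rfl
    exact hxy.1.ne rfl
  rcases lt_or_gt_of_ne hab with hlt | hlt
  · exact key hc hA hAn hA2 hlt hb g1 g2 g3 (hmap h1) (hmap h2)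
  · rw [Sym2.eq_swap (a := φ (a : ZMod n))] at h1 h2
    exact key hc hA hAn hA2 hlt ha g1 g2 g3.symm (hmap h1) (hmap h2)

end IsConformalCycle
end ChordPairs

/-! ### Closed walks as maps from `ZMod n` -/

section ParametrizesCycle

variable {W : Type*} {J : SimpleGraph W} {r : W} {n : ℕ}

/-- The map `c` lists the vertices of the closed walk `C` of length `n` in order. -/
structure ParametrizesCycle (C : J.Walk r r) (c : ZMod n → W) : Prop where
  length : C.length = n
  getVert : ∀ i : ℕ, i ≤ n → C.getVert i = c i

namespace ParametrizesCycle

lemma of_isCycle {C : J.Walk r r} (hC : C.IsCycle) :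
    ∃ c : ZMod C.length → W, ParametrizesCycle C c := by
  have h3 := hC.three_le_length
  have : NeZero C.length := ⟨by omega⟩
  refine ⟨fun z => C.getVert z.val, rfl, fun i hi => ?_⟩
  rcases hi.eq_or_lt with rfl | hi
  · simp
  · rw [ZMod.val_natCast, Nat.mod_eq_of_lt hi]

variable {C : J.Walk r r} {c : ZMod n → W}

lemma support (h : ParametrizesCycle C c) :
    C.support = (List.range (n + 1)).map fun i : ℕ => c i := by
  refine List.ext_getElem (by simp [h.length]) fun i h1 h2 => ?_
  rw [Walk.length_support, h.length] at h1
  rw [← Walk.getVert_eq_support_getElem _ (by rw [h.length]; omega), h.getVert i (by omega)]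
  simp

lemma support_tail (h : ParametrizesCycle C c) :
    C.support.tail = (List.range n).map fun i : ℕ => c ((i + 1 : ℕ) : ZMod n) := by
  rw [h.support, List.range_succ_eq_map]
  simp

lemma mem_support [NeZero n] (h : ParametrizesCycle C c) {x : W} :
    x ∈ C.support ↔ x ∈ Set.range c := by
  rw [h.support, List.mem_map]
  constructor
  · rintro ⟨i, -, rfl⟩
    exact ⟨_, rfl⟩
  · rintro ⟨z, rfl⟩
    exact ⟨z.val, List.mem_range.2 ((ZMod.val_lt z).trans (Nat.lt_succ_self n)), by simp⟩

lemma mem_edges [NeZero n] (h : ParametrizesCycle C c) {e : Sym2 W} :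
    e ∈ C.edges ↔ ∃ z, e = s(c z, c (z + 1)) := by
  rw [mem_edges_iff_getVert, h.length]
  constructor
  · rintro ⟨i, hi, rfl⟩
    exact ⟨i, by rw [h.getVert i hi.le, h.getVert (i + 1) hi]; push_cast; rfl⟩
  · rintro ⟨z, rfl⟩
    have hz := ZMod.val_lt z
    refine ⟨z.val, hz, ?_⟩
    rw [h.getVert _ hz.le, h.getVert _ hz]
    push_cast
    simp

lemma adj [NeZero n] (h : ParametrizesCycle C c) (z : ZMod n) : J.Adj (c z) (c (z + 1)) :=
  C.adj_of_mem_edges (h.mem_edges.2 ⟨z, rfl⟩)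

lemma natCast_inj (h : ParametrizesCycle C c) (hC : C.IsCycle) {i j : ℕ} (hi : i < n) (hj : j < n)
    (hij : c i = c j) : i = j := by
  have h3 := hC.three_le_length
  rw [h.length] at h3
  have := hC.getVert_injOn' (x₁ := i) (x₂ := j)
    (by simp only [Set.mem_ofPred_eq, h.length]; omega)
    (by simp only [Set.mem_ofPred_eq, h.length]; omega)
  rw [h.getVert i hi.le, h.getVert j hj.le] at this
  exact this hij

lemma injective (h : ParametrizesCycle C c) (hC : C.IsCycle) : Function.Injective c := by
  have h3 := hC.three_le_length
  rw [h.length] at h3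
  have : NeZero n := ⟨by omega⟩
  intro x y hxy
  refine ZMod.val_injective n (h.natCast_inj hC (ZMod.val_lt x) (ZMod.val_lt y) ?_)
  simpa using hxy

lemma surjective [DecidableEq W] (h : ParametrizesCycle C c) (hC : C.IsHamiltonianCycle) :
    Function.Surjective c := by
  have h3 := hC.isCycle.three_le_length
  rw [h.length] at h3
  have : NeZero n := ⟨by omega⟩
  intro x
  exact h.mem_support.1 (hC.mem_support x)

lemma exists_isHamiltonianCycle [DecidableEq W] (hn : 3 ≤ n) {c : ZMod n → W}
    (hc : Function.Bijective c) (hadj : ∀ z, J.Adj (c z) (c (z + 1))) :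
    ∃ C : J.Walk (c 0) (c 0), C.IsHamiltonianCycle ∧ ParametrizesCycle C c := by
  have : NeZero n := ⟨by omega⟩
  let w := walkOfNat (H := J) (fun i : ℕ => c i) n fun i _ => by push_cast; exact hadj _
  have hw : ParametrizesCycle (w.copy (congrArg c Nat.cast_zero)
      (congrArg c (ZMod.natCast_self n))) c := by
    constructor
    · rw [Walk.length_copy, ← Nat.add_right_cancel_iff (n := 1), ← Walk.length_support,
        support_walkOfNat]
      simp
    · intro i hi
      rw [Walk.getVert_copy]
      exact getVert_walkOfNat _ _ _ hi
  have hnd : (w.copy (congrArg c Nat.cast_zero)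
      (congrArg c (ZMod.natCast_self n))).support.tail.Nodup := by
    rw [hw.support_tail]
    refine List.Nodup.map_on (fun i hi j hj hij => ?_) List.nodup_range
    have := (ZMod.natCast_eq_natCast_iff' _ _ n).1 (hc.1 hij)
    have h1 : i ≡ j [MOD n] := Nat.ModEq.add_right_cancel' 1 this
    exact Nat.ModEq.eq_of_lt_of_lt h1 (List.mem_range.1 hi) (List.mem_range.1 hj)
  refine ⟨_, ?_, hw⟩
  rw [Walk.isHamiltonianCycle_iff_isCycle_and_support_count_tail_eq_one]
  constructor
  · rw [Walk.isCycle_iff_isPath_tail_and_le_length]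
    refine ⟨?_, by rw [hw.length]; exact hn⟩
    refine Walk.IsPath.mk' ?_
    rwa [Walk.support_tail_of_not_nil]
    intro hnil
    have := Walk.length_eq_zero_iff.2 hnil
    rw [hw.length] at this
    omega
  · intro a
    refine List.count_eq_one_of_mem hnd ?_
    obtain ⟨z, rfl⟩ := hc.2 a
    rw [hw.support_tail, List.mem_map]
    refine ⟨(z - 1).val, List.mem_range.2 (ZMod.val_lt _), ?_⟩
    push_cast
    simp

/-- The vertex sequences that occur in `OrderedAlong` are the rotations and reflections of `c`. -/
lemma isRotated_iff [NeZero n] (h : ParametrizesCycle C c) {l : List W} :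
    (l ~r C.support.tail ∨ l ~r C.support.tail.reverse) ↔
      ∃ φ : ZMod n → ZMod n, IsFrame φ ∧ l = (List.range n).map fun i : ℕ => c (φ i) := by
  have h1 : ∀ k : ℕ, C.support.tail.rotate k =
      (List.range n).map fun i : ℕ => c ((k + 1 : ℕ) + (i : ZMod n)) := by
    intro k
    rw [h.support_tail]
    refine List.ext_getElem (by simp) fun i hi _ => ?_
    simp only [List.getElem_rotate, List.getElem_map, List.getElem_range, List.length_map,
      List.length_range]
    congr 1
    push_cast
    simp only [ZMod.natCast_mod]
    push_cast
    ring
  have h2 : ∀ k : ℕ, C.support.tail.reverse.rotate k =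
      (List.range n).map fun i : ℕ => c (-(k : ZMod n) - (i : ZMod n)) := by
    intro k
    rw [h.support_tail]
    refine List.ext_getElem (by simp) fun i hi _ => ?_
    simp only [List.getElem_rotate, List.getElem_reverse, List.getElem_map, List.getElem_range,
      List.length_map, List.length_range, List.length_reverse]
    congr 1
    have hlt : (i + k) % n < n := Nat.mod_lt _ (NeZero.pos n)
    rw [show n - 1 - (i + k) % n + 1 = n - (i + k) % n by omega, Nat.cast_sub hlt.le,
      ZMod.natCast_self, ZMod.natCast_mod]
    push_cast
    ring
  constructor
  · rintro (hl | hl)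
    · obtain ⟨k, rfl⟩ := hl.symm
      exact ⟨_, isFrame_rotate _, h1 k⟩
    · obtain ⟨k, rfl⟩ := hl.symm
      exact ⟨_, ⟨_, Or.inr fun _ => rfl⟩, h2 k⟩
  · rintro ⟨φ, ⟨s, hs | hs⟩, rfl⟩
    · left
      refine List.IsRotated.symm ⟨(s - 1).val, ?_⟩
      rw [h1]
      push_cast
      simp [hs]
    · right
      refine List.IsRotated.symm ⟨(-s).val, ?_⟩
      rw [h2]
      simp [hs]

lemma orderedAlong_iff [NeZero n] (h : ParametrizesCycle C c) {w x y z : W} :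
    OrderedAlong C w x y z ↔ ∃ φ : ZMod n → ZMod n, IsFrame φ ∧ ∃ p q t : ℕ, 0 < p ∧ p < q ∧
      q < t ∧ t < n ∧ w = c (φ (0 : ℕ)) ∧ x = c (φ p) ∧ y = c (φ q) ∧ z = c (φ t) := by
  constructor
  · rintro ⟨l, hl, hs⟩
    obtain ⟨φ, hφ, rfl⟩ := h.isRotated_iff.1 hl
    obtain ⟨l', hl', he⟩ := List.sublist_map_iff.1 hs
    have hlt := hl'.subset
    have hp := List.pairwise_lt_range.sublist hl'
    obtain ⟨a, b, p, q, rfl⟩ : ∃ a b p q, l' = [a, b, p, q] := by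
      rcases l' with _ | ⟨a, _ | ⟨b, _ | ⟨p, _ | ⟨q, _ | ⟨t, l⟩⟩⟩⟩⟩ <;> simp at he
      exact ⟨a, b, p, q, rfl⟩
    simp only [List.map_cons, List.map_nil, List.cons.injEq, and_true] at he
    obtain ⟨rfl, rfl, rfl, rfl⟩ := he
    have hqn : q < n := List.mem_range.1 (hlt (by simp))
    simp only [List.pairwise_cons, List.mem_cons] at hp
    have hab : a < b := hp.1 b (by simp)
    have hbp : b < p := hp.2.1 p (by simp)
    have hpq : p < q := hp.2.2.1 q (by simp)
    refine ⟨fun z => φ (a + z), hφ.comp (isFrame_rotate _), b - a, p - a, q - a, by omega, by omega,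
      by omega, by omega, by simp, ?_, ?_, ?_⟩
    · dsimp only; rw [← Nat.cast_add, Nat.add_sub_cancel' (by omega)]
    · dsimp only; rw [← Nat.cast_add, Nat.add_sub_cancel' (by omega)]
    · dsimp only; rw [← Nat.cast_add, Nat.add_sub_cancel' (by omega)]
  · rintro ⟨φ, hφ, p, q, t, h0, h1, h2, h3, rfl, rfl, rfl, rfl⟩
    refine ⟨_, h.isRotated_iff.2 ⟨φ, hφ, rfl⟩, ?_⟩
    have : List.Sublist [0, p, q, t] (List.range n) := by
      refine List.sublist_of_subperm_of_pairwise (r := (· < ·))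
        (List.subperm_of_subset ?_ ?_) ?_ List.pairwise_lt_range
      · simp; omega
      · intro i hi
        simp at hi
        rw [List.mem_range]
        omega
      · simp; omega
    exact this.map fun i : ℕ => c (φ i)

lemma mem_chords [NeZero n] (h : ParametrizesCycle C c) (hc : Function.Injective c) {e : Sym2 W} :
    e ∈ chords C ↔ ∃ i j, IsChord J c i j ∧ e = s(c i, c j) := by
  constructor
  · rintro ⟨h1, h2, h3⟩
    induction e with | _ x y => ?_
    obtain ⟨i, rfl⟩ := h.mem_support.1 (h3 x (Sym2.mem_mk_left _ _))
    obtain ⟨j, rfl⟩ := h.mem_support.1 (h3 y (Sym2.mem_mk_right _ _))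
    refine ⟨i, j, ⟨h1, ?_, ?_⟩, rfl⟩
    · rintro rfl
      exact h2 (h.mem_edges.2 ⟨i, rfl⟩)
    · rintro rfl
      exact h2 (h.mem_edges.2 ⟨j, Sym2.eq_swap⟩)
  · rintro ⟨i, j, ⟨h1, h2, h3⟩, rfl⟩
    refine ⟨h1, fun h4 => ?_, ?_⟩
    · obtain ⟨z, hz⟩ := h.mem_edges.1 h4
      rcases Sym2.eq_iff.1 hz with ⟨e1, e2⟩ | ⟨e1, e2⟩
      · exact h2 (by rw [hc e1, hc e2])
      · exact h3 (by rw [hc e1, hc e2])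
    · intro x hx
      rcases Sym2.mem_iff.1 hx with rfl | rfl
      · exact h.mem_support.2 ⟨_, rfl⟩
      · exact h.mem_support.2 ⟨_, rfl⟩

end ParametrizesCycle
end ParametrizesCycle

/-! ### Elementary components without excluded minors -/

section Structure

variable {V : Type*} {G : SimpleGraph V}

lemma IsFrame.injective {n : ℕ} {φ : ZMod n → ZMod n} (hφ : IsFrame φ) : Function.Injective φ := by
  obtain ⟨s, hs | hs⟩ := hφ <;> intro x y hxy <;> rw [hs, hs] at hxy
  · exact add_right_injective s hxy
  · exact sub_right_injective hxy

section Coloring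

variable {W : Type*} {J : SimpleGraph W} {n : ℕ} {c : ZMod n → W}

/-- The colours alternate along a cycle, read in either direction. -/
lemma color_frame (col : J.Coloring Bool) (hadj : ∀ z, J.Adj (c z) (c (z + 1)))
    {φ : ZMod n → ZMod n} (hφ : IsFrame φ) (i : ℕ) :
    col (c (φ i)) = col (c (φ (0 : ℕ))) ↔ i % 2 = 0 := by
  have hstep : ∀ i : ℕ, col (c (φ (i + 1 : ℕ))) ≠ col (c (φ i)) := by
    intro i
    obtain ⟨s, hs | hs⟩ := hφ
    · rw [hs, hs]
      push_cast
      rw [← add_assoc]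
      exact (col.valid (hadj _)).symm
    · rw [hs, hs]
      have := col.valid (hadj (s - (i + 1 : ℕ)))
      push_cast at this ⊢
      rwa [show s - ((i : ZMod n) + 1) + 1 = s - i by ring] at this
  induction i with
  | zero => simp
  | succ i ih =>
    have h1 := hstep i
    have h3 : (i + 1) % 2 = 0 ↔ ¬ i % 2 = 0 := by omega
    refine Iff.trans ?_ ((not_congr ih).trans h3.symm)
    revert h1
    cases col (c (φ i)) <;> cases col (c (φ (i + 1 : ℕ))) <;> cases col (c (φ (0 : ℕ))) <;> simp

variable {r : W} {C : J.Walk r r}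

lemma ParallelPos.areParallel [NeZero n] (hC : ParametrizesCycle C c) (col : J.Coloring Bool)
    {i j k l : ZMod n} (h : ParallelPos s(i, j) s(k, l)) :
    AreParallel col C s(c i, c j) s(c k, c l) := by
  obtain ⟨φ, hφ, J, A, B, h0, h1, h2, h3, h4, e1, e2⟩ := h
  refine ⟨c (φ (0 : ℕ)), c (φ J), c (φ A), c (φ B), congrArg (Sym2.map c) e1,
    congrArg (Sym2.map c) e2, ((color_frame col hC.adj hφ A).2 h4).symm,
    hC.orderedAlong_iff.2 ⟨φ, hφ, J, A, B, h0, h1, h2, h3, rfl, rfl, rfl, rfl⟩⟩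

lemma StronglyCrossedPos.areStronglyCrossed [NeZero n] (hC : ParametrizesCycle C c)
    (col : J.Coloring Bool) {i j k l : ZMod n} (h : StronglyCrossedPos s(i, j) s(k, l)) :
    AreStronglyCrossed col C s(c i, c j) s(c k, c l) := by
  obtain ⟨φ, hφ, A, h0, h1, h2, e1, e2⟩ := h
  have hstep : ∀ i : ℕ, s(c (φ i), c (φ (i + 1 : ℕ))) ∈ C.edges := by
    intro i
    rw [hC.mem_edges]
    obtain ⟨s, hs | hs⟩ := hφ
    · refine ⟨s + i, ?_⟩
      rw [hs, hs]
      push_cast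
      rw [add_assoc]
    · refine ⟨s - (i + 1 : ℕ), ?_⟩
      rw [hs, hs, Sym2.eq_swap]
      push_cast
      rw [show s - ((i : ZMod n) + 1) + 1 = s - i by ring]
  refine ⟨c (φ (0 : ℕ)), c (φ (A + 1 : ℕ)), c (φ A), c (φ (n - 1 : ℕ)), congrArg (Sym2.map c) e1,
    congrArg (Sym2.map c) e2, ((color_frame col hC.adj hφ A).2 h2).symm,
    hC.orderedAlong_iff.2 ⟨φ, hφ, A, A + 1, n - 1, h0, by omega, by omega, by omega, rfl, rfl, rfl,
      rfl⟩, ?_, ?_⟩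
  · have := hstep (n - 1)
    rw [Nat.sub_add_cancel (by omega), ZMod.natCast_self, ← Nat.cast_zero (R := ZMod n)] at this
    rwa [Sym2.eq_swap]
  · rw [Sym2.eq_swap]
    exact hstep A

end Coloring

/-- A matchable bipartite graph without conformal minors in `𝓐`: each elementary component is `K₂`
or has a Hamilton cycle that is conformal in the whole graph, and whose chords are pairwise
parallel or form one strongly crossed pair. -/
theorem component_of_not_isConformalMinor [Finite V] (hbip : G.IsBipartite) (hG : Matchable G)
    (hA₁ : ¬ IsConformalMinor A₁ G) (hA₂ : ¬ IsConformalMinor A₂ G)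
    (hA₃ : ¬ IsConformalMinor A₃ G) (hA₄ : ¬ IsConformalMinor A₄ G) (K : ElementaryComponent G) :
    IsK₂ K.toSimpleGraph ∨ InB₂ K.toSimpleGraph ∨ InB₃ K.toSimpleGraph := by
  classical
  obtain ⟨col⟩ : Nonempty (G.Coloring Bool) :=
    ⟨G.recolorOfEquiv finTwoEquiv hbip.some⟩
  by_cases hK : IsK₂ K.toSimpleGraph
  · exact Or.inl hK
  right
  obtain ⟨n, c, h, hrange⟩ := exists_hamiltonian_isConformalCycle col hG hA₁ K hK
  have := h.neZero
  have h4 := h.four_le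
  have hmem : ∀ z, c z ∈ K := fun z => by
    have : c z ∈ K.supp := hrange ▸ ⟨z, rfl⟩
    exact this
  let cK : ZMod n → K := fun z => ⟨c z, hmem z⟩
  have hcadj : ∀ i j, K.toSimpleGraph.Adj (cK i) (cK j) ↔ G.Adj (c i) (c j) := fun i j => by
    rw [K.toSimpleGraph_adj]
    exact ⟨fun hij => allowedGraph_le hij, fun hij => h.allowed col hij⟩
  have hchord : ∀ i j, IsChord K.toSimpleGraph cK i j ↔ IsChord G c i j := fun i j => by
    rw [IsChord, IsChord, hcadj]
  have hinj : Function.Injective cK := fun x y hxy => h.inj (congrArg Subtype.val hxy)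
  have hsurj : Function.Surjective cK := by
    rintro ⟨v, hv⟩
    obtain ⟨z, rfl⟩ : v ∈ Set.range c := hrange ▸ hv
    exact ⟨z, rfl⟩
  obtain ⟨C, hC, hCc⟩ := ParametrizesCycle.exists_isHamiltonianCycle (by omega) ⟨hinj, hsurj⟩
    fun z => (hcadj _ _).2 (h.adj z)
  let colK : K.toSimpleGraph.Coloring Bool :=
    Coloring.mk (fun v => col v.1) fun {v w} hvw => col.valid (allowedGraph_le hvw)
  by_cases hcross : ∃ i j k l, IsChord G c i j ∧ IsChord G c k l ∧ s(i, j) ≠ s(k, l) ∧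
      StronglyCrossedPos s(i, j) s(k, l)
  · obtain ⟨i, j, k, l, hij, hkl, hne, hx⟩ := hcross
    refine Or.inl ⟨colK, _, C, ?_, s(cK i, cK j), s(cK k, cK l),
      fun he => hne (Sym2.map.injective hinj he), ?_, hx.areStronglyCrossed hCc colK⟩
    · convert hC
    ext e
    rw [hCc.mem_chords hinj]
    constructor
    · rintro ⟨x, y, hxy, rfl⟩
      rw [hchord] at hxy
      by_contra hno
      refine hA₄ (h.isConformalMinor_A₄_of_third col hA₁ hA₂ hA₃ hij hkl hx hxy ?_ ?_)
      · exact fun he => hno (Or.inl (congrArg (Sym2.map cK) he).symm)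
      · exact fun he => hno (Or.inr (congrArg (Sym2.map cK) he).symm)
    · rintro (rfl | rfl)
      · exact ⟨i, j, (hchord _ _).2 hij, rfl⟩
      · exact ⟨k, l, (hchord _ _).2 hkl, rfl⟩
  · refine Or.inr ⟨colK, _, C, by convert hC, ?_⟩
    intro e he f hf hef
    obtain ⟨i, j, hij, rfl⟩ := (hCc.mem_chords hinj).1 he
    obtain ⟨k, l, hkl, rfl⟩ := (hCc.mem_chords hinj).1 hf
    rw [hchord] at hij hkl
    have hne : s(i, j) ≠ s(k, l) := fun h => hef (congrArg (Sym2.map cK) h)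
    rcases h.parallelPos_or_stronglyCrossedPos col hA₁ hA₂ hA₃ hij hkl hne with hp | hx
    · exact hp.areParallel hCc colK
    · exact absurd ⟨i, j, k, l, hij, hkl, hne, hx⟩ hcross

end Structure

/-! ### Codes of perfect matchings on a Hamilton cycle -/

section Codes

variable {W : Type*} {J : SimpleGraph W} {n : ℕ} {c : ZMod n → W}

/-- A Hamilton cycle of a bipartite graph, as a map `c` that runs once around it, together with a
proper colouring. -/
structure IsColoredHamiltonCycle (J : SimpleGraph W) (col : J.Coloring Bool) (c : ZMod n → W) :
    Prop where
  three_le : 3 ≤ n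
  bij : Function.Bijective c
  adj : ∀ z, J.Adj (c z) (c (z + 1))
  col_succ : ∀ z, col (c (z + 1)) = !col (c z)

lemma IsColoredHamiltonCycle.mk' (hn : 3 ≤ n) (hc : Function.Bijective c)
    (hadj : ∀ z, J.Adj (c z) (c (z + 1))) (col : J.Coloring Bool) :
    IsColoredHamiltonCycle J col c where
  three_le := hn
  bij := hc
  adj := hadj
  col_succ z := by
    have := col.valid (hadj z)
    revert this
    cases col (c z) <;> cases col (c (z + 1)) <;> simp

/-- Whether the edge of the cycle `c` at position `t` is in `M`, negated where `col (c t)` is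
`true`. Without chords in `M`, this does not depend on `t` for a perfect matching `M`. -/
def code (col : J.Coloring Bool) (c : ZMod n → W) (M : Set (Sym2 W)) (t : ZMod n) : Prop :=
  s(c t, c (t + 1)) ∈ M ↔ col (c t) = false

/-- The vertex at position `t` is matched by `M` along a chord. -/
def ChordAt (J : SimpleGraph W) (c : ZMod n → W) (M : Set (Sym2 W)) (t : ZMod n) : Prop :=
  ∃ x, IsChord J c t x ∧ s(c t, c x) ∈ M

/-- `y = x + h`, for truth values read as `0` and `1`. -/
def Step (x h y : Prop) : Prop := (y ↔ x ∨ h) ∧ ¬ (x ∧ h)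

lemma Step.of_not {x h y : Prop} (hs : Step x h y) (hh : ¬ h) : y ↔ x := by
  unfold Step at hs; tauto

lemma step_of_iff {x h y : Prop} (hh : ¬ h) (hxy : y ↔ x) : Step x h y := by
  unfold Step; tauto

namespace IsColoredHamiltonCycle

variable {col : J.Coloring Bool} (h : IsColoredHamiltonCycle J col c)
include h

lemma neZero : NeZero n := ⟨by have := h.three_le; omega⟩

lemma add_one_ne_sub_one (t : ZMod n) : t + 1 ≠ t - 1 := by
  have h3 := h.three_le
  intro he
  have h2 : ((2 : ℕ) : ZMod n) = 0 := by
    push_cast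
    linear_combination he
  rw [ZMod.natCast_eq_zero_iff] at h2
  have := Nat.le_of_dvd two_pos h2
  omega

omit h in
lemma chordAt_iff_of_isChord (huniq : ∀ t x y, IsChord J c t x → IsChord J c t y → x = y)
    {M : Set (Sym2 W)} {t x : ZMod n} (hx : IsChord J c t x) :
    ChordAt J c M t ↔ s(c t, c x) ∈ M := by
  constructor
  · rintro ⟨y, hy, hM⟩
    rwa [huniq _ _ _ hx hy]
  · exact fun hM => ⟨x, hx, hM⟩

omit h in
lemma adj_cases {t x : ZMod n} (htx : J.Adj (c t) (c x)) :
    x = t - 1 ∨ x = t + 1 ∨ IsChord J c t x := by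
  by_cases h1 : x = t + 1
  · exact Or.inr (Or.inl h1)
  by_cases h2 : t = x + 1
  · exact Or.inl (by rw [h2]; ring)
  · exact Or.inr (Or.inr ⟨htx, h1, h2⟩)

lemma existsUnique_iff (huniq : ∀ t x y, IsChord J c t x → IsChord J c t y → x = y)
    {M : Set (Sym2 W)} (hM : M ⊆ J.edgeSet) (t : ZMod n) : (∃! w, s(c t, w) ∈ M) ↔
      (s(c t, c (t - 1)) ∈ M ∧ s(c t, c (t + 1)) ∉ M ∧ ¬ ChordAt J c M t) ∨
      (s(c t, c (t - 1)) ∉ M ∧ s(c t, c (t + 1)) ∈ M ∧ ¬ ChordAt J c M t) ∨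
      (s(c t, c (t - 1)) ∉ M ∧ s(c t, c (t + 1)) ∉ M ∧ ChordAt J c M t) := by
  have hne := h.add_one_ne_sub_one t
  constructor
  · rintro ⟨w, hw, hu⟩
    obtain ⟨x, rfl⟩ := h.bij.2 w
    have hx : ∀ y, s(c t, c y) ∈ M → y = x := fun y hy => h.bij.1 (hu _ hy)
    rcases adj_cases (hM hw) with rfl | rfl | hch
    · refine Or.inl ⟨hw, fun h1 => hne (hx _ h1), ?_⟩
      rintro ⟨y, hy, hy'⟩
      obtain rfl := hx y hy'
      exact hy.2.2 (by ring)
    · refine Or.inr (Or.inl ⟨fun h1 => hne (hx _ h1).symm, hw, ?_⟩)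
      rintro ⟨y, hy, hy'⟩
      obtain rfl := hx y hy'
      exact hy.2.1 rfl
    · refine Or.inr (Or.inr ⟨fun h1 => ?_, fun h1 => ?_, x, hch, hw⟩)
      · obtain rfl := hx _ h1
        exact hch.2.2 (by ring)
      · obtain rfl := hx _ h1
        exact hch.2.1 rfl
  · have key : ∀ x, s(c t, c x) ∈ M → (∀ y, s(c t, c y) ∈ M → y = x) → ∃! w, s(c t, w) ∈ M := by
      intro x hx hu
      refine ⟨c x, hx, fun w hw => ?_⟩
      obtain ⟨y, rfl⟩ := h.bij.2 w
      rw [hu y hw]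
    rintro (⟨h1, h2, h3⟩ | ⟨h1, h2, h3⟩ | ⟨h1, h2, x, hx, hxM⟩)
    · refine key _ h1 fun y hy => ?_
      rcases adj_cases (hM hy) with rfl | rfl | hch
      · rfl
      · exact absurd hy h2
      · exact absurd ⟨y, hch, hy⟩ h3
    · refine key _ h2 fun y hy => ?_
      rcases adj_cases (hM hy) with rfl | rfl | hch
      · exact absurd hy h1
      · rfl
      · exact absurd ⟨y, hch, hy⟩ h3
    · refine key _ hxM fun y hy => ?_
      rcases adj_cases (hM hy) with rfl | rfl | hch
      · exact absurd hy h1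
      · exact absurd hy h2
      · exact huniq _ _ _ hch hx

/-- A set of edges is a perfect matching if and only if the code increases by the number of chords
in `M` at each position of colour `true`, and decreases by it at each position of colour `false`. -/
lemma mem_perfectMatchings_iff (huniq : ∀ t x y, IsChord J c t x → IsChord J c t y → x = y)
    {M : Set (Sym2 W)} (hM : M ⊆ J.edgeSet) : M ∈ perfectMatchings J ↔
      (∀ t, col (c t) = true → Step (code col c M (t - 1)) (ChordAt J c M t) (code col c M t)) ∧
      ∀ t, col (c t) = false → Step (code col c M t) (ChordAt J c M t) (code col c M (t - 1)) := by
  rw [mem_perfectMatchings, and_iff_right hM, ← forall_and,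
    h.bij.2.forall (p := fun v => ∃! w, s(v, w) ∈ M)]
  refine forall_congr' fun t => ?_
  rw [h.existsUnique_iff huniq hM t]
  have h1 : code col c M (t - 1) ↔ (s(c t, c (t - 1)) ∈ M ↔ col (c t) = true) := by
    have := h.col_succ (t - 1)
    rw [sub_add_cancel] at this
    rw [code, sub_add_cancel, Sym2.eq_swap, this]
    simp
  rw [h1, code]
  generalize (s(c t, c (t - 1)) ∈ M) = a
  generalize (s(c t, c (t + 1)) ∈ M) = b
  generalize ChordAt J c M t = d
  unfold Step
  cases col (c t) <;> simp <;> tauto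

end IsColoredHamiltonCycle

/-- The positions from `b` (inclusive) to `w` (exclusive) in cyclic order. -/
def arc (b w : ZMod n) : Set (ZMod n) := {t | (t - b).val < (w - b).val}

section Arc

variable [NeZero n]

lemma val_sub_one_of_ne_zero {s : ZMod n} (hs : s ≠ 0) : (s - 1).val + 1 = s.val := by
  have h0 : 0 < s.val := Nat.pos_of_ne_zero fun h => hs ((ZMod.val_eq_zero s).1 h)
  have h1 := ZMod.val_lt s
  have h2 : s - 1 = ((s.val - 1 : ℕ) : ZMod n) := by
    rw [Nat.cast_sub h0]
    simp
  rw [h2, ZMod.val_natCast, Nat.mod_eq_of_lt (by omega)]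
  omega

omit [NeZero n] in
lemma left_mem_arc {b w : ZMod n} (hbw : b ≠ w) : b ∈ arc b w := by
  show (b - b).val < (w - b).val
  rw [sub_self, ZMod.val_zero]
  exact Nat.pos_of_ne_zero fun h => hbw (sub_eq_zero.1 ((ZMod.val_eq_zero _).1 h)).symm

omit [NeZero n] in
lemma right_notMem_arc {b w : ZMod n} : w ∉ arc b w :=
  fun h => lt_irrefl (w - b).val h

lemma left_sub_one_notMem_arc {b w : ZMod n} : b - 1 ∉ arc b w := by
  show ¬ (b - 1 - b).val < (w - b).val
  have h1 := ZMod.val_lt (w - b)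
  have h2 : (b - 1 - b).val = n - 1 := by
    rw [show b - 1 - b = ((n - 1 : ℕ) : ZMod n) by
      rw [Nat.cast_sub (NeZero.pos n)]; simp, ZMod.val_natCast,
      Nat.mod_eq_of_lt (Nat.sub_lt (NeZero.pos n) one_pos)]
  omega

lemma mem_arc_iff_sub_one {b w t : ZMod n} (hb : t ≠ b) (hw : t ≠ w) :
    t ∈ arc b w ↔ t - 1 ∈ arc b w := by
  show (t - b).val < _ ↔ (t - 1 - b).val < _
  have h1 := val_sub_one_of_ne_zero (sub_ne_zero.2 hb)
  have h2 : (t - b).val ≠ (w - b).val := fun h =>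
    hw (sub_left_injective (ZMod.val_injective n h))
  rw [show t - 1 - b = t - b - 1 by ring]
  omega

lemma right_sub_one_mem_arc {b w : ZMod n} (hbw : b ≠ w) : w - 1 ∈ arc b w := by
  show (w - 1 - b).val < (w - b).val
  have h1 := val_sub_one_of_ne_zero (sub_ne_zero.2 hbw.symm)
  rw [show w - 1 - b = w - b - 1 by ring]
  omega

/-- Reversing the ends of an arc gives the complement. -/
lemma arc_swap {b w : ZMod n} (hbw : b ≠ w) : arc w b = (arc b w)ᶜ := by
  ext t
  show (t - w).val < (b - w).val ↔ ¬ (t - b).val < (w - b).val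
  have hpos : 0 < (w - b).val := Nat.pos_of_ne_zero fun h =>
    hbw (sub_eq_zero.1 ((ZMod.val_eq_zero _).1 h)).symm
  have h1 : (b - w).val = n - (w - b).val := by
    rw [← neg_sub w b, ZMod.neg_val, if_neg (sub_ne_zero.2 hbw.symm)]
  have h2 := ZMod.val_lt (w - b)
  have h3 := ZMod.val_lt (t - b)
  have h4 : (t - w).val = if (w - b).val ≤ (t - b).val then (t - b).val - (w - b).val
      else (t - b).val + n - (w - b).val := by
    have : t - w = (t - b) - (w - b) := by ring
    split_ifs with hle
    · rw [this, ZMod.val_sub hle]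
    · have e : t - w = (((t - b).val + n - (w - b).val : ℕ) : ZMod n) := by
        rw [Nat.cast_sub (by omega)]
        push_cast
        simp
      rw [e, ZMod.val_natCast, Nat.mod_eq_of_lt (by omega)]
  rw [h1, h4]
  split_ifs <;> omega

omit [NeZero n] in
lemma natCast_mem_arc {i x y : ℕ} (hi : i < n) (hx : x < n) (hy : y < n) (s : ZMod n) :
    s + (i : ZMod n) ∈ arc (s + (x : ZMod n)) (s + (y : ZMod n)) ↔ if x ≤ y then x ≤ i ∧ i < y else x ≤ i ∨ i < y := by
  have key : ∀ {i x : ℕ}, i < n → x < n →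
      ((s + (i : ZMod n)) - (s + (x : ZMod n))).val = if x ≤ i then i - x else i + n - x := by
    intro i x hi hx
    rw [add_sub_add_left_eq_sub]
    split_ifs with h
    · rw [← Nat.cast_sub h, ZMod.val_natCast, Nat.mod_eq_of_lt (by omega)]
    · have : (i : ZMod n) - x = ((i + n - x : ℕ) : ZMod n) := by
        rw [Nat.cast_sub (by omega)]
        simp
      rw [this, ZMod.val_natCast, Nat.mod_eq_of_lt (by omega)]
  show (_ : ZMod n).val < (_ : ZMod n).val ↔ _
  rw [key hi hx, key hy hx]
  split_ifs <;> omega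

end Arc
end Codes

/-! ### Hamilton cycles whose chords have disjoint arcs -/

section Bump

variable {W : Type*} {J : SimpleGraph W} {n : ℕ} {c : ZMod n → W}

/-- The chords of the cycle `c`, as pairs of positions of which the first has colour `true`. -/
abbrev OrientedChord (J : SimpleGraph W) (col : J.Coloring Bool) (c : ZMod n → W) : Type :=
  {p : ZMod n × ZMod n // IsChord J c p.1 p.2 ∧ col (c p.1) = true}

namespace OrientedChord

variable {col : J.Coloring Bool} (p : OrientedChord J col c)

/-- The vertices of the arc from the end of colour `true` to the end of colour `false`. -/
def toArc : Set (ZMod n) := arc p.1.1 p.1.2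

/-- The edge that forms the chord. -/
def edge : Sym2 W := s(c p.1.1, c p.1.2)

lemma col_right : col (c p.1.2) = false := by
  have h1 := p.2.2
  have h2 := col.valid p.2.1.1
  rw [h1] at h2
  simpa using h2.symm

lemma ne : p.1.1 ≠ p.1.2 := fun h => p.2.1.1.ne (congrArg c h)

lemma edge_mem : p.edge ∈ J.edgeSet := p.2.1.1

lemma exists_of_isChord {x y : ZMod n} (h : IsChord J c x y) :
    ∃ p : OrientedChord J col c, s(c x, c y) = p.edge ∧
      ((col (c x) = true ∧ p.1 = (x, y)) ∨ (col (c x) = false ∧ p.1 = (y, x))) := by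
  cases hx : col (c x)
  · have hy : col (c y) = true := by
      have := col.valid h.1
      rw [hx] at this
      simpa using this.symm
    exact ⟨⟨(y, x), h.symm, hy⟩, Sym2.eq_swap, Or.inr ⟨rfl, rfl⟩⟩
  · exact ⟨⟨(x, y), h, hx⟩, rfl, Or.inl ⟨rfl, rfl⟩⟩

lemma edge_injective (hc : Function.Injective c) :
    Function.Injective (edge : OrientedChord J col c → Sym2 W) := by
  intro p p' h
  rcases Sym2.eq_iff.1 h with ⟨h1, h2⟩ | ⟨h1, h2⟩
  · exact Subtype.ext (Prod.ext (hc h1) (hc h2))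
  · have h3 := p.2.2
    rw [h1, p'.col_right] at h3
    exact absurd h3 (by simp)

end OrientedChord

open OrientedChord

/-- The edge set whose code is `U`, and which contains the chords in `T`. -/
def ofCode (col : J.Coloring Bool) (c : ZMod n → W) (U : ZMod n → Prop)
    (T : Set (OrientedChord J col c)) : Set (Sym2 W) :=
  {e | (∃ t, e = s(c t, c (t + 1)) ∧ (U t ↔ col (c t) = false)) ∨ ∃ p ∈ T, e = p.edge}

/-- Going through the positions one by one. -/
lemma zmod_induction [NeZero n] {P : ZMod n → Prop} {t₀ : ZMod n} (h0 : P t₀)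
    (hs : ∀ t, P (t - 1) → P t) (t : ZMod n) : P t := by
  have : ∀ i : ℕ, P (t₀ + i) := by
    intro i
    induction i with
    | zero => simpa using h0
    | succ i ih =>
      refine hs _ ?_
      push_cast
      rwa [← add_assoc, add_sub_cancel_right]
  have := this (t - t₀).val
  simpa using this

namespace IsColoredHamiltonCycle

variable {col : J.Coloring Bool} (h : IsColoredHamiltonCycle J col c)
include h

lemma edge_ne (p : OrientedChord J col c) (t : ZMod n) : p.edge ≠ s(c t, c (t + 1)) := by
  intro he
  rcases Sym2.eq_iff.1 he with ⟨h1, h2⟩ | ⟨h1, h2⟩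
  · exact p.2.1.2.1 (by rw [h.bij.1 h1, h.bij.1 h2])
  · exact p.2.1.2.2 (by rw [h.bij.1 h1, h.bij.1 h2])

lemma cycle_edge_inj {s t : ZMod n} (hst : s(c s, c (s + 1)) = s(c t, c (t + 1))) : s = t := by
  rcases Sym2.eq_iff.1 hst with ⟨h1, -⟩ | ⟨h1, h2⟩
  · exact h.bij.1 h1
  · have h3 := h.bij.1 h1
    have h4 := h.bij.1 h2
    exact absurd (by rw [h4, h3]; ring) (h.add_one_ne_sub_one s)

lemma ofCode_subset (U : ZMod n → Prop) (T : Set (OrientedChord J col c)) :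
    ofCode col c U T ⊆ J.edgeSet := by
  rintro _ (⟨t, rfl, -⟩ | ⟨p, -, rfl⟩)
  · exact h.adj t
  · exact p.edge_mem

lemma code_ofCode (U : ZMod n → Prop) (T : Set (OrientedChord J col c)) (t : ZMod n) :
    code col c (ofCode col c U T) t ↔ U t := by
  have : s(c t, c (t + 1)) ∈ ofCode col c U T ↔ (U t ↔ col (c t) = false) := by
    constructor
    · rintro (⟨t', he, ht⟩ | ⟨p, -, he⟩)
      · obtain rfl := h.cycle_edge_inj he
        exact ht
      · exact absurd he.symm (h.edge_ne p t)
    · exact fun ht => Or.inl ⟨t, rfl, ht⟩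
  rw [code, this]
  tauto

lemma edge_mem_ofCode (U : ZMod n → Prop) (T : Set (OrientedChord J col c))
    (p : OrientedChord J col c) : p.edge ∈ ofCode col c U T ↔ p ∈ T := by
  constructor
  · rintro (⟨t, he, -⟩ | ⟨p', hp, he⟩)
    · exact absurd he (h.edge_ne p t)
    · rwa [edge_injective h.bij.1 he]
  · exact fun hp => Or.inr ⟨p, hp, rfl⟩

lemma edge_cases {e : Sym2 W} (he : e ∈ J.edgeSet) :
    (∃ t, e = s(c t, c (t + 1))) ∨ ∃ p : OrientedChord J col c, e = p.edge := by
  induction e with | _ x y => ?_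
  obtain ⟨i, rfl⟩ := h.bij.2 x
  obtain ⟨j, rfl⟩ := h.bij.2 y
  rcases adj_cases he with rfl | rfl | hch
  · exact Or.inl ⟨i - 1, by rw [sub_add_cancel, Sym2.eq_swap]⟩
  · exact Or.inl ⟨i, rfl⟩
  · obtain ⟨p, hp, -⟩ := exists_of_isChord (col := col) hch
    exact Or.inr ⟨p, hp⟩

omit h in
lemma mem_iff_code {M : Set (Sym2 W)} {t : ZMod n} :
    s(c t, c (t + 1)) ∈ M ↔ (code col c M t ↔ col (c t) = false) := by
  rw [code]; tauto

lemma exists_color (b : Bool) : ∃ t, col (c t) = b := by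
  by_cases hb : col (c 0) = b
  · exact ⟨0, hb⟩
  · refine ⟨0 + 1, ?_⟩
    rw [h.col_succ]
    revert hb
    cases col (c 0) <;> cases b <;> simp

variable (hdis : ∀ p p' : OrientedChord J col c, p ≠ p' → Disjoint p.toArc p'.toArc)
include hdis

omit h in
lemma chord_unique_of_disjoint [NeZero n] (t x y : ZMod n) (hx : IsChord J c t x)
    (hy : IsChord J c t y) : x = y := by
  obtain ⟨p, -, hp⟩ := exists_of_isChord (col := col) hx
  obtain ⟨p', -, hp'⟩ := exists_of_isChord (col := col) hy
  by_cases hpp : p = p'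
  · subst hpp
    rcases hp with ⟨h1, h2⟩ | ⟨h1, h2⟩ <;> rcases hp' with ⟨h3, h4⟩ | ⟨h3, h4⟩
    · exact (Prod.ext_iff.1 (h2.symm.trans h4)).2
    · rw [h1] at h3; exact absurd h3 (by simp)
    · rw [h1] at h3; exact absurd h3 (by simp)
    · exact (Prod.ext_iff.1 (h2.symm.trans h4)).1
  · have hd := Set.disjoint_left.1 (hdis p p' hpp)
    have hne := p.ne
    have hne' := p'.ne
    unfold toArc at hd
    rcases hp with ⟨h1, h2⟩ | ⟨h1, h2⟩ <;> rcases hp' with ⟨h3, h4⟩ | ⟨h3, h4⟩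
    · rw [h2, h4] at hd
      rw [h2] at hne
      rw [h4] at hne'
      exact absurd (left_mem_arc hne') (hd (left_mem_arc hne))
    · rw [h1] at h3; exact absurd h3 (by simp)
    · rw [h1] at h3; exact absurd h3 (by simp)
    · rw [h2, h4] at hd
      rw [h2] at hne
      rw [h4] at hne'
      exact absurd (right_sub_one_mem_arc hne') (hd (right_sub_one_mem_arc hne))

omit h in
/-- How membership in the arcs changes from one position to the next, if the arcs are disjoint. -/
lemma arc_cases [NeZero n] (t : ZMod n) :
    (∃ p : OrientedChord J col c, t = p.1.1 ∧ t ∈ p.toArc ∧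
      (∀ p' : OrientedChord J col c, t - 1 ∉ p'.toArc) ∧ ∀ p', t ∈ toArc p' → p' = p) ∨
    (∃ p : OrientedChord J col c, t = p.1.2 ∧ t - 1 ∈ p.toArc ∧
      (∀ p' : OrientedChord J col c, t ∉ p'.toArc) ∧ ∀ p', t - 1 ∈ toArc p' → p' = p) ∨
    ((∀ p : OrientedChord J col c, t ≠ p.1.1 ∧ t ≠ p.1.2) ∧
      ∀ p : OrientedChord J col c, t ∈ p.toArc ↔ t - 1 ∈ p.toArc) := by
  have hu : ∀ (p p' : OrientedChord J col c) s, s ∈ p.toArc → s ∈ p'.toArc → p' = p := by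
    intro p p' s h1 h2
    by_contra hne
    exact Set.disjoint_left.1 (hdis p p' (Ne.symm hne)) h1 h2
  have huniq := chord_unique_of_disjoint hdis
  by_cases hb : ∃ p : OrientedChord J col c, t = p.1.1
  · obtain ⟨p, rfl⟩ := hb
    have hmem : p.1.1 ∈ p.toArc := left_mem_arc p.ne
    refine Or.inl ⟨p, rfl, hmem, fun p' hp' => ?_, fun p' hp' => hu p p' _ hmem hp'⟩
    by_cases hpp : p.1.1 = p'.1.1
    · rw [hpp] at hp'
      exact left_sub_one_notMem_arc hp'
    · have h1 : p.1.1 ≠ p'.1.2 := fun he => by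
        have := p.2.2
        rw [he, p'.col_right] at this
        exact absurd this (by simp)
      have h2 : p.1.1 ∈ p'.toArc := (mem_arc_iff_sub_one hpp h1).2 hp'
      rw [hu p p' _ hmem h2] at hpp
      exact hpp rfl
  by_cases hw : ∃ p : OrientedChord J col c, t = p.1.2
  · obtain ⟨p, rfl⟩ := hw
    have hmem : p.1.2 - 1 ∈ p.toArc := right_sub_one_mem_arc p.ne
    refine Or.inr (Or.inl ⟨p, rfl, hmem, fun p' hp' => ?_, fun p' hp' => hu p p' _ hmem hp'⟩)
    by_cases hpp : p.1.2 = p'.1.2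
    · rw [hpp] at hp'
      exact right_notMem_arc hp'
    · have h1 : p.1.2 ≠ p'.1.1 := fun he => hb ⟨p', he⟩
      have h2 : p.1.2 - 1 ∈ p'.toArc := (mem_arc_iff_sub_one h1 hpp).1 hp'
      rw [hu p p' _ hmem h2] at hpp
      exact hpp rfl
  · push Not at hb hw
    exact Or.inr (Or.inr ⟨fun p => ⟨hb p, hw p⟩, fun p => mem_arc_iff_sub_one (hb p) (hw p)⟩)

omit h in
lemma chordAt_iff [NeZero n] {M : Set (Sym2 W)} {t : ZMod n} {p : OrientedChord J col c}
    (hp : t = p.1.1 ∨ t = p.1.2) : ChordAt J c M t ↔ p.edge ∈ M := by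
  have huniq := chord_unique_of_disjoint hdis
  rcases hp with rfl | rfl
  · exact chordAt_iff_of_isChord huniq p.2.1
  · rw [chordAt_iff_of_isChord huniq p.2.1.symm, Sym2.eq_swap, OrientedChord.edge]

omit h hdis in
lemma not_chordAt {M : Set (Sym2 W)} {t : ZMod n}
    (hp : ∀ p : OrientedChord J col c, t ≠ p.1.1 ∧ t ≠ p.1.2) : ¬ ChordAt J c M t := by
  rintro ⟨x, hx, -⟩
  obtain ⟨p, -, h1 | h1⟩ := exists_of_isChord (col := col) hx
  · exact (hp p).1 (by rw [h1.2])
  · exact (hp p).2 (by rw [h1.2])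

lemma exists_base [NeZero n] :
    ∃ t₀, col (c t₀) = false ∧ ∀ p : OrientedChord J col c, t₀ ∉ p.toArc := by
  by_cases hI : Nonempty (OrientedChord J col c)
  · obtain ⟨p⟩ := hI
    rcases arc_cases hdis p.1.2 with ⟨p', h1, -⟩ | ⟨p', -, -, h1, -⟩ | ⟨h1, -⟩
    · have := p'.2.2
      rw [← h1, p.col_right] at this
      exact absurd this (by simp)
    · exact ⟨_, p.col_right, h1⟩
    · exact absurd rfl (h1 p).2
  · obtain ⟨t, ht⟩ := h.exists_color false
    exact ⟨t, ht, fun p => (hI ⟨p⟩).elim⟩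

/-- The code of a perfect matching is constant off the arcs of the chords, and grows on an arc if
the matching contains the chord. -/
lemma code_eq [NeZero n] {M : Set (Sym2 W)} (hM : M ∈ perfectMatchings J) {t₀ : ZMod n}
    (h0 : ∀ p : OrientedChord J col c, t₀ ∉ p.toArc) (t : ZMod n) :
    ((∀ p : OrientedChord J col c, t ∉ p.toArc) → (code col c M t ↔ code col c M t₀)) ∧
      ∀ p : OrientedChord J col c, t ∈ p.toArc →
        Step (code col c M t₀) (p.edge ∈ M) (code col c M t) := by
  have hM' := (h.mem_perfectMatchings_iff (chord_unique_of_disjoint hdis)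
    (mem_perfectMatchings.1 hM).1).1 hM
  refine zmod_induction (P := fun t => ((∀ p : OrientedChord J col c, t ∉ p.toArc) →
    (code col c M t ↔ code col c M t₀)) ∧ ∀ p : OrientedChord J col c, t ∈ p.toArc →
      Step (code col c M t₀) (p.edge ∈ M) (code col c M t))
    (t₀ := t₀) ⟨fun _ => Iff.rfl, fun p hp => absurd hp (h0 p)⟩ ?_ t
  clear t
  rintro t ⟨ih1, ih2⟩
  rcases arc_cases hdis t with ⟨p, h1, h2, h3, h4⟩ | ⟨p, h1, h2, h3, h4⟩ | ⟨h1, h2⟩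
  · refine ⟨fun h5 => absurd h2 (h5 p), fun p' hp' => ?_⟩
    obtain rfl := h4 p' hp'
    have h5 := hM'.1 t (by rw [h1]; exact p'.2.2)
    rw [chordAt_iff hdis (Or.inl h1), propext (ih1 h3)] at h5
    exact h5
  · refine ⟨fun _ => ?_, fun p' hp' => absurd hp' (h3 p')⟩
    have h5 := hM'.2 t (by rw [h1]; exact p.col_right)
    rw [chordAt_iff hdis (Or.inr h1)] at h5
    have h6 := ih2 p h2
    unfold Step at h5 h6
    tauto
  · have h5 : code col c M t ↔ code col c M (t - 1) := by
      cases hc : col (c t)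
      · exact ((hM'.2 t hc).of_not (not_chordAt h1)).symm
      · exact (hM'.1 t hc).of_not (not_chordAt h1)
    rw [propext h5]
    simp only [h2]
    exact ⟨ih1, ih2⟩

lemma ofCode_mem [NeZero n] (T : Set (OrientedChord J col c)) :
    ofCode col c (fun t => ∃ p ∈ T, t ∈ p.toArc) T ∈ perfectMatchings J := by
  rw [h.mem_perfectMatchings_iff (chord_unique_of_disjoint hdis) (h.ofCode_subset _ _)]
  simp only [h.code_ofCode]
  constructor <;> intro t ht
  · rcases arc_cases hdis t with ⟨p, h1, h2, h3, h4⟩ | ⟨p, h1, -⟩ | ⟨h1, h2⟩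
    · rw [chordAt_iff hdis (Or.inl h1), h.edge_mem_ofCode]
      constructor
      · constructor
        · rintro ⟨p', hp', hpt⟩
          exact Or.inr (h4 p' hpt ▸ hp')
        · rintro (⟨p', -, hpt⟩ | hp)
          · exact absurd hpt (h3 p')
          · exact ⟨p, hp, h2⟩
      · rintro ⟨⟨p', -, hpt⟩, -⟩
        exact h3 p' hpt
    · rw [h1, p.col_right] at ht
      exact absurd ht (by simp)
    · exact step_of_iff (not_chordAt h1) (by simp only [h2])
  · rcases arc_cases hdis t with ⟨p, h1, -⟩ | ⟨p, h1, h2, h3, h4⟩ | ⟨h1, h2⟩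
    · rw [h1, p.2.2] at ht
      exact absurd ht (by simp)
    · rw [chordAt_iff hdis (Or.inr h1), h.edge_mem_ofCode]
      constructor
      · constructor
        · rintro ⟨p', hp', hpt⟩
          exact Or.inr (h4 p' hpt ▸ hp')
        · rintro (⟨p', -, hpt⟩ | hp)
          · exact absurd hpt (h3 p')
          · exact ⟨p, hp, h2⟩
      · rintro ⟨⟨p', -, hpt⟩, -⟩
        exact h3 p' hpt
    · exact step_of_iff (not_chordAt h1) (by simp only [h2])

lemma ofCode_true_mem [NeZero n] : ofCode col c (fun _ => True) ∅ ∈ perfectMatchings J := by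
  rw [h.mem_perfectMatchings_iff (chord_unique_of_disjoint hdis) (h.ofCode_subset _ _)]
  simp only [h.code_ofCode]
  have : ∀ t, ¬ ChordAt J c (ofCode col c (fun _ => True) (∅ : Set (OrientedChord J col c))) t := by
    rintro t ⟨x, hx, hM⟩
    obtain ⟨p, hp, -⟩ := exists_of_isChord (col := col) hx
    rw [hp, h.edge_mem_ofCode] at hM
    exact hM
  exact ⟨fun t _ => step_of_iff (this t) Iff.rfl, fun t _ => step_of_iff (this t) Iff.rfl⟩

/-- If the arcs of the chords are pairwise disjoint, then the perfect matchings form a bump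
family. -/
lemma exists_isBumpFamily : ∃ (q : Sym2 W) (a : OrientedChord J col c → Sym2 W),
    IsBumpFamily (perfectMatchings J) q edge a := by
  have := h.neZero
  obtain ⟨t₀, hcol, h0⟩ := h.exists_base hdis
  have hq : ∀ M : Set (Sym2 W), s(c t₀, c (t₀ + 1)) ∈ M ↔ code col c M t₀ := fun M => by
    rw [code]; simp [hcol]
  have ha : ∀ (p : OrientedChord J col c), ∀ M : Set (Sym2 W),
      s(c p.1.1, c (p.1.1 + 1)) ∈ M ↔ ¬ code col c M p.1.1 := fun p M => by
    rw [code]; simp [p.2.2]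
  have hstep : ∀ M ∈ perfectMatchings J, ∀ p : OrientedChord J col c,
      Step (code col c M t₀) (p.edge ∈ M) (code col c M p.1.1) := fun M hM p =>
    (h.code_eq hdis hM h0 p.1.1).2 p (left_mem_arc p.ne)
  refine ⟨s(c t₀, c (t₀ + 1)), fun p => s(c p.1.1, c (p.1.1 + 1)), perfectMatchings_antichain,
    ?_, ?_, ?_, ?_, ?_⟩
  · intro M hM hqM p hp
    rw [hq] at hqM
    exact (hstep M hM p).2 ⟨hqM, hp⟩
  · intro M hM p
    rw [ha, hq, (hstep M hM p).1]
    tauto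
  · intro x
    by_cases hx : x ∈ J.edgeSet
    swap
    · exact Or.inl fun M hM hxM => hx ((mem_perfectMatchings.1 hM).1 hxM)
    right
    rcases h.edge_cases hx with ⟨t, rfl⟩ | ⟨p, rfl⟩
    · by_cases ht : ∀ p : OrientedChord J col c, t ∉ p.toArc
      · cases hct : col (c t)
        · left
          intro M hM
          rw [hq, mem_iff_code, (h.code_eq hdis hM h0 t).1 ht, hct]
          simp
        · right; left
          intro M hM
          rw [hq, mem_iff_code, (h.code_eq hdis hM h0 t).1 ht, hct]
          simp
      · push Not at ht
        obtain ⟨p, hp⟩ := ht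
        right; right
        refine ⟨p, Or.inr ?_⟩
        have key : ∀ M ∈ perfectMatchings J, (code col c M t ↔ code col c M p.1.1) := by
          intro M hM
          rw [((h.code_eq hdis hM h0 t).2 p hp).1, (hstep M hM p).1]
        cases hct : col (c t)
        · right
          intro M hM
          rw [ha, mem_iff_code, key M hM, hct]
          simp
        · left
          intro M hM
          rw [ha, mem_iff_code, key M hM, hct]
          simp
    · exact Or.inr (Or.inr ⟨p, Or.inl fun M hM => Iff.rfl⟩)
  · intro T
    refine ⟨_, h.ofCode_mem hdis T, ?_, h.edge_mem_ofCode _ _⟩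
    rw [hq, h.code_ofCode]
    rintro ⟨p, -, hp⟩
    exact h0 p hp
  · refine ⟨_, h.ofCode_true_mem hdis, ?_⟩
    rw [hq, h.code_ofCode]
    trivial

end IsColoredHamiltonCycle
end Bump

/-! ### Strongly crossed chords and covering arcs -/

section Square

variable {W : Type*} {J : SimpleGraph W} {n : ℕ} {c : ZMod n → W}

/-- Every nonempty face of the family `F` is uniform. -/
def FacesUniform {E : Type*} (F : Set (Set E)) : Prop :=
  ∀ X Y, (face F X Y).Nonempty → ∃ d, Uniform (face F X Y) d

/-- The colouring with the two colours exchanged. -/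
def swapColor (col : J.Coloring Bool) : J.Coloring Bool :=
  Coloring.mk (fun v => !col v) fun {v w} hvw => by
    have := col.valid hvw
    simpa using this

lemma swapColor_apply (col : J.Coloring Bool) (v : W) : swapColor col v = !col v := rfl

/-- The codes `P`, `Y`, `R`, `Z` on the four arcs between the ends of two crossing chords. -/
lemma square_codes {P R Y Z e f : Prop} (h1 : Step Z e P) (h2 : Step P f Y) (h3 : Step R e Y)
    (h4 : Step Z f R) : (Y ↔ P ∨ R) ∧ (Z ↔ P ∧ R) ∧ (e ↔ P ∧ ¬ R) ∧ (f ↔ ¬ P ∧ R) := by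
  unfold Step at *
  by_cases hP : P <;> by_cases hR : R <;> by_cases hZ : Z <;> simp_all

namespace IsColoredHamiltonCycle

variable {col : J.Coloring Bool} (h : IsColoredHamiltonCycle J col c)
include h

lemma swap : IsColoredHamiltonCycle J (swapColor col) c :=
  .mk' h.three_le h.bij h.adj _

lemma comp_frame {φ : ZMod n → ZMod n} (hφ : IsFrame φ) :
    IsColoredHamiltonCycle J col fun z => c (φ z) := by
  obtain ⟨s, hs | hs⟩ := hφ
  · refine .mk' h.three_le (h.bij.comp ?_) (fun z => ?_) _
    · rw [show φ = fun x => s + x from funext hs]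
      exact (Equiv.addLeft s).bijective
    · show J.Adj (c (φ z)) (c (φ (z + 1)))
      rw [hs, hs, ← add_assoc]
      exact h.adj _
  · refine .mk' h.three_le (h.bij.comp ?_) (fun z => ?_) _
    · rw [show φ = fun x => s - x from funext hs]
      exact (Equiv.subLeft s).bijective
    · have := (h.adj (s - (z + 1))).symm
      rw [show s - (z + 1) + 1 = s - z by ring] at this
      show J.Adj (c (φ z)) (c (φ (z + 1)))
      rw [hs, hs]
      exact this

/-- If the Hamilton cycle has exactly two chords, which are strongly crossed, then there are at most
four perfect matchings. They are coded by their codes on the two long arcs between ends of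
chords. -/
lemma facesUniform_of_stronglyCrossed [Finite W] (hcol : col (c (0 : ℕ)) = true) {A : ℕ}
    (hA : 0 < A) (hA2 : A % 2 = 0) (hAn : A + 2 < n)
    (hch : ∀ x y : ZMod n, IsChord J c x y ↔
      s(x, y) = s(((0 : ℕ) : ZMod n), ((A + 1 : ℕ) : ZMod n)) ∨
      s(x, y) = s((A : ZMod n), ((n - 1 : ℕ) : ZMod n))) :
    FacesUniform (perfectMatchings J) := by
  have := h.neZero
  have hcast : ∀ i j : ℕ, i < n → j < n → (i : ZMod n) = (j : ZMod n) → i = j := by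
    intro i j hi hj hij
    have := (ZMod.natCast_eq_natCast_iff' i j n).1 hij
    rwa [Nat.mod_eq_of_lt hi, Nat.mod_eq_of_lt hj] at this
  have hcol' : ∀ i : ℕ, col (c (i : ZMod n)) = true ↔ i % 2 = 0 := by
    intro i
    have := color_frame col h.adj isFrame_id i
    rwa [hcol] at this
  have hcolf : ∀ i : ℕ, col (c (i : ZMod n)) = false ↔ i % 2 = 1 := by
    intro i
    rw [← Bool.not_eq_true, hcol']
    omega
  have hn2 : n % 2 = 0 := by
    have := hcol' n
    rw [ZMod.natCast_self, ← Nat.cast_zero (R := ZMod n), hcol] at this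
    exact this.1 rfl
  have hends : ∀ {t x : ZMod n}, IsChord J c t x →
      (t = (0 : ℕ) ∧ x = (A + 1 : ℕ)) ∨ (t = (A + 1 : ℕ) ∧ x = (0 : ℕ)) ∨
      (t = (A : ℕ) ∧ x = (n - 1 : ℕ)) ∨ (t = (n - 1 : ℕ) ∧ x = (A : ℕ)) := by
    intro t x hx
    rcases (hch t x).1 hx with h1 | h1 <;> rcases Sym2.eq_iff.1 h1 with ⟨h2, h3⟩ | ⟨h2, h3⟩
    · exact Or.inl ⟨h2, h3⟩
    · exact Or.inr (Or.inl ⟨h2, h3⟩)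
    · exact Or.inr (Or.inr (Or.inl ⟨h2, h3⟩))
    · exact Or.inr (Or.inr (Or.inr ⟨h2, h3⟩))
  have huniq : ∀ t x y, IsChord J c t x → IsChord J c t y → x = y := by
    intro t x y hx hy
    rcases hends hx with ⟨h1, h2⟩ | ⟨h1, h2⟩ | ⟨h1, h2⟩ | ⟨h1, h2⟩ <;>
      rcases hends hy with ⟨h3, h4⟩ | ⟨h3, h4⟩ | ⟨h3, h4⟩ | ⟨h3, h4⟩ <;>
      first
      | exact h2.trans h4.symm
      | (have := hcast _ _ (by omega) (by omega) (h1.symm.trans h3); omega)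
  have he := (hch (0 : ℕ) (A + 1 : ℕ)).2 (Or.inl rfl)
  have hf := (hch (A : ℕ) (n - 1 : ℕ)).2 (Or.inr rfl)
  have hpred : ∀ i : ℕ, 0 < i → (i : ZMod n) - 1 = (i - 1 : ℕ) := by
    intro i hi
    rw [Nat.cast_sub hi, Nat.cast_one]
  have hzero : ((0 : ℕ) : ZMod n) - 1 = (n - 1 : ℕ) := by
    rw [Nat.cast_sub (by omega), ZMod.natCast_self]
    simp
  have hcodes : ∀ M ∈ perfectMatchings J,
      (∀ i : ℕ, i < A → (code col c M i ↔ code col c M (0 : ℕ))) ∧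
      (∀ i : ℕ, A < i → i < n - 1 → (code col c M i ↔ code col c M (A + 1 : ℕ))) ∧
      (code col c M A ↔ code col c M (0 : ℕ) ∨ code col c M (A + 1 : ℕ)) ∧
      (code col c M (n - 1 : ℕ) ↔ code col c M (0 : ℕ) ∧ code col c M (A + 1 : ℕ)) ∧
      (s(c (0 : ℕ), c (A + 1 : ℕ)) ∈ M ↔ code col c M (0 : ℕ) ∧ ¬ code col c M (A + 1 : ℕ)) ∧
      (s(c (A : ℕ), c (n - 1 : ℕ)) ∈ M ↔ ¬ code col c M (0 : ℕ) ∧ code col c M (A + 1 : ℕ)) := by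
    intro M hM
    obtain ⟨hb, hw⟩ := (h.mem_perfectMatchings_iff huniq (mem_perfectMatchings.1 hM).1).1 hM
    have hconst : ∀ i : ℕ, 0 < i → i ≠ A → i ≠ A + 1 → i < n - 1 →
        (code col c M i ↔ code col c M (i - 1 : ℕ)) := by
      intro i h0 h1 h2 h3
      have hno : ¬ ChordAt J c M i := by
        rintro ⟨x, hx, -⟩
        rcases hends hx with ⟨h4, -⟩ | ⟨h4, -⟩ | ⟨h4, -⟩ | ⟨h4, -⟩ <;>
          (have := hcast _ _ (by omega) (by omega) h4; omega)
      rw [← hpred i h0]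
      cases hc : col (c (i : ZMod n))
      · exact ((hw _ hc).of_not hno).symm
      · exact (hb _ hc).of_not hno
    have hP : ∀ i : ℕ, i < A → (code col c M i ↔ code col c M (0 : ℕ)) := by
      intro i hi
      induction i with
      | zero => rfl
      | succ i ih =>
        exact (hconst (i + 1) (by omega) (by omega) (by omega) (by omega)).trans
          (ih (by omega))
    have hR : ∀ i : ℕ, A < i → i < n - 1 → (code col c M i ↔ code col c M (A + 1 : ℕ)) := by
      intro i hi hi'
      induction i, hi using Nat.le_induction with
      | base => rfl
      | succ i hi ih =>
        exact (hconst (i + 1) (by omega) (by omega) (by omega) hi').trans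
          (ih (by omega))
    have s1 := hb (0 : ℕ) hcol
    have s2 := hb (A : ℕ) ((hcol' A).2 hA2)
    have s3 := hw (A + 1 : ℕ) ((hcolf _).2 (by omega))
    have s4 := hw (n - 1 : ℕ) ((hcolf _).2 (by omega))
    rw [chordAt_iff_of_isChord huniq he, hzero] at s1
    rw [chordAt_iff_of_isChord huniq hf, hpred A hA, propext (hP (A - 1) (by omega))] at s2
    rw [chordAt_iff_of_isChord huniq he.symm, Sym2.eq_swap, hpred _ (by omega),
      Nat.add_sub_cancel] at s3
    rw [chordAt_iff_of_isChord huniq hf.symm, Sym2.eq_swap, hpred _ (by omega),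
      propext (hR (n - 1 - 1) (by omega) (by omega))] at s4
    exact ⟨hP, hR, square_codes s1 s2 s3 s4⟩
  -- the edges that show the two bits of the code, and their negations
  have hp : ∀ M ∈ perfectMatchings J,
      (s(c (1 : ℕ), c ((1 : ℕ) + 1)) ∈ M ↔ code col c M (0 : ℕ)) := fun M hM => by
    rw [mem_iff_code, (hcodes M hM).1 1 (by omega), (hcolf 1).2 rfl]
    simp
  have hp' : ∀ M : Set (Sym2 W),
      (s(c (0 : ℕ), c ((0 : ℕ) + 1)) ∈ M ↔ ¬ code col c M (0 : ℕ)) := fun M => by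
    rw [mem_iff_code, hcol]
    simp
  have hq : ∀ M : Set (Sym2 W),
      (s(c (A + 1 : ℕ), c ((A + 1 : ℕ) + 1)) ∈ M ↔ code col c M (A + 1 : ℕ)) := fun M => by
    rw [mem_iff_code, (hcolf (A + 1)).2 (by omega)]
    simp
  have hq' : ∀ M ∈ perfectMatchings J,
      (s(c (A + 2 : ℕ), c ((A + 2 : ℕ) + 1)) ∈ M ↔ ¬ code col c M (A + 1 : ℕ)) := fun M hM => by
    rw [mem_iff_code, (hcodes M hM).2.1 (A + 2) (by omega) (by omega), (hcol' (A + 2)).2 (by omega)]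
    simp
  intro X Y hne
  refine Uniform.of_square perfectMatchings_antichain _ _ _ _
    (fun M hM => (hp' M).trans (not_congr (hp M hM)).symm)
    (fun M hM => (hq' M hM).trans (not_congr (hq M)).symm) ?_ (fun M hM => hM.1) hne
  intro x
  -- it suffices to give the dependence on the codes
  have key : ∀ g : Prop → Prop → Prop, (∀ a b, g (¬ a) b → g a (¬ b) → g a b) →
      (∀ M ∈ perfectMatchings J, (x ∈ M ↔ g (code col c M (0 : ℕ)) (code col c M (A + 1 : ℕ)))) →
      ∃ g : Prop → Prop → Prop, (∀ M ∈ perfectMatchings J,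
        (x ∈ M ↔ g (s(c (1 : ℕ), c ((1 : ℕ) + 1)) ∈ M)
          (s(c (A + 1 : ℕ), c ((A + 1 : ℕ) + 1)) ∈ M))) ∧
        ∀ a b, g (¬ a) b → g a (¬ b) → g a b :=
    fun g hg hx => ⟨g, fun M hM => by rw [hp M hM, hq M]; exact hx M hM, hg⟩
  by_cases hx : x ∈ J.edgeSet
  swap
  · exact key (fun _ _ => False) (fun _ _ h _ => h) fun M hM =>
      iff_of_false (fun hxM => hx ((mem_perfectMatchings.1 hM).1 hxM)) id
  rcases h.edge_cases hx with ⟨t, rfl⟩ | ⟨p, rfl⟩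
  · obtain ⟨i, hi, rfl⟩ : ∃ i < n, (i : ZMod n) = t :=
      ⟨t.val, ZMod.val_lt t, ZMod.natCast_rightInverse t⟩
    have hci : col (c (i : ZMod n)) = false ↔ i % 2 = 1 := hcolf i
    rcases lt_trichotomy i A with hiA | rfl | hiA
    · rcases Nat.mod_two_eq_zero_or_one i with hi2 | hi2
      · refine key (fun a _ => ¬ a) (fun a b => by tauto) fun M hM => ?_
        rw [mem_iff_code, (hcodes M hM).1 i hiA, hci]
        simp [hi2]
      · refine key (fun a _ => a) (fun a b => by tauto) fun M hM => ?_
        rw [mem_iff_code, (hcodes M hM).1 i hiA, hci]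
        simp [hi2]
    · refine key (fun a b => ¬ (a ∨ b)) (fun a b => by tauto) fun M hM => ?_
      rw [mem_iff_code, (hcodes M hM).2.2.1, hci]
      simp [hA2]
    · by_cases hin : i = n - 1
      · subst hin
        refine key (fun a b => a ∧ b) (fun a b => by tauto) fun M hM => ?_
        rw [mem_iff_code, (hcodes M hM).2.2.2.1, hci]
        simp [show (n - 1) % 2 = 1 by omega]
      · rcases Nat.mod_two_eq_zero_or_one i with hi2 | hi2
        · refine key (fun _ b => ¬ b) (fun a b => by tauto) fun M hM => ?_
          rw [mem_iff_code, (hcodes M hM).2.1 i hiA (by omega), hci]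
          simp [hi2]
        · refine key (fun _ b => b) (fun a b => by tauto) fun M hM => ?_
          rw [mem_iff_code, (hcodes M hM).2.1 i hiA (by omega), hci]
          simp [hi2]
  · have hpe : p.edge = s(c (0 : ℕ), c (A + 1 : ℕ)) ∨ p.edge = s(c (A : ℕ), c (n - 1 : ℕ)) :=
      ((hch _ _).1 p.2.1).imp (congrArg (Sym2.map c)) (congrArg (Sym2.map c))
    rcases hpe with hpe | hpe
    · rw [hpe] at key ⊢
      exact key (fun a b => a ∧ ¬ b) (fun a b => by tauto) fun M hM => (hcodes M hM).2.2.2.2.1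
    · rw [hpe] at key ⊢
      exact key (fun a b => ¬ a ∧ b) (fun a b => by tauto) fun M hM => (hcodes M hM).2.2.2.2.2

/-- A Hamilton cycle whose chords have pairwise disjoint or pairwise covering arcs. Exchanging the
colours turns the arcs into their complements, so disjoint arcs can be assumed. -/
lemma facesUniform_of_arcs [Finite W]
    (harc : ∀ p p' : OrientedChord J col c, p ≠ p' →
      Disjoint p.toArc p'.toArc ∨ p.toArc ∪ p'.toArc = Set.univ) :
    FacesUniform (perfectMatchings J) := by
  have := h.neZero
  have hfin : ∀ col' : J.Coloring Bool, Finite (OrientedChord J col' c) := fun _ => inferInstance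
  by_cases hdis : ∀ p p' : OrientedChord J col c, p ≠ p' → Disjoint p.toArc p'.toArc
  · obtain ⟨q, a, hq⟩ := h.exists_isBumpFamily hdis
    exact fun X Y hne => hq.uniform_face X Y hne
  -- the kind of a pair of chords is the same for two pairs that share a chord
  have hshare : ∀ p p' p'' : OrientedChord J col c, Disjoint p.toArc p'.toArc →
      p'.toArc ∪ p''.toArc = Set.univ → p ≠ p'' → False := by
    intro p p' p'' h1 h2 hne
    have hsub : p.toArc ⊆ p''.toArc := fun t ht =>
      (Set.eq_univ_iff_forall.1 h2 t).resolve_left (Set.disjoint_left.1 h1 ht)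
    rcases harc p p'' hne with h3 | h3
    · exact Set.disjoint_left.1 h3 (left_mem_arc p.ne) (hsub (left_mem_arc p.ne))
    · rw [Set.union_eq_self_of_subset_left hsub, Set.eq_univ_iff_forall] at h3
      exact right_notMem_arc (h3 p''.1.2)
  push Not at hdis
  obtain ⟨p₁, p₂, hne, hnd⟩ := hdis
  have hcov₁ := (harc p₁ p₂ hne).resolve_left hnd
  have hcov : ∀ p p' : OrientedChord J col c, p ≠ p' → p.toArc ∪ p'.toArc = Set.univ := by
    intro p p' hpp
    refine (harc p p' hpp).resolve_left fun hd => ?_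
    -- the pair `p₁`, `q` with `q` one of `p`, `p'` covers
    have hq : ∀ q : OrientedChord J col c, q ≠ p₁ → p₁.toArc ∪ q.toArc = Set.univ := by
      intro q hq
      refine (harc p₁ q hq.symm).resolve_left fun hd => ?_
      by_cases hq2 : q = p₂
      · exact hnd (hq2 ▸ hd)
      · exact hshare q p₁ p₂ hd.symm hcov₁ hq2
    by_cases h1 : p = p₁
    · subst h1
      by_cases h3 : p' = p₂
      · exact hnd (h3 ▸ hd)
      · exact hshare p' p p₂ hd.symm hcov₁ h3
    · by_cases h3 : p' = p₁
      · subst h3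
        by_cases h4 : p = p₂
        · exact hnd (h4 ▸ hd.symm)
        · exact hshare p p' p₂ hd hcov₁ h4
      · exact hshare p p' p₁ hd (by rw [Set.union_comm]; exact hq p' h3) h1
  obtain ⟨q, a, hq⟩ := h.swap.exists_isBumpFamily (by
    intro p p' hpp
    have hp : ∀ p : OrientedChord J (swapColor col) c,
        ∃ q : OrientedChord J col c, q.toArc = p.toArcᶜ ∧ q.1 = p.1.swap := by
      intro p
      refine ⟨⟨p.1.swap, p.2.1.symm, ?_⟩, ?_, rfl⟩
      · have := p.col_right
        rw [swapColor_apply] at this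
        simpa using this
      · exact arc_swap p.ne
    obtain ⟨q, hq, hqp⟩ := hp p
    obtain ⟨q', hq', hqp'⟩ := hp p'
    have hne : q ≠ q' := by
      rintro rfl
      exact hpp (Subtype.ext (Prod.swap_injective (hqp.symm.trans hqp')))
    have := hcov q q' hne
    rw [hq, hq', ← Set.compl_inter] at this
    rw [Set.disjoint_iff_inter_eq_empty]
    exact Set.compl_univ_iff.1 this)
  exact fun X Y hne => hq.uniform_face X Y hne

end IsColoredHamiltonCycle
end Square

/-! ### The four classes of elementary components -/

section Components

variable {W : Type*} {J : SimpleGraph W}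

lemma facesUniform_of_isK₂ (hJ : IsK₂ J) : FacesUniform (perfectMatchings J) := by
  obtain ⟨e⟩ := hJ
  have hsub : ∀ M ∈ perfectMatchings J, M = J.edgeSet := by
    intro M hM
    obtain ⟨h1, h2⟩ := mem_perfectMatchings.1 hM
    refine h1.antisymm fun x hx => ?_
    induction x with | _ v w => ?_
    obtain ⟨w', hw', -⟩ := h2 v
    have h3 : e v ≠ e w := e.injective.ne (J.ne_of_adj hx)
    have h4 : e v ≠ e w' := e.injective.ne (J.ne_of_adj (h1 hw'))
    have : w = w' := e.injective (by omega)
    rwa [this]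
  rintro X Y ⟨M₀, h₀⟩
  have : face (perfectMatchings J) X Y = {M₀} := Set.eq_singleton_iff_unique_mem.2
    ⟨h₀, fun M hM => (hsub M hM.1).trans (hsub M₀ h₀.1).symm⟩
  exact ⟨0, this ▸ Uniform.singleton M₀⟩

/-- An even cycle is a Hamilton cycle without chords, to which the statement on arcs applies. -/
lemma facesUniform_of_inB₀ [Finite W] (col : J.Coloring Bool) (hJ : InB₀ J) :
    FacesUniform (perfectMatchings J) := by
  obtain ⟨k, hk, ⟨e⟩⟩ := hJ
  obtain ⟨m, hm⟩ : ∃ m, 2 * k = m + 2 := ⟨2 * k - 2, by omega⟩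
  rw [hm] at e
  let c : ZMod (m + 2) → W := fun z => e.symm (z : Fin (m + 2))
  have hadj : ∀ x y : ZMod (m + 2), J.Adj (c x) (c y) ↔ x - y = 1 ∨ y - x = 1 := by
    intro x y
    exact e.symm.map_adj_iff.trans cycleGraph_adj
  have h : IsColoredHamiltonCycle J col c := .mk' (by omega) e.symm.bijective
    (fun z => (hadj _ _).2 (Or.inr (add_sub_cancel_left z 1))) col
  refine h.facesUniform_of_arcs fun p => ?_
  obtain ⟨h1, h2, h3⟩ := p.2.1
  rcases (hadj _ _).1 h1 with h4 | h4
  · exact absurd (by rw [← h4]; ring) h3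
  · exact absurd (by rw [← h4]; ring) h2

section HamiltonCycle

variable {n : ℕ} {c : ZMod n → W} {col : J.Coloring Bool}

lemma OrientedChord.eq_of_edge_eq (hc : Function.Injective c) (p : OrientedChord J col c)
    {x y : ZMod n} (he : p.edge = s(c x, c y)) :
    (col (c x) = true → p.1 = (x, y)) ∧ (col (c x) = false → p.1 = (y, x)) := by
  rcases Sym2.eq_iff.1 he with ⟨h1, h2⟩ | ⟨h1, h2⟩
  · refine ⟨fun _ => Prod.ext (hc h1) (hc h2), fun h3 => ?_⟩
    rw [← h1, p.2.2] at h3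
    exact absurd h3 (by simp)
  · refine ⟨fun h3 => ?_, fun _ => Prod.ext (hc h1) (hc h2)⟩
    rw [← h2, p.col_right] at h3
    exact absurd h3 (by simp)

/-- The arcs of parallel chords are disjoint or cover the cycle. -/
lemma arcs_of_areParallel [NeZero n] {r : W} {C : J.Walk r r} (hC : ParametrizesCycle C c)
    (hc : Function.Injective c) (p p' : OrientedChord J col c)
    (h : AreParallel col C p.edge p'.edge) :
    Disjoint p.toArc p'.toArc ∨ p.toArc ∪ p'.toArc = Set.univ := by
  have key : ∀ (s : ZMod n) (P Q T : ℕ), 0 < P → P < Q → Q < T → T < n →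
      ∀ p p' : OrientedChord J col c, p.edge = s(c (s + (0 : ℕ)), c (s + P)) →
      p'.edge = s(c (s + Q), c (s + T)) → col (c (s + (0 : ℕ))) = col (c (s + Q)) →
      Disjoint p.toArc p'.toArc ∨ p.toArc ∪ p'.toArc = Set.univ := by
    intro s P Q T h0 h1 h2 h3 p p' e e' hcol
    have hp := p.eq_of_edge_eq hc e
    have hp' := p'.eq_of_edge_eq hc e'
    have hex : ∀ t, ∃ i < n, t = s + (i : ℕ) := fun t =>
      ⟨(t - s).val, ZMod.val_lt _, by simp⟩
    unfold OrientedChord.toArc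
    cases hx : col (c (s + (0 : ℕ)))
    · right
      rw [hp.2 hx, hp'.2 (hcol ▸ hx), Set.eq_univ_iff_forall]
      intro t
      obtain ⟨i, hi, rfl⟩ := hex t
      rw [Set.mem_union, natCast_mem_arc hi (by omega) (by omega),
        natCast_mem_arc hi (by omega) (by omega)]
      split_ifs <;> omega
    · left
      rw [hp.1 hx, hp'.1 (hcol ▸ hx), Set.disjoint_left]
      intro t
      obtain ⟨i, hi, rfl⟩ := hex t
      rw [natCast_mem_arc hi (by omega) (by omega), natCast_mem_arc hi (by omega) (by omega)]
      split_ifs <;> omega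
  obtain ⟨x₁, x₂, y₁, y₂, e1, e2, hcol, hord⟩ := h
  obtain ⟨φ, ⟨s, hs | hs⟩, P, Q, T, h0, h1, h2, h3, rfl, rfl, rfl, rfl⟩ := hC.orderedAlong_iff.1 hord
  · simp only [hs] at e1 e2 hcol
    exact key s P Q T h0 h1 h2 h3 p p' e1 e2 hcol
  · have hrev : ∀ i j : ℕ, i + j = T → φ i = s - (T : ℕ) + (j : ℕ) := by
      rintro i j rfl
      rw [hs]
      push_cast
      ring
    rw [hrev 0 T (by omega), hrev P (T - P) (by omega)] at e1
    rw [hrev Q (T - Q) (by omega), hrev T 0 (by omega)] at e2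
    rw [hrev 0 T (by omega), hrev Q (T - Q) (by omega)] at hcol
    have a1 := col.valid (e1 ▸ p.edge_mem : s(_, _) ∈ J.edgeSet)
    have a2 := col.valid (e2 ▸ p'.edge_mem : s(_, _) ∈ J.edgeSet)
    rw [Sym2.eq_swap] at e1 e2
    have := key (s - (T : ℕ)) (T - Q) (T - P) T (by omega) (by omega) (by omega) h3 p' p e2 e1 (by
      revert a1 a2
      rw [hcol]
      generalize col (c (s - (T : ℕ) + (0 : ℕ))) = b₁
      generalize col (c (s - (T : ℕ) + (T - Q : ℕ))) = b₂
      generalize col (c (s - (T : ℕ) + (T - P : ℕ))) = b₃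
      revert b₁ b₂ b₃
      decide)
    rwa [disjoint_comm, Set.union_comm] at this

end HamiltonCycle

lemma facesUniform_of_inB₃ [Finite W] (hJ : InB₃ J) : FacesUniform (perfectMatchings J) := by
  classical
  obtain ⟨col, r, C, hC, hpar⟩ := hJ
  have hC' : C.IsHamiltonianCycle := by convert hC
  have h3 := hC'.isCycle.three_le_length
  have : NeZero C.length := ⟨by omega⟩
  obtain ⟨c, hc⟩ := ParametrizesCycle.of_isCycle hC'.isCycle
  have hinj := hc.injective hC'.isCycle
  have h : IsColoredHamiltonCycle J col c := .mk' h3 ⟨hinj, hc.surjective hC'⟩ hc.adj col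
  refine h.facesUniform_of_arcs fun p p' hne => arcs_of_areParallel hc hinj p p' ?_
  exact hpar ((hc.mem_chords hinj).2 ⟨_, _, p.2.1, rfl⟩) ((hc.mem_chords hinj).2 ⟨_, _, p'.2.1, rfl⟩)
    fun he => hne (OrientedChord.edge_injective hinj he)

lemma InB₁.inB₃ (hJ : InB₁ J) : InB₃ J := by
  obtain ⟨hbip, r, C, hC, e, he⟩ := hJ
  refine ⟨J.recolorOfEquiv finTwoEquiv hbip.some, r, C, hC, ?_⟩
  rw [he]
  exact Set.pairwise_singleton _ _

lemma facesUniform_of_inB₂ [Finite W] (hJ : InB₂ J) : FacesUniform (perfectMatchings J) := by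
  classical
  obtain ⟨col, r, C, hC, e, f, hef, hch, x₁, x₂, y₁, y₂, rfl, rfl, hcol, hord, he1, he2⟩ := hJ
  have hC' : C.IsHamiltonianCycle := by convert hC
  have h3 := hC'.isCycle.three_le_length
  have : NeZero C.length := ⟨by omega⟩
  obtain ⟨c, hc⟩ := ParametrizesCycle.of_isCycle hC'.isCycle
  have hinj := hc.injective hC'.isCycle
  have h : IsColoredHamiltonCycle J col c := .mk' h3 ⟨hinj, hc.surjective hC'⟩ hc.adj col
  obtain ⟨φ, hφ, P, Q, T, h0, hPQ, hQT, hTn, rfl, rfl, rfl, rfl⟩ := hc.orderedAlong_iff.1 hord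
  have h' := h.comp_frame hφ
  have hnext : ∀ i j : ℕ, s(c (φ i), c (φ j)) ∈ C.edges →
      (i + 1) % C.length = j % C.length ∨ (j + 1) % C.length = i % C.length := by
    intro i j hij
    obtain ⟨z, hz⟩ := hc.mem_edges.1 hij
    have h1 : φ j = φ i + 1 ∨ φ i = φ j + 1 := by
      rcases Sym2.eq_iff.1 hz with ⟨h1, h2⟩ | ⟨h1, h2⟩
      · exact Or.inl (by rw [hinj h1, hinj h2])
      · exact Or.inr (by rw [hinj h1, hinj h2])
    simp only [← ZMod.natCast_eq_natCast_iff']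
    obtain ⟨s, hs | hs⟩ := hφ <;> rw [hs, hs] at h1 <;> push_cast <;> rcases h1 with h1 | h1
    · left; linear_combination -h1
    · right; linear_combination -h1
    · right; linear_combination -h1
    · left; linear_combination -h1
  obtain rfl : Q = P + 1 := by
    have hlt : Q + 1 < C.length := by omega
    have := hnext Q P he2
    rw [Nat.mod_eq_of_lt hlt, Nat.mod_eq_of_lt (by omega), Nat.mod_eq_of_lt (by omega),
      Nat.mod_eq_of_lt (by omega)] at this
    omega
  obtain rfl : T = C.length - 1 := by
    by_contra hne
    have := hnext 0 T he1
    rw [Nat.mod_eq_of_lt (by omega), Nat.mod_eq_of_lt (by omega), Nat.mod_eq_of_lt (by omega),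
      Nat.mod_eq_of_lt (by omega)] at this
    omega
  have hP2 : P % 2 = 0 := (color_frame col hc.adj hφ P).1 hcol.symm
  have hchord : ∀ x y : ZMod C.length, IsChord J (fun z => c (φ z)) x y ↔
      s(x, y) = s(((0 : ℕ) : ZMod C.length), ((P + 1 : ℕ) : ZMod C.length)) ∨
      s(x, y) = s((P : ZMod C.length), ((C.length - 1 : ℕ) : ZMod C.length)) := by
    intro x y
    have h1 : IsChord J (fun z => c (φ z)) x y ↔ s(c (φ x), c (φ y)) ∈ chords C := by
      rw [hφ.isChord_iff, hc.mem_chords hinj]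
      constructor
      · exact fun h1 => ⟨_, _, h1, rfl⟩
      · rintro ⟨i, j, h1, h2⟩
        exact h1.congr (Sym2.map.injective hinj h2.symm)
    have hmap : ∀ x y z w : ZMod C.length,
        s(c (φ x), c (φ y)) = s(c (φ z), c (φ w)) ↔ s(x, y) = s(z, w) := fun x y z w =>
      (Sym2.map.injective (hinj.comp hφ.injective)).eq_iff (a := s(x, y)) (b := s(z, w))
    rw [h1, hch, Set.mem_insert_iff, Set.mem_singleton_iff, hmap, hmap]
  cases hcol0 : col (c (φ (0 : ℕ)))
  · exact h'.swap.facesUniform_of_stronglyCrossed (by rw [swapColor_apply, hcol0]; rfl) h0 hP2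
      (by omega) hchord
  · exact h'.facesUniform_of_stronglyCrossed hcol0 h0 hP2 (by omega) hchord

end Components

/-! ### Products over elementary components, and conformal subgraphs -/

section Image

variable {E E' : Type*}

/-- Uniformity does not depend on the ground set. -/
lemma Uniform.image [Finite E] [Finite E'] {F : Set (Set E')} {d : ℕ} (φ : E' → E)
    (hφ : Function.Injective φ) (h : Uniform F d) : Uniform ((φ '' ·) '' F) d := by
  have hcard : ∀ S : Set E, (φ ⁻¹' S).ncard ≤ S.ncard := fun S => by
    rw [← Set.ncard_image_of_injective _ hφ]
    exact Set.ncard_le_ncard (Set.image_preimage_subset _ _)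
  have hinter : ∀ S : Set E, ∀ M : Set E', S ∩ φ '' M = φ '' (φ ⁻¹' S ∩ M) := fun S M => by
    rw [Set.inter_comm, ← Set.image_inter_preimage, Set.inter_comm]
  have hblocks : ∀ M ∈ F, ∀ S, Blocks ((φ '' ·) '' F) (φ '' M) S → Blocks F M (φ ⁻¹' S) := by
    intro M hM S hS
    refine ⟨?_, fun M' hM' hne => ?_⟩
    · have := hS.1
      rw [Set.disjoint_iff_inter_eq_empty, hinter, Set.image_eq_empty] at this
      exact Set.disjoint_iff_inter_eq_empty.2 this
    · have := hS.2 _ ⟨M', hM', rfl⟩ fun he => hne (hφ.image_injective he)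
      rw [hinter] at this
      exact this.of_image
  refine ⟨?_, fun S hS => ?_, ?_, ?_⟩
  · obtain ⟨S, hS, hd⟩ := h.exists_sep
    refine ⟨φ '' S, ?_, by rwa [Set.ncard_image_of_injective _ hφ]⟩
    rintro _ ⟨M, hM, rfl⟩ _ ⟨N, hN, rfl⟩ he
    rw [hinter, hinter, Set.preimage_image_eq _ hφ] at he
    exact congrArg _ (hS M hM N hN (hφ.image_injective he))
  · refine (h.le_sep (φ ⁻¹' S) fun M hM N hN he => hφ.image_injective ?_).trans (hcard S)
    refine hS _ ⟨M, hM, rfl⟩ _ ⟨N, hN, rfl⟩ ?_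
    rw [hinter, hinter, he]
  · rintro _ ⟨M, hM, rfl⟩
    obtain ⟨S, hS, hd⟩ := h.exists_block M hM
    refine ⟨φ '' S, ⟨?_, ?_⟩, by rwa [Set.ncard_image_of_injective _ hφ]⟩
    · exact (Set.disjoint_image_iff hφ).2 hS.1
    · rintro _ ⟨M', hM', rfl⟩ hne
      rw [hinter, Set.preimage_image_eq _ hφ]
      exact (hS.2 M' hM' fun he => hne (by rw [he])).image _
  · obtain ⟨M, hM, hMS⟩ := h.le_block
    exact ⟨_, ⟨M, hM, rfl⟩, fun S hS => (hMS _ (hblocks M hM S hS)).trans (hcard S)⟩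

end Image

section Glue

variable {V : Type*} {G : SimpleGraph V}

section Subtype

variable {p : V → Prop} {J : SimpleGraph {v // p v}}

lemma mk_mem_image_val {M : Set (Sym2 {v // p v})} {v w : V} :
    s(v, w) ∈ Sym2.map Subtype.val '' M ↔ ∃ (hv : p v) (hw : p w), s(⟨v, hv⟩, ⟨w, hw⟩) ∈ M := by
  constructor
  · rintro ⟨e, he, hvw⟩
    induction e with | _ a b => ?_
    rcases Sym2.eq_iff.1 hvw with ⟨rfl, rfl⟩ | ⟨rfl, rfl⟩
    · exact ⟨a.2, b.2, he⟩
    · exact ⟨b.2, a.2, by rw [Sym2.eq_swap]; exact he⟩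
  · rintro ⟨hv, hw, h⟩
    exact ⟨_, h, rfl⟩

/-- A perfect matching of a subgraph and one of the rest of the graph form a perfect matching. -/
lemma glue_mem_perfectMatchings {M : Set (Sym2 {v // p v})} {N : Set (Sym2 V)}
    (hM : M ∈ perfectMatchings J) (hJ : ∀ a b, J.Adj a b → G.Adj a.1 b.1) (hN : N ⊆ G.edgeSet)
    (hNp : ∀ v w, s(v, w) ∈ N → ¬ p v) (hNu : ∀ v, ¬ p v → ∃! w, s(v, w) ∈ N) :
    Sym2.map Subtype.val '' M ∪ N ∈ perfectMatchings G := by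
  obtain ⟨h1, h2⟩ := mem_perfectMatchings.1 hM
  refine mem_perfectMatchings.2 ⟨?_, fun v => ?_⟩
  · rintro e (⟨e, he, rfl⟩ | he)
    · induction e with | _ a b => ?_
      exact hJ _ _ (h1 he)
    · exact hN he
  · by_cases hv : p v
    · obtain ⟨w, hw, hu⟩ := h2 ⟨v, hv⟩
      refine ⟨w.1, Or.inl (mk_mem_image_val.2 ⟨hv, w.2, hw⟩), ?_⟩
      rintro w' (hw' | hw')
      · obtain ⟨_, hpw, h3⟩ := mk_mem_image_val.1 hw'
        exact congrArg Subtype.val (hu _ h3)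
      · exact absurd hv (hNp _ _ hw')
    · obtain ⟨w, hw, hu⟩ := hNu v hv
      refine ⟨w, Or.inr hw, ?_⟩
      rintro w' (hw' | hw')
      · exact absurd (mk_mem_image_val.1 hw').1 hv
      · exact hu _ hw'

lemma restrict_mem_perfectMatchings {M : Set (Sym2 V)} (hM : M ∈ perfectMatchings G)
    (hJ : ∀ v w (hv : p v), s(v, w) ∈ M → ∃ hw : p w, J.Adj ⟨v, hv⟩ ⟨w, hw⟩) :
    Sym2.map Subtype.val ⁻¹' M ∈ perfectMatchings J := by
  obtain ⟨h1, h2⟩ := mem_perfectMatchings.1 hM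
  refine mem_perfectMatchings.2 ⟨fun e he => ?_, fun v => ?_⟩
  · induction e with | _ a b => ?_
    exact (hJ a.1 b.1 a.2 he).2
  · obtain ⟨w, hw, hu⟩ := h2 v
    obtain ⟨hpw, -⟩ := hJ v.1 w v.2 hw
    exact ⟨⟨w, hpw⟩, hw, fun w' hw' => Subtype.ext (hu _ hw')⟩

end Subtype

/-- The edges of a perfect matching stay within the elementary components. -/
lemma mem_component_of_mem {M : Set (Sym2 V)} (hM : M ∈ perfectMatchings G) {v w : V}
    (hvw : s(v, w) ∈ M) : (allowedGraph G).Adj v w := by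
  rw [allowedGraph, fromEdgeSet_adj]
  exact ⟨⟨M, hM, hvw⟩, G.ne_of_adj ((mem_perfectMatchings.1 hM).1 hvw)⟩

/-- The perfect matchings of a graph are the products of perfect matchings of its elementary
components, and so are those in a face. -/
lemma exists_uniform_face [Finite V]
    (h : ∀ K : ElementaryComponent G, FacesUniform (perfectMatchings K.toSimpleGraph)) :
    FacesUniform (perfectMatchings G) := by
  classical
  intro X Y hne
  have := Fintype.ofFinite (ElementaryComponent G)
  let val : ∀ K : ElementaryComponent G, Sym2 K → Sym2 V := fun K => Sym2.map Subtype.val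
  have hval : ∀ K, Function.Injective (val K) := fun K => Sym2.map.injective Subtype.val_injective
  let C : ElementaryComponent G → Set (Sym2 V) := fun K => Set.range (val K)
  have hCmem : ∀ K v w, s(v, w) ∈ C K ↔ v ∈ K ∧ w ∈ K := by
    intro K v w
    have := mk_mem_image_val (p := fun v => v ∈ K) (M := Set.univ) (v := v) (w := w)
    rw [Set.image_univ] at this
    refine this.trans ⟨fun ⟨h1, h2, _⟩ => ⟨h1, h2⟩, fun ⟨h1, h2⟩ => ⟨h1, h2, trivial⟩⟩
  have hadj : ∀ {M}, M ∈ perfectMatchings G → ∀ {v w}, s(v, w) ∈ M →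
      ∀ K : ElementaryComponent G, v ∈ K → w ∈ K := fun hM v w hvw K hv =>
    (K.mem_supp_congr_adj (mem_component_of_mem hM hvw)).1 hv
  have huniq : ∀ {K K' : ElementaryComponent G} {v}, v ∈ K → v ∈ K' → K = K' := by
    intro K K' v hv hv'
    exact (ConnectedComponent.mem_supp_iff _ _ |>.1 hv).symm.trans
      (ConnectedComponent.mem_supp_iff _ _ |>.1 hv')
  have hself : ∀ v, v ∈ (allowedGraph G).connectedComponentMk v := fun v => rfl
  -- the part of a face inside a component is a face of the family of perfect matchings of it
  have hface : ∀ K, (· ∩ C K) '' face (perfectMatchings G) X Y =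
      (val K '' ·) '' face (perfectMatchings K.toSimpleGraph) (val K ⁻¹' X) (val K ⁻¹' Y) := by
    intro K
    apply Set.Subset.antisymm
    · rintro _ ⟨M, ⟨hM, hX, hY⟩, rfl⟩
      refine ⟨val K ⁻¹' M, ⟨?_, Set.preimage_mono hX, hY.preimage _⟩,
        Set.image_preimage_eq_inter_range⟩
      refine restrict_mem_perfectMatchings hM fun v w hv hvw => ⟨hadj hM hvw K hv, ?_⟩
      exact (K.toSimpleGraph_adj _ _).2 (mem_component_of_mem hM hvw)
    · rintro _ ⟨M, ⟨hM, hX, hY⟩, rfl⟩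
      obtain ⟨M₀, hM₀, hX₀, hY₀⟩ := hne
      have h0 := mem_perfectMatchings.1 hM₀
      have hmem : ∀ v w, s(v, w) ∈ M₀ \ C K ↔ s(v, w) ∈ M₀ ∧ v ∉ K := by
        intro v w
        rw [Set.mem_sdiff, hCmem]
        refine and_congr_right fun hvw => ⟨fun h1 hv => h1 ⟨hv, hadj hM₀ hvw K hv⟩, ?_⟩
        exact fun h1 h2 => h1 h2.1
      refine ⟨val K '' M ∪ M₀ \ C K, ⟨?_, ?_, ?_⟩, ?_⟩
      · refine glue_mem_perfectMatchings hM
          (fun a b hab => allowedGraph_le ((K.toSimpleGraph_adj a.2 b.2).1 hab))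
          (Set.sdiff_subset.trans h0.1) (fun v w hvw => ((hmem v w).1 hvw).2) fun v hv => ?_
        obtain ⟨w, hw, hu⟩ := h0.2 v
        exact ⟨w, (hmem v w).2 ⟨hw, hv⟩, fun w' hw' => hu w' ((hmem v w').1 hw').1⟩
      · intro e he
        by_cases heC : e ∈ C K
        · obtain ⟨e, rfl⟩ := heC
          exact Or.inl ⟨e, hX he, rfl⟩
        · exact Or.inr ⟨hX₀ he, heC⟩
      · rw [Set.disjoint_union_right]
        refine ⟨?_, hY₀.mono_right Set.sdiff_subset⟩
        rw [Set.disjoint_left]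
        rintro _ he ⟨e, heM, rfl⟩
        exact Set.disjoint_left.1 hY he heM
      · show (val K '' M ∪ M₀ \ C K) ∩ C K = val K '' M
        rw [Set.union_inter_distrib_right, Set.sdiff_inter_self, Set.union_empty,
          Set.inter_eq_left]
        exact Set.image_subset_range _ _
  have hd : ∀ K, ∃ d, Uniform ((· ∩ C K) '' face (perfectMatchings G) X Y) d := by
    intro K
    rw [hface]
    obtain ⟨d, hd⟩ := h K (val K ⁻¹' X) (val K ⁻¹' Y) (by
      have := hne.image (· ∩ C K)
      rw [hface] at this
      exact this.of_image)
    exact ⟨d, hd.image _ (hval K)⟩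
  choose d hd using hd
  refine ⟨_, Uniform.prod C ?_ ?_ ?_ d hd⟩
  · intro K K' hKK
    rw [Function.onFun, Set.disjoint_left]
    intro e he he'
    induction e with | _ v w => ?_
    exact hKK (huniq ((hCmem _ _ _).1 he).1 ((hCmem _ _ _).1 he').1)
  · intro M hM e he
    induction e with | _ v w => ?_
    exact Set.mem_iUnion.2 ⟨(allowedGraph G).connectedComponentMk v,
      (hCmem _ _ _).2 ⟨hself v, hadj hM.1 he _ (hself v)⟩⟩
  · intro m hm
    have hiff : ∀ v w, s(v, w) ∈ (⋃ K, m K ∩ C K) ↔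
        s(v, w) ∈ m ((allowedGraph G).connectedComponentMk v) := by
      intro v w
      rw [Set.mem_iUnion]
      constructor
      · rintro ⟨K, h1, h2⟩
        rwa [huniq (hself v) ((hCmem _ _ _).1 h2).1]
      · intro h1
        exact ⟨_, h1, (hCmem _ _ _).2 ⟨hself v, hadj (hm _).1 h1 _ (hself v)⟩⟩
    refine ⟨mem_perfectMatchings.2 ⟨?_, fun v => ?_⟩, ?_, ?_⟩
    · exact Set.iUnion_subset fun K =>
        Set.inter_subset_left.trans (mem_perfectMatchings.1 (hm K).1).1
    · simp only [hiff]
      exact (mem_perfectMatchings.1 (hm _).1).2 v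
    · intro e he
      induction e with | _ v w => ?_
      exact (hiff v w).2 ((hm _).2.1 he)
    · rw [Set.disjoint_iUnion_right]
      exact fun K => (hm K).2.2.mono_right Set.inter_subset_left

/-- The perfect matchings of a conformal subgraph form a face of those of the whole graph: extend
them by a fixed perfect matching of the rest. -/
theorem isStronglyUniform_of_facesUniform [Finite V] (h : FacesUniform (perfectMatchings G)) :
    IsStronglyUniform G := by
  intro H hH hHm
  obtain ⟨N₀, hN₀⟩ := hH
  obtain ⟨L₀, hL₀⟩ := hHm
  obtain ⟨hN1, hN2⟩ := mem_perfectMatchings.1 hN₀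
  set N : Set (Sym2 V) := Sym2.map (Subtype.val : {v // v ∈ H.vertsᶜ} → V) '' N₀ with hN
  let φ : Sym2 {v // v ∈ H.verts} → Sym2 V := Sym2.map Subtype.val
  have hφ : Function.Injective φ := Sym2.map.injective Subtype.val_injective
  have hNG : N ⊆ G.edgeSet := by
    rintro _ ⟨e, he, rfl⟩
    induction e with | _ a b => ?_
    exact hN1 he
  have hNp : ∀ v w, s(v, w) ∈ N → v ∉ H.verts := fun v w hvw => (mk_mem_image_val.1 hvw).1
  have hNu : ∀ v, v ∉ H.verts → ∃! w, s(v, w) ∈ N := by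
    intro v hv
    obtain ⟨w, hw, hu⟩ := hN2 ⟨v, hv⟩
    refine ⟨w.1, mk_mem_image_val.2 ⟨hv, w.2, hw⟩, fun w' hw' => ?_⟩
    obtain ⟨_, h1, h2⟩ := mk_mem_image_val.1 hw'
    exact congrArg Subtype.val (hu _ h2)
  have hdisj : Disjoint N (Set.range φ) := by
    rw [Set.disjoint_left]
    rintro _ he ⟨e, rfl⟩
    induction e with | _ a b => ?_
    exact hNp _ _ he a.2
  set Y : Set (Sym2 V) := (φ '' H.coe.edgeSet ∪ N)ᶜ with hY
  have h1 : ∀ M ∈ perfectMatchings H.coe, φ '' M ∪ N ∈ face (perfectMatchings G) N Y := by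
    intro M hM
    refine ⟨glue_mem_perfectMatchings hM (fun a b hab => H.adj_sub hab) hNG hNp hNu,
      Set.subset_union_right, ?_⟩
    rw [hY, Set.disjoint_compl_left_iff_subset]
    exact Set.union_subset_union_left _ (Set.image_mono (mem_perfectMatchings.1 hM).1)
  obtain ⟨d, hd⟩ := h N Y ⟨_, h1 L₀ hL₀⟩
  refine gf_eq_Af (hd.of_map φ hφ N hdisj h1 ?_)
  rintro M ⟨hM, hNM, hYM⟩
  rw [hY, Set.disjoint_compl_left_iff_subset] at hYM
  refine ⟨φ ⁻¹' M, restrict_mem_perfectMatchings hM fun v w hv hvw => ?_, ?_⟩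
  · rcases hYM hvw with h2 | h2
    · obtain ⟨_, h3, h4⟩ := mk_mem_image_val.1 h2
      exact ⟨h3, h4⟩
    · exact absurd hv (hNp _ _ h2)
  · rw [Set.image_preimage_eq_inter_range]
    ext e
    constructor
    · rintro (he | he)
      · exact he.1
      · exact hNM he
    · intro he
      rcases hYM he with ⟨e, -, rfl⟩ | h2
      · exact Or.inl ⟨he, e, rfl⟩
      · exact Or.inr h2

end Glue

/-- A bipartite graph whose elementary components are `K₂` or in one of the classes `𝓑ᵢ` is strongly
uniform. -/
theorem isStronglyUniform_of_components {V : Type*} [Finite V] {G : SimpleGraph V}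
    (hbip : G.IsBipartite)
    (h : ∀ K : ElementaryComponent G, IsK₂ K.toSimpleGraph ∨ InB₀ K.toSimpleGraph ∨
      InB₁ K.toSimpleGraph ∨ InB₂ K.toSimpleGraph ∨ InB₃ K.toSimpleGraph) :
    IsStronglyUniform G := by
  refine isStronglyUniform_of_facesUniform (exists_uniform_face fun K => ?_)
  let col : K.toSimpleGraph.Coloring Bool :=
    Coloring.mk (fun v => G.recolorOfEquiv finTwoEquiv hbip.some v.1) fun {v w} hvw =>
      (G.recolorOfEquiv finTwoEquiv hbip.some).valid (allowedGraph_le hvw)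
  rcases h K with hK | hK | hK | hK | hK
  · exact facesUniform_of_isK₂ hK
  · exact facesUniform_of_inB₀ col hK
  · exact facesUniform_of_inB₃ hK.inB₃
  · exact facesUniform_of_inB₂ hK
  · exact facesUniform_of_inB₃ hK

end StronglyUniform

theorem corollary3p2 {V : Type*} [Finite V] (G : SimpleGraph V)
    (hbip : G.IsBipartite) (hG : StronglyUniform.Matchable G) :
    List.TFAE [
      StronglyUniform.IsStronglyUniform G,
      ¬ StronglyUniform.IsConformalMinor StronglyUniform.A₁ G ∧
        ¬ StronglyUniform.IsConformalMinor StronglyUniform.A₂ G ∧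
        ¬ StronglyUniform.IsConformalMinor StronglyUniform.A₃ G ∧
        ¬ StronglyUniform.IsConformalMinor StronglyUniform.A₄ G,
      ∀ K : StronglyUniform.ElementaryComponent G,
        StronglyUniform.IsK₂ K.toSimpleGraph ∨
        StronglyUniform.InB₀ K.toSimpleGraph ∨ StronglyUniform.InB₁ K.toSimpleGraph ∨
        StronglyUniform.InB₂ K.toSimpleGraph ∨ StronglyUniform.InB₃ K.toSimpleGraph] := by
  tfae_have 1 → 2 := fun h => ⟨h.not_isConformalMinor_A₁, h.not_isConformalMinor_A₂,
    h.not_isConformalMinor_A₃, h.not_isConformalMinor_A₄⟩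
  tfae_have 2 → 3 := fun ⟨h₁, h₂, h₃, h₄⟩ K => by
    rcases StronglyUniform.component_of_not_isConformalMinor hbip hG h₁ h₂ h₃ h₄ K with h | h | h
    · exact Or.inl h
    · exact Or.inr (Or.inr (Or.inr (Or.inl h)))
    · exact Or.inr (Or.inr (Or.inr (Or.inr h)))
  tfae_have 3 → 1 := StronglyUniform.isStronglyUniform_of_components hbip
  tfae_finish
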